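/- **Setting.** Let $n\ge 1$ and let $X$ be a smooth manifold with a closed form $\omega\in\Omega^{n+1}(X)$ (a pre-$n$-plectic manifold). Let $\mathcal U=\{U_\alpha\}$ be a good open cover of $X$ (all nonempty finite intersections $U_{\alpha_0\cdots\alpha_i}$ are contractible), let $\mathrm{Tot}^m(\mathcal U,\Omega)=\bigoplus_{i+k=m}\check C^i(\mathcal U,\Omega^k)$ be the Čech–de Rham complex with differential $d_{\mathrm{Tot}}=\delta+(-1)^i d$ on $\check C^i(\mathcal U,\Omega^\bullet)$, and let $\mathrm{res}\colon\Omega^\bullet(X)\to\check C^0(\mathcal U,\Omega^\bullet)$ be the restriction, $\mathrm{res}(\theta)_\alpha=\theta|_{U_\alpha}$. Let $(X,\omega)$ be prequantized by a Čech–Deligne cocycle $\bar A=\sum_{i=0}^n A^{n-i}$, where $A^{n-i}\in\check C^i(\mathcal U,\Omega^{n-i})$ for $i<n$ and $A^0\in\check C^n(\mathcal U,U(1))$ is a cochain of smooth $U(1)$-valued functions, with $d_{\mathrm{Tot}}\bar A=\omega$; that is, $dA^n=\omega|_{U_\alpha}$, $\ \delta A^{n-i}=(-1)^i\,dA^{n-i-1}$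 for $0\le i\le n-2$, $\ \delta A^1=(-1)^{n-1}\,\mathrm{dlog}A^0$, $\ \delta A^0=1$, where $\mathrm{dlog}\,g=\frac1{2\pi i}g^{-1}dg$. (In particular $\omega$ is integral.) **Notation.** $\iota_{v_1\wedge\cdots\wedge v_m}=\iota_{v_m}\cdots\iota_{v_1}$, $\ \varsigma(k)=-(-1)^{k(k+1)/2}$, $\ \bar A(m)=\sum_{i=0}^n(-1)^{mi}A^{n-i}$, with $\iota_vA^0=0$. The Lie derivative of forms is $\mathcal L_v=d\iota_v+\iota_vd$; on cochains $\iota_v$ and $\mathcal L_v$ act componentwise, with $\mathcal L_vA^0=\iota_v\,\mathrm{dlog}A^0$. *The local observables* $L_\infty(X,\omega)$ are the graded vector space $L$ with $$L_0=\{v+H\in\mathfrak X(X)\oplus\Omega^{n-1}(X)\mid dH=-\iota_v\omega\},\qquad L_i=\Omega^{n-1-i}(X)\quad(1\le i\le n-1),$$ and the following brackets. Write elements of $L$ as $x=v+\theta$, with $v=0$ if $\deg x>0$. Then $l_1(\theta)=d\theta$ in positive degree and $l_1=0$ on $L_0$, $\ l_2(x_1,x_2)=[v_1,v_2]+\iota_{v_1\wedge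 v_2}\omega$, and $l_k(x_1,\dots,x_k)=\varsigma(k)\,\iota_{v_1\wedge\cdots\wedge v_k}\omega$ for $k\ge3$. *The infinitesimal quantomorphisms* $\mathrm{dgLie}_{\mathrm{Qu}}(X,\bar A)$ are the graded vector space $L'$ with $$L'_0=\{v+\bar\theta\in\mathfrak X(X)\oplus\mathrm{Tot}^{n-1}(\mathcal U,\Omega)\mid\mathcal L_v\bar A=d_{\mathrm{Tot}}\bar\theta\},\qquad L'_i=\mathrm{Tot}^{n-1-i}(\mathcal U,\Omega)\quad(1\le i\le n-1),$$ with differential $d_{\mathrm{Tot}}$ in positive degree and $0$ on $L'_0$, and with bracket $[\![v_1+\bar\theta_1,v_2+\bar\theta_2]\!]=[v_1,v_2]+\mathcal L_{v_1}\bar\theta_2-\mathcal L_{v_2}\bar\theta_1$ (again $v=0$ in positive degree). **Theorem.** $L_\infty(X,\omega)$ is an $L_\infty$-algebra, $\mathrm{dgLie}_{\mathrm{Qu}}(X,\bar A)$ is a dg Lie algebra, and the maps $f_m\colon L^{\otimes m}\to L'$ $(m\ge1)$ given, for $x_i=v_i+\theta_i$, by $$f_1(v+\theta)=v-\mathrm{res}(\theta)+\iota_v\bar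 A(1),$$ $$f_m(x_1,\dots,x_m)=\varsigma(m)\Big(\mathrm{res}\,\sum_{i=1}^m(-1)^i\,\iota_{v_1\wedge\cdots\wedge\widehat{v_i}\wedge\cdots\wedge v_m}\theta_i+\iota_{v_1\wedge\cdots\wedge v_m}\bar A(m)\Big)\qquad(2\le m\le n),$$ and $f_m=0$ for $m>n$, are graded skew-symmetric of degree $m-1$ and constitute an $L_\infty$-quasi-isomorphism $$f\colon L_\infty(X,\omega)\xrightarrow{\ \simeq\ }\mathrm{dgLie}_{\mathrm{Qu}}(X,\bar A).$$ Explicitly, $f_1$ is a quasi-isomorphism of complexes and, for all $m\ge1$ and all homogeneous $x_1,\dots,x_m\in L$, $$d_{L'}f_m(x_1,\dots,x_m)+\sum_{j+k=m+1}\ \sum_{\sigma\in\mathrm{Sh}(k,m-k)}\chi(\sigma)(-1)^{k(j-1)+1}f_j\big(l_k(x_{\sigma(1)},\dots,x_{\sigma(k)}),x_{\sigma(k+1)},\dots,x_{\sigma(m)}\big)$$ $$+\sum_{s+t=m}\ \sum_{\substack{\tau\in\mathrm{Sh}(s,m-s)\\ \tau(1)<\tau(s+1)}}\chi(\tau)(-1)^{s-1}(-1)^{(t-1)\sum_{p=1}^s|x_{\tau(p)}|}\,[\![f_s(x_{\tau(1)},\dots,x_{\tau(s)}),f_t(x_{\tau(s+1)},\dots,x_{\tau(m)})]\!]=0,$$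 where $j,k,s,t\ge1$, $d_{L'}$ is the differential of $L'$, $\mathrm{Sh}(k,m-k)$ denotes the unshuffles, and $\chi(\sigma)$ is the sign of $\sigma$ times its Koszul sign. -/

import Mathlib

open scoped Manifold ContDiff Topology
open Set

set_option linter.unusedSectionVars false

noncomputable section

namespace Plectic

/-! ### Differential forms, vector fields and Cartan calculus on a smooth manifold

`X` is a smooth manifold modelled on the finite-dimensional real vector space `E`. The tangent
space at `x` is identified with `E` through the preferred chart at `x` (this is Mathlib's
`TangentSpace`), so that a `k`-form is a function `X → E [⋀^Fin k]→L[ℝ] ℝ`, and passing to the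
coordinates of another chart is done with `tangentCoordChange`. -/

lemma two_le_infty : (2 : WithTop ℕ∞) ≤ ∞ :=
  WithTop.coe_le_coe.2 (le_top : (2 : ℕ∞) ≤ ⊤)

section Forms

variable {E : Type*} [NormedAddCommGroup E] [NormedSpace ℝ E]
  {X : Type*} [TopologicalSpace X] [ChartedSpace E X] [IsManifold 𝓘(ℝ, E) ∞ X]

/-- The coordinate expression of a (not necessarily smooth) `k`-form in the preferred chart
at `c`, i.e. its pullback along the inverse of that chart. -/
def rep {k : ℕ} (c : X) (η : X → E [⋀^Fin k]→L[ℝ] ℝ) (y : E) : E [⋀^Fin k]→L[ℝ] ℝ :=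
  (η ((extChartAt 𝓘(ℝ, E) c).symm y)).compContinuousLinearMap
    (tangentCoordChange 𝓘(ℝ, E) c ((extChartAt 𝓘(ℝ, E) c).symm y)
      ((extChartAt 𝓘(ℝ, E) c).symm y))

/-- The part of the target of the chart at `c` that lies over the open set `U`. -/
def chartDom (c : X) (U : TopologicalSpace.Opens X) : Set E :=
  (extChartAt 𝓘(ℝ, E) c).target ∩ (extChartAt 𝓘(ℝ, E) c).symm ⁻¹' U

lemma isOpen_chartDom (c : X) (U : TopologicalSpace.Opens X) :
    IsOpen (chartDom (E := E) c U) := by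
  simpa [chartDom] using (chartAt E c).isOpen_inter_preimage_symm U.2

lemma rep_add {k : ℕ} (c : X) (η ζ : X → E [⋀^Fin k]→L[ℝ] ℝ) :
    rep c (η + ζ) = rep c η + rep c ζ := by
  ext y v; simp [rep]

lemma rep_smul {k : ℕ} (c : X) (r : ℝ) (η : X → E [⋀^Fin k]→L[ℝ] ℝ) :
    rep c (r • η) = r • rep c η := by
  ext y v; simp [rep]

lemma rep_zero {k : ℕ} (c : X) : rep c (0 : X → E [⋀^Fin k]→L[ℝ] ℝ) = 0 := by
  ext y v; simp [rep]

lemma rep_change {k : ℕ} (c b : X) (η : X → E [⋀^Fin k]→L[ℝ] ℝ) {y : E}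
    (hy : y ∈ (extChartAt 𝓘(ℝ, E) c).target)
    (hb : (extChartAt 𝓘(ℝ, E) c).symm y ∈ (extChartAt 𝓘(ℝ, E) b).source) :
    rep c η y = (rep b η ((extChartAt 𝓘(ℝ, E) b)
        ((extChartAt 𝓘(ℝ, E) c).symm y))).compContinuousLinearMap
      (fderiv ℝ ((extChartAt 𝓘(ℝ, E) b) ∘ (extChartAt 𝓘(ℝ, E) c).symm) y) := by
  have hf : fderiv ℝ ((extChartAt 𝓘(ℝ, E) b) ∘ (extChartAt 𝓘(ℝ, E) c).symm) y
      = tangentCoordChange 𝓘(ℝ, E) c b ((extChartAt 𝓘(ℝ, E) c).symm y) := by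
    rw [tangentCoordChange_def, (extChartAt 𝓘(ℝ, E) c).right_inv hy]
    simp [fderivWithin_univ]
  rw [hf]
  ext v
  simp only [rep, ContinuousAlternatingMap.compContinuousLinearMap_apply]
  rw [(extChartAt 𝓘(ℝ, E) b).left_inv hb]
  congr 1
  funext i
  simp only [Function.comp]
  exact (tangentCoordChange_comp (I := 𝓘(ℝ, E))
    ⟨⟨(extChartAt 𝓘(ℝ, E) c).map_target hy, hb⟩, mem_extChartAt_source _⟩).symm

variable (E) in
/-- The space `Ω^k(U)` of smooth `k`-forms on the open set `U` (smooth in all preferred charts).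
A form on `U` is represented by its extension by zero to `X`. -/
def DForm (U : TopologicalSpace.Opens X) (k : ℕ) : Submodule ℝ (X → E [⋀^Fin k]→L[ℝ] ℝ) where
  carrier := {η | (∀ c : X, ContDiffOn ℝ ∞ (rep c η) (chartDom c U)) ∧ ∀ x ∉ U, η x = 0}
  zero_mem' := ⟨fun c => by rw [rep_zero]; exact contDiffOn_const, fun _ _ => rfl⟩
  add_mem' := by
    rintro η ζ ⟨h1, h2⟩ ⟨h3, h4⟩
    exact ⟨fun c => by rw [rep_add]; exact (h1 c).add (h3 c),
      fun x hx => by simp [h2 x hx, h4 x hx]⟩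
  smul_mem' := by
    rintro r η ⟨h1, h2⟩
    exact ⟨fun c => by rw [rep_smul]; exact contDiffOn_const.smul (h1 c),
      fun x hx => by simp [h2 x hx]⟩

/-- The exterior derivative of a form on `U`: at `x ∈ U` it is the exterior derivative of the
coordinate expression in the preferred chart at `x`. -/
def extD {k : ℕ} (U : TopologicalSpace.Opens X) (η : X → E [⋀^Fin k]→L[ℝ] ℝ) :
    X → E [⋀^Fin (k + 1)]→L[ℝ] ℝ :=
  (U : Set X).indicator fun x => extDeriv (rep x η) (extChartAt 𝓘(ℝ, E) x x)

/-- The exterior derivative can be computed in any chart. -/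
lemma rep_extD {k : ℕ} {U : TopologicalSpace.Opens X} {η : X → E [⋀^Fin k]→L[ℝ] ℝ}
    (hη : η ∈ DForm E U k) (c : X) {y : E} (hy : y ∈ chartDom (E := E) c U) :
    rep c (extD U η) y = extDeriv (rep c η) y := by
  obtain ⟨hyt, hyU⟩ := hy
  set p := (extChartAt 𝓘(ℝ, E) c).symm y with hp
  have hpU : p ∈ U := hyU
  have hps := mem_extChartAt_source (I := 𝓘(ℝ, E)) p
  rw [rep_change c p _ hyt hps]
  have h1 : rep p (extD U η) (extChartAt 𝓘(ℝ, E) p p) =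
      extDeriv (rep p η) (extChartAt 𝓘(ℝ, E) p p) := by
    ext v
    simp only [rep, ContinuousAlternatingMap.compContinuousLinearMap_apply, extChartAt_to_inv, extD]
    rw [Set.indicator_of_mem (by simpa using hpU)]
    congr 1
    funext i
    exact tangentCoordChange_self (I := 𝓘(ℝ, E)) hps
  have hsm : ContDiffAt ℝ ∞ ((extChartAt 𝓘(ℝ, E) p) ∘ (extChartAt 𝓘(ℝ, E) c).symm) y := by
    have := contDiffWithinAt_ext_coord_change (I := 𝓘(ℝ, E)) (n := ∞) p c (y := y) (by
      rw [PartialEquiv.trans_source]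
      exact ⟨hyt, hps⟩)
    rwa [ModelWithCorners.range_eq_univ, contDiffWithinAt_univ] at this
  have hev : rep c η =ᶠ[𝓝 y] fun z => (rep p η (((extChartAt 𝓘(ℝ, E) p) ∘
      (extChartAt 𝓘(ℝ, E) c).symm) z)).compContinuousLinearMap
      (fderiv ℝ ((extChartAt 𝓘(ℝ, E) p) ∘ (extChartAt 𝓘(ℝ, E) c).symm) z) := by
    have ho := (chartAt E c).isOpen_inter_preimage_symm (chartAt E p).open_source
    filter_upwards [ho.mem_nhds (x := y) ⟨by simpa using hyt, by simp [hp]⟩] with z hz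
    exact rep_change c p η (by simpa using hz.1) (by simpa using hz.2)
  have hd : DifferentiableAt ℝ (rep p η) (((extChartAt 𝓘(ℝ, E) p) ∘
      (extChartAt 𝓘(ℝ, E) c).symm) y) := by
    refine (((hη.1 p).contDiffAt ((isOpen_chartDom p U).mem_nhds ?_)).differentiableAt (by simp))
    exact ⟨(extChartAt 𝓘(ℝ, E) p).map_source hps, by
      change (extChartAt 𝓘(ℝ, E) p).symm (extChartAt 𝓘(ℝ, E) p p) ∈ U
      rwa [extChartAt_to_inv]⟩
  rw [h1, hev.extDeriv_eq, extDeriv_pullback hd hsm (by simp; exact two_le_infty)]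
  rfl

lemma extD_mem {k : ℕ} {U : TopologicalSpace.Opens X} {η : X → E [⋀^Fin k]→L[ℝ] ℝ}
    (hη : η ∈ DForm E U k) : extD U η ∈ DForm E U (k + 1) := by
  refine ⟨fun c => ?_, fun x hx => Set.indicator_of_notMem (by simpa using hx) _⟩
  have h : ContDiffOn ℝ ∞ (extDeriv (rep c η)) (chartDom c U) := by
    have h1 : ContDiffOn ℝ ∞ (fderiv ℝ (rep c η)) (chartDom c U) :=
      (hη.1 c).fderiv_of_isOpen (isOpen_chartDom c U) (by simp)
    exact (ContinuousAlternatingMap.alternatizeUncurryFinCLM ℝ E ℝ).contDiff.comp_contDiffOn h1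
  exact h.congr fun y hy => rep_extD hη c hy

lemma extD_add {k : ℕ} {U : TopologicalSpace.Opens X} {η ζ : X → E [⋀^Fin k]→L[ℝ] ℝ}
    (hη : η ∈ DForm E U k) (hζ : ζ ∈ DForm E U k) :
    extD U (η + ζ) = extD U η + extD U ζ := by
  funext x
  by_cases hx : x ∈ (U : Set X)
  · have hm : extChartAt 𝓘(ℝ, E) x x ∈ chartDom (E := E) x U :=
      ⟨mem_extChartAt_target x, by simpa using hx⟩
    have h1 := ((hη.1 x).contDiffAt ((isOpen_chartDom x U).mem_nhds hm)).differentiableAt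
      (by simp)
    have h2 := ((hζ.1 x).contDiffAt ((isOpen_chartDom x U).mem_nhds hm)).differentiableAt
      (by simp)
    simp only [extD, Set.indicator_of_mem hx, Pi.add_apply, rep_add]
    exact extDeriv_add h1 h2
  · simp [extD, Set.indicator_of_notMem hx]

lemma extD_smul {k : ℕ} {U : TopologicalSpace.Opens X} (r : ℝ) (η : X → E [⋀^Fin k]→L[ℝ] ℝ) :
    extD U (r • η) = r • extD U η := by
  funext x
  by_cases hx : x ∈ (U : Set X)
  · simp only [extD, Set.indicator_of_mem hx, Pi.smul_apply, rep_smul]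
    exact extDeriv_smul r _
  · simp [extD, Set.indicator_of_notMem hx]

lemma indicator_mem {k : ℕ} {U V : TopologicalSpace.Opens X} (h : V ≤ U)
    {η : X → E [⋀^Fin k]→L[ℝ] ℝ} (hη : η ∈ DForm E U k) :
    (V : Set X).indicator η ∈ DForm E V k := by
  refine ⟨fun c => ?_, fun x hx => Set.indicator_of_notMem (by simpa using hx) _⟩
  refine ((hη.1 c).mono fun y hy => ⟨hy.1, h hy.2⟩).congr fun y hy => ?_
  have hy2 : (extChartAt 𝓘(ℝ, E) c).symm y ∈ (V : Set X) := hy.2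
  simp only [rep]
  rw [Set.indicator_of_mem hy2]

/-- A real function on `U`, as a `0`-form on `U`. -/
def fnForm (U : TopologicalSpace.Opens X) (f : X → ℝ) : X → E [⋀^Fin 0]→L[ℝ] ℝ :=
  (U : Set X).indicator fun x => ContinuousAlternatingMap.constOfIsEmpty ℝ E (Fin 0) (f x)

lemma contDiffOn_chart {F : Type*} [NormedAddCommGroup F] [NormedSpace ℝ F]
    {U : TopologicalSpace.Opens X} {f : X → F}
    (hf : ContMDiffOn 𝓘(ℝ, E) 𝓘(ℝ, F) ∞ f U) (c : X) :
    ContDiffOn ℝ ∞ (fun y => f ((extChartAt 𝓘(ℝ, E) c).symm y)) (chartDom c U) :=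
  (hf.comp ((contMDiffOn_extChartAt_symm (I := 𝓘(ℝ, E)) (n := ∞) c).mono
    Set.inter_subset_left) (fun _ hy => hy.2)).contDiffOn

lemma fnForm_mem {U : TopologicalSpace.Opens X} {f : X → ℝ}
    (hf : ContMDiffOn 𝓘(ℝ, E) 𝓘(ℝ, ℝ) ∞ f U) : fnForm U f ∈ DForm E U 0 := by
  refine ⟨fun c => ?_, fun x hx => Set.indicator_of_notMem (by simpa using hx) _⟩
  have h0 : ContDiff ℝ ∞ (fun r : ℝ => ContinuousAlternatingMap.constOfIsEmpty ℝ E (Fin 0) r) :=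
    LinearIsometryEquiv.contDiff (𝕜 := ℝ) (n := ∞) (E := ℝ) (F := E [⋀^Fin 0]→L[ℝ] ℝ)
      (ContinuousAlternatingMap.constOfIsEmptyLIE ℝ E ℝ (Fin 0))
  refine (h0.comp_contDiffOn (contDiffOn_chart hf c)).congr fun y hy => ?_
  have hy2 : (extChartAt 𝓘(ℝ, E) c).symm y ∈ (U : Set X) := hy.2
  ext v
  simp only [rep, fnForm, ContinuousAlternatingMap.compContinuousLinearMap_apply, Function.comp]
  rw [Set.indicator_of_mem hy2]
  rfl

lemma fn_smul_mem {k : ℕ} {U : TopologicalSpace.Opens X} {f : X → ℝ}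
    (hf : ContMDiffOn 𝓘(ℝ, E) 𝓘(ℝ, ℝ) ∞ f U) {η : X → E [⋀^Fin k]→L[ℝ] ℝ}
    (hη : η ∈ DForm E U k) : (fun x => f x • η x) ∈ DForm E U k := by
  refine ⟨fun c => ?_, fun x hx => by simp [hη.2 x hx]⟩
  refine ((contDiffOn_chart hf c).smul (hη.1 c)).congr fun y hy => ?_
  ext v
  simp [rep]

variable (E X) in
/-- The space `𝔛(X)` of smooth vector fields on `X`. -/
abbrev VField : Type _ := ContMDiffSection 𝓘(ℝ, E) E ∞ (fun x : X => TangentSpace 𝓘(ℝ, E) x)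

/-- The value of a vector field at `x`, in the coordinates of the preferred chart at `x`. -/
def VField.val (v : VField E X) (x : X) : E := v x

/-- The coordinate expression of a vector field in the preferred chart at `c`. -/
def VField.rep (c : X) (v : VField E X) (y : E) : E :=
  tangentCoordChange 𝓘(ℝ, E) ((extChartAt 𝓘(ℝ, E) c).symm y) c ((extChartAt 𝓘(ℝ, E) c).symm y)
    (v.val ((extChartAt 𝓘(ℝ, E) c).symm y))

lemma VField.contDiffOn_rep (c : X) (v : VField E X) :
    ContDiffOn ℝ ∞ (v.rep c) (extChartAt 𝓘(ℝ, E) c).target := by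
  have h1 := v.contMDiff
  have h2 := ((trivializationAt E
    (TangentSpace 𝓘(ℝ, E) : X → Type _) c).contMDiffOn_section_baseSet_iff
    (IB := 𝓘(ℝ, E)) (n := ∞) (s := fun x => v x)).1 h1.contMDiffOn
  have h3 := h2.comp (contMDiffOn_extChartAt_symm (I := 𝓘(ℝ, E)) (n := ∞) c) (by
    intro y hy
    simpa using (extChartAt 𝓘(ℝ, E) c).map_target hy)
  exact h3.contDiffOn

lemma VField.val_eq_rep (c : X) (v : VField E X) {y : E}
    (hy : y ∈ (extChartAt 𝓘(ℝ, E) c).target) :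
    tangentCoordChange 𝓘(ℝ, E) c ((extChartAt 𝓘(ℝ, E) c).symm y)
      ((extChartAt 𝓘(ℝ, E) c).symm y) (v.rep c y) = v.val ((extChartAt 𝓘(ℝ, E) c).symm y) := by
  have hp := mem_extChartAt_source (I := 𝓘(ℝ, E)) ((extChartAt 𝓘(ℝ, E) c).symm y)
  rw [VField.rep, tangentCoordChange_comp (I := 𝓘(ℝ, E))
    ⟨⟨hp, (extChartAt 𝓘(ℝ, E) c).map_target hy⟩, hp⟩]
  exact tangentCoordChange_self (I := 𝓘(ℝ, E)) hp

/-- The Lie bracket of vector fields. -/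
def VField.bracket [FiniteDimensional ℝ E] (v w : VField E X) : VField E X where
  toFun := VectorField.mlieBracket 𝓘(ℝ, E) v w
  contMDiff_toFun x :=
    haveI : CompleteSpace E := FiniteDimensional.complete ℝ E
    haveI : IsManifold 𝓘(ℝ, E) (((⊤ : ℕ∞) : WithTop ℕ∞) + 1) X := by simpa
    haveI : IsManifold 𝓘(ℝ, E) (minSmoothness ℝ 2) X :=
      IsManifold.of_le (n := ∞) (by simp; exact two_le_infty)
    ContMDiffAt.mlieBracket_vectorField (m := ⊤) (n := ⊤)
      v.contMDiff.contMDiffAt w.contMDiff.contMDiffAt (by simp)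

/-- The interior product `ι_v η = η(v, ·, …, ·)`. -/
def contractRaw {k : ℕ} (v : VField E X) (η : X → E [⋀^Fin (k + 1)]→L[ℝ] ℝ) :
    X → E [⋀^Fin k]→L[ℝ] ℝ := fun x => (η x).curryLeft (v.val x)

lemma contractRaw_mem {k : ℕ} {U : TopologicalSpace.Opens X} (v : VField E X)
    {η : X → E [⋀^Fin (k + 1)]→L[ℝ] ℝ} (hη : η ∈ DForm E U (k + 1)) :
    contractRaw v η ∈ DForm E U k := by
  refine ⟨fun c => ?_, fun x hx => by simp [contractRaw, hη.2 x hx]⟩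
  have h : ContDiffOn ℝ ∞ (fun y => (Plectic.rep c η y).curryLeft (v.rep c y))
      (chartDom c U) := by
    have h0 : ContDiff ℝ ∞ (fun f : E [⋀^Fin (k + 1)]→L[ℝ] ℝ => f.curryLeft) :=
      LinearIsometry.contDiff (𝕜 := ℝ) (n := ∞) (E := E [⋀^Fin (k + 1)]→L[ℝ] ℝ)
        (F := E →L[ℝ] E [⋀^Fin k]→L[ℝ] ℝ)
        (ContinuousAlternatingMap.curryLeftLI (𝕜 := ℝ) (E := E) (F := ℝ) (n := k))
    have h1 : ContDiffOn ℝ ∞ (fun y => (Plectic.rep c η y).curryLeft) (chartDom c U) :=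
      h0.comp_contDiffOn (hη.1 c)
    exact h1.clm_apply ((v.contDiffOn_rep c).mono Set.inter_subset_left)
  refine h.congr fun y hy => ?_
  simp only [Plectic.rep, contractRaw]
  rw [ContinuousAlternatingMap.curryLeft_compContinuousLinearMap, v.val_eq_rep c hy.1]

variable (E) in
/-- The graded space `Ω^•(U)` of inhomogeneous forms on `U`: the element `η` has the component
`η k ∈ Ω^k(U)` in each degree `k`. -/
abbrev Forms (U : TopologicalSpace.Opens X) : Type _ := ∀ k : ℕ, DForm E U k

/-- The exterior derivative `d : Ω^•(U) → Ω^•(U)`. -/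
def d (U : TopologicalSpace.Opens X) : Forms E U →ₗ[ℝ] Forms E U where
  toFun η := fun k => match k with
    | 0 => 0
    | k + 1 => ⟨extD U (η k), extD_mem (η k).2⟩
  map_add' η ζ := by
    funext k
    cases k with
    | zero => simp
    | succ k => exact Subtype.ext (extD_add (η k).2 (ζ k).2)
  map_smul' r η := by
    funext k
    cases k with
    | zero => simp
    | succ k => exact Subtype.ext (extD_smul r (η k).1)

/-- The interior product `ι_v : Ω^•(U) → Ω^•(U)` with a vector field (zero on functions),
linear also in `v`. -/
def ι (U : TopologicalSpace.Opens X) : VField E X →ₗ[ℝ] Forms E U →ₗ[ℝ] Forms E U :=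
  LinearMap.mk₂ ℝ (fun v η k => ⟨contractRaw v (η (k + 1)), contractRaw_mem v (η (k + 1)).2⟩)
    (fun v w η => funext fun k => Subtype.ext <| funext fun x => map_add _ (v.val x) (w.val x))
    (fun r v η => funext fun k => Subtype.ext <| funext fun x => map_smul _ r (v.val x))
    (fun v η ζ => funext fun k => Subtype.ext <| funext fun x => by
      simp [contractRaw])
    (fun r v η => funext fun k => Subtype.ext <| funext fun x => by
      simp [contractRaw])

/-- The Lie derivative `𝓛_v = d ι_v + ι_v d` along a vector field. -/
def lieD (U : TopologicalSpace.Opens X) (v : VField E X) : Forms E U →ₗ[ℝ] Forms E U :=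
  d U ∘ₗ ι U v + ι U v ∘ₗ d U

/-- `ι_{v₁ ∧ ⋯ ∧ v_m} = ι_{v_m} ⋯ ι_{v₁}`. -/
def ιMulti (U : TopologicalSpace.Opens X) :
    (m : ℕ) → (Fin m → VField E X) → Forms E U →ₗ[ℝ] Forms E U
  | 0, _ => LinearMap.id
  | m + 1, v => ιMulti U m (Fin.tail v) ∘ₗ ι U (v 0)

/-- Restriction of forms to a smaller open set. -/
def res {U V : TopologicalSpace.Opens X} (h : V ≤ U) : Forms E U →ₗ[ℝ] Forms E V where
  toFun η := fun k => ⟨(V : Set X).indicator (η k).1, indicator_mem h (η k).2⟩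
  map_add' _ _ := funext fun _ => Subtype.ext (Set.indicator_add _ _ _)
  map_smul' r η := funext fun k => Subtype.ext (Set.indicator_const_smul (V : Set X) r (η k).1)

variable (E) in
/-- The forms of degree `m` inside `Ω^•(U)` (only `0` if `m < 0`). -/
def formsDeg (U : TopologicalSpace.Opens X) (m : ℤ) : Submodule ℝ (Forms E U) where
  carrier := {η | ∀ k : ℕ, (k : ℤ) ≠ m → η k = 0}
  zero_mem' := fun _ _ => rfl
  add_mem' h1 h2 k hk := by simp [h1 k hk, h2 k hk]
  smul_mem' r _ h k hk := by simp [h k hk]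

/-- `ϖ` is a pre-`n`-plectic form on `X`: a closed `(n+1)`-form. -/
def IsPrePlectic (n : ℕ) (ϖ : Forms E (⊤ : TopologicalSpace.Opens X)) : Prop :=
  ϖ ∈ formsDeg E ⊤ ((n : ℤ) + 1) ∧ d ⊤ ϖ = 0

variable (E) in
/-- A smooth `U(1)`-valued function on `U` (extended by `1` to `X`). -/
structure CircleFun (U : TopologicalSpace.Opens X) where
  /-- the underlying function -/
  toFun : X → Circle
  smooth : ContMDiffOn 𝓘(ℝ, E) 𝓘(ℝ, ℂ) ∞ (fun x => (toFun x : ℂ)) U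
  eq_one : ∀ x ∉ U, toFun x = 1

lemma CircleFun.smooth_re {U : TopologicalSpace.Opens X} (g : CircleFun E U) :
    ContMDiffOn 𝓘(ℝ, E) 𝓘(ℝ, ℝ) ∞ (fun x => (g.toFun x : ℂ).re) U :=
  (Complex.reCLM.contDiff (n := ∞)).contMDiff.comp_contMDiffOn g.smooth

lemma CircleFun.smooth_im {U : TopologicalSpace.Opens X} (g : CircleFun E U) :
    ContMDiffOn 𝓘(ℝ, E) 𝓘(ℝ, ℝ) ∞ (fun x => (g.toFun x : ℂ).im) U :=
  (Complex.imCLM.contDiff (n := ∞)).contMDiff.comp_contMDiffOn g.smooth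

/-- `dlog g = (1 / 2πi) g⁻¹ dg = (1 / 2π) (a db - b da)` for `g = a + i b` with values in `U(1)`;
so `dlog (exp (2πi f)) = df`. It is a `1`-form. -/
def CircleFun.dlog {U : TopologicalSpace.Opens X} (g : CircleFun E U) : Forms E U :=
  fun k => match k with
    | 1 => (2 * Real.pi)⁻¹ •
        ((⟨_, fn_smul_mem g.smooth_re (extD_mem (fnForm_mem g.smooth_im))⟩ : DForm E U 1) -
          ⟨_, fn_smul_mem g.smooth_im (extD_mem (fnForm_mem g.smooth_re))⟩)
    | _ => 0

end Forms

/-! ### The Čech–de Rham complex and Čech–Deligne cocycles -/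

section Cech

variable {E : Type*} [NormedAddCommGroup E] [NormedSpace ℝ E]
  {X : Type*} [TopologicalSpace X] [ChartedSpace E X] [IsManifold 𝓘(ℝ, E) ∞ X]
  {κ : Type*} (𝒰 : κ → TopologicalSpace.Opens X)

/-- The intersection `U_{α₀} ∩ ⋯ ∩ U_{α_{m-1}}`. -/
def inter {m : ℕ} (α : Fin m → κ) : TopologicalSpace.Opens X :=
  ⟨⋂ k, (𝒰 (α k) : Set X), isOpen_iInter_of_finite fun k => (𝒰 (α k)).2⟩

lemma inter_le {m p : ℕ} (α : Fin m → κ) (s : Fin p → Fin m) : inter 𝒰 α ≤ inter 𝒰 (α ∘ s) :=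
  fun _ hx => Set.mem_iInter.2 fun k => Set.mem_iInter.1 hx (s k)

/-- A good open cover: nonempty finite intersections are contractible. -/
def IsGoodCover : Prop :=
  (∀ x, ∃ a, x ∈ 𝒰 a) ∧
    ∀ (i : ℕ) (α : Fin (i + 1) → κ), (inter 𝒰 α : Set X).Nonempty → ContractibleSpace (inter 𝒰 α)

variable (E) in
/-- The bigraded space of Čech cochains with values in forms: `θ i α k` is the component in
`Ω^k(U_{α₀⋯α_i})` of an inhomogeneous element `θ` of `⨁_{i,k} Č^i(𝒰, Ω^k)`. -/
abbrev Tot : Type _ := ∀ (i : ℕ) (α : Fin (i + 1) → κ), Forms E (inter 𝒰 α)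

variable (E) in
/-- `Tot^m(𝒰, Ω) = ⨁_{i+k=m} Č^i(𝒰, Ω^k)` (only `0` if `m < 0`). -/
def totDeg (m : ℤ) : Submodule ℝ (Tot E 𝒰) where
  carrier := {θ | ∀ (i : ℕ) (α : Fin (i + 1) → κ) (k : ℕ), (i : ℤ) + k ≠ m → θ i α k = 0}
  zero_mem' := fun _ _ _ _ => rfl
  add_mem' h1 h2 i α k hk := by simp [h1 i α k hk, h2 i α k hk]
  smul_mem' r _ h i α k hk := by simp [h i α k hk]

variable {𝒰}

/-- The Čech differential
`(δθ)_{α₀⋯α_{i+1}} = ∑_k (-1)^k θ_{α₀⋯α̂_k⋯α_{i+1}}` restricted to `U_{α₀⋯α_{i+1}}`. -/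
def δ : Tot E 𝒰 →ₗ[ℝ] Tot E 𝒰 where
  toFun θ := fun i => match i with
    | 0 => fun _ => 0
    | i + 1 => fun α => ∑ k : Fin (i + 2),
        (-1 : ℝ) ^ (k : ℕ) • res (inter_le 𝒰 α k.succAbove) (θ i (α ∘ k.succAbove))
  map_add' θ ξ := by
    funext i α
    cases i with
    | zero => simp
    | succ i => simp [Finset.sum_add_distrib]
  map_smul' r θ := by
    funext i α
    cases i with
    | zero => simp
    | succ i => simp [Finset.smul_sum, smul_comm r]

/-- Apply an operation on forms to all components of a Čech cochain. -/
def Tot.map (φ : ∀ U : TopologicalSpace.Opens X, Forms E U →ₗ[ℝ] Forms E U) :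
    Tot E 𝒰 →ₗ[ℝ] Tot E 𝒰 where
  toFun θ := fun i α => φ _ (θ i α)
  map_add' θ ξ := by funext i α; simp
  map_smul' r θ := by funext i α; simp

/-- Multiply the Čech degree `i` part by `(-1)^(m i)`. -/
def Tot.sgn (m : ℕ) : Tot E 𝒰 →ₗ[ℝ] Tot E 𝒰 where
  toFun θ := fun i α => (-1 : ℝ) ^ (m * i) • θ i α
  map_add' θ ξ := by funext i α; simp
  map_smul' r θ := by funext i α; simp [smul_comm r]

/-- The total differential `d_Tot = δ + (-1)^i d` on `Č^i(𝒰, Ω^•)`. -/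
def dTot : Tot E 𝒰 →ₗ[ℝ] Tot E 𝒰 := δ + Tot.sgn 1 ∘ₗ Tot.map d

/-- The restriction `Ω^•(X) → Č^0(𝒰, Ω^•)`, `res(η)_α = η|_{U_α}`. -/
def resTot : Forms E (⊤ : TopologicalSpace.Opens X) →ₗ[ℝ] Tot E 𝒰 where
  toFun η := fun i => match i with
    | 0 => fun _ => res le_top η
    | _ + 1 => fun _ => 0
  map_add' η ζ := by
    funext i α
    cases i with
    | zero => simp
    | succ i => simp
  map_smul' r η := by
    funext i α
    cases i with
    | zero => simp
    | succ i => simp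

variable (E 𝒰) in
/-- A Čech cochain `Ā = ∑_{i=0}^n A^{n-i}` of total degree `n` with values in the Deligne complex
`C^∞(-; U(1)) → Ω^1 → Ω^2 → ⋯` (with `U(1)`-valued functions in degree `0`), where
`A^{n-i} ∈ Č^i(𝒰, Ω^{n-i})` for `i < n` and `A^0 ∈ Č^n(𝒰, U(1))`. The field `form` collects the
components that are differential forms, and `fn` the components that are `U(1)`-valued functions,
which are trivial except in Čech degree `n`. -/
structure DeligneCochain (n : ℕ) where
  /-- the components `A^{n-i}`, `i < n` -/
  form : Tot E 𝒰
  /-- the component `A^0` (in Čech degree `n`) -/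
  fn : ∀ (i : ℕ) (α : Fin (i + 1) → κ), CircleFun E (inter 𝒰 α)
  form_deg : form ∈ totDeg E 𝒰 n
  form_zero : ∀ i α, form i α 0 = 0
  fn_deg : ∀ i α, i ≠ n → ∀ x, (fn i α).toFun x = 1

namespace DeligneCochain

variable {n : ℕ} (A : DeligneCochain E 𝒰 n)

/-- The differential of the Deligne complex applied to all components of `Ā`: the exterior
derivative of the components of positive degree and `dlog` of the `U(1)`-valued functions. -/
def dDel : Tot E 𝒰 := Tot.map d A.form + fun i α => (A.fn i α).dlog

/-- `Ā` is a Čech–Deligne cocycle presenting a prequantization of `ϖ`, i.e. `d_Tot Ā = ϖ`: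
`δ A^{n-i} = (-1)^i d A^{n-i-1}` for `i ≤ n - 2`, `δ A^1 = (-1)^{n-1} dlog A^0`, `δ A^0 = 1`,
and `d A^n = ϖ|_{U_α}`. -/
def IsPrequantization (ϖ : Forms E (⊤ : TopologicalSpace.Opens X)) : Prop :=
  δ A.form + Tot.sgn 1 A.dDel = resTot ϖ ∧
    ∀ (i : ℕ) (α : Fin (i + 2) → κ), ∀ x ∈ inter 𝒰 α,
      ∏ k : Fin (i + 2), (A.fn i (α ∘ k.succAbove)).toFun x ^ ((-1 : ℤ) ^ (k : ℕ)) = 1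

/-- The Lie derivative `𝓛_v Ā = d ι_v Ā + ι_v d Ā`, where `d` is the differential of the Deligne
complex and the interior product of `A^0` is zero; so `𝓛_v A^0 = ι_v dlog A^0`. -/
def lie : VField E X →ₗ[ℝ] Tot E 𝒰 where
  toFun v := Tot.map d (Tot.map (fun U => ι U v) A.form) + Tot.map (fun U => ι U v) A.dDel
  map_add' v w := by
    funext i α
    simp [Tot.map]
    abel
  map_smul' r v := by
    funext i α
    simp [Tot.map]

/-- `Ā(m) = ∑_i (-1)^(m i) A^{n-i}`, without the `U(1)`-valued component, which is killed by
interior products. -/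
def twist (m : ℕ) : Tot E 𝒰 := Tot.sgn m A.form

end DeligneCochain

end Cech

/-! ### `L_∞`-algebras

A graded vector space is given by a family `𝒱 : ℤ → Submodule ℝ V` of subspaces of an ambient
vector space `V`, and all operations are only considered on homogeneous elements. Degrees are
homological. -/

section LInfty

/-- The sign `χ(σ) = sign(σ) ε(σ)` of a permutation of homogeneous elements of degrees
`e 0, …, e (m-1)`, where `ε(σ)` is the Koszul sign. -/
def χ {m : ℕ} (σ : Equiv.Perm (Fin m)) (e : Fin m → ℤ) : ℤˣ :=
  Equiv.Perm.sign σ * ∏ p : Fin m × Fin m,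
    if p.1 < p.2 ∧ σ p.2 < σ p.1 then Int.negOnePow (e (σ p.1) * e (σ p.2)) else 1

/-- The `(k, m-k)`-unshuffles `Sh(k, m-k)`. -/
def Sh (k m : ℕ) : Finset (Equiv.Perm (Fin m)) :=
  {σ | (∀ a b : Fin m, a < b → (b : ℕ) < k → σ a < σ b) ∧
    (∀ a b : Fin m, k ≤ (a : ℕ) → a < b → σ a < σ b)}

/-- The first `k` of `m` entries. -/
def firstArgs {V : Type*} {k m : ℕ} (h : k ≤ m) (x : Fin m → V) : Fin k → V :=
  fun a => x (Fin.castLE h a)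

/-- The last `m - k` of `m` entries. -/
def lastArgs {V : Type*} (k : ℕ) {m : ℕ} (x : Fin m → V) : Fin (m - k) → V :=
  fun b => x ⟨k + b, by omega⟩

variable {V V' : Type*} [AddCommGroup V] [Module ℝ V] [AddCommGroup V'] [Module ℝ V']

/-- `φ` is a graded skew-symmetric multilinear map `𝒱^{⊗ k} → 𝒱'` of degree `r`. -/
structure IsGradedSkew (𝒱 : ℤ → Submodule ℝ V) (𝒱' : ℤ → Submodule ℝ V') (k : ℕ) (r : ℤ)
    (φ : (Fin k → V) → V') : Prop where
  mem : ∀ (e : Fin k → ℤ) (x : Fin k → V), (∀ a, x a ∈ 𝒱 (e a)) → φ x ∈ 𝒱' (∑ a, e a + r)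
  map_add : ∀ (e : Fin k → ℤ) (x : Fin k → V), (∀ a, x a ∈ 𝒱 (e a)) → ∀ a, ∀ y ∈ 𝒱 (e a),
    φ (Function.update x a (x a + y)) = φ x + φ (Function.update x a y)
  map_smul : ∀ (e : Fin k → ℤ) (x : Fin k → V), (∀ a, x a ∈ 𝒱 (e a)) → ∀ a, ∀ c : ℝ,
    φ (Function.update x a (c • x a)) = c • φ x
  skew : ∀ (e : Fin k → ℤ) (x : Fin k → V), (∀ a, x a ∈ 𝒱 (e a)) → ∀ σ : Equiv.Perm (Fin k),
    φ (x ∘ σ) = χ σ e • φ x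

/-- The graded vector space `𝒱` with the brackets `l k`, `k ≥ 1`, is an `L_∞`-algebra
(in the conventions of Lada and Markl): `l k` is graded skew-symmetric of degree `k - 2`, and
`∑_{k+j=m+1} ∑_{σ ∈ Sh(k,m-k)} χ(σ) (-1)^{k(j-1)}
  l_j(l_k(x_{σ(1)}, …, x_{σ(k)}), x_{σ(k+1)}, …, x_{σ(m)}) = 0` for all `m ≥ 1`.
Below, `k = i + 1` and `j = m - k + 1`. -/
structure IsLInfty (𝒱 : ℤ → Submodule ℝ V) (l : (k : ℕ) → (Fin k → V) → V) : Prop where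
  skew : ∀ k, 1 ≤ k → IsGradedSkew 𝒱 𝒱 k (k - 2) (l k)
  jacobi : ∀ m, 1 ≤ m → ∀ (e : Fin m → ℤ) (x : Fin m → V), (∀ a, x a ∈ 𝒱 (e a)) →
    ∑ i : Fin m, ∑ σ ∈ Sh (i + 1) m, (χ σ e * (-1) ^ ((i + 1) * (m - (i + 1)))) •
      l (m - (i + 1) + 1)
        (Fin.cons (l (i + 1) (firstArgs i.isLt (x ∘ σ))) (lastArgs (i + 1) (x ∘ σ))) = 0

/-- The graded vector space `𝒱` with the differential `D` of degree `-1` and the bracket `br` of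
degree `0` is a dg Lie algebra. -/
structure IsDGLie (𝒱 : ℤ → Submodule ℝ V) (D : V → V) (br : V → V → V) : Prop where
  diff_mem : ∀ i, ∀ x ∈ 𝒱 i, D x ∈ 𝒱 (i - 1)
  diff_add : ∀ i, ∀ x ∈ 𝒱 i, ∀ y ∈ 𝒱 i, D (x + y) = D x + D y
  diff_smul : ∀ i, ∀ x ∈ 𝒱 i, ∀ c : ℝ, D (c • x) = c • D x
  diff_diff : ∀ i, ∀ x ∈ 𝒱 i, D (D x) = 0
  br_mem : ∀ i j, ∀ x ∈ 𝒱 i, ∀ y ∈ 𝒱 j, br x y ∈ 𝒱 (i + j)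
  br_add : ∀ i j, ∀ x ∈ 𝒱 i, ∀ y ∈ 𝒱 j, ∀ z ∈ 𝒱 j, br x (y + z) = br x y + br x z
  br_smul : ∀ i j, ∀ x ∈ 𝒱 i, ∀ y ∈ 𝒱 j, ∀ c : ℝ, br x (c • y) = c • br x y
  br_skew : ∀ i j, ∀ x ∈ 𝒱 i, ∀ y ∈ 𝒱 j, br x y = -((i * j).negOnePow • br y x)
  jacobi : ∀ i j k, ∀ x ∈ 𝒱 i, ∀ y ∈ 𝒱 j, ∀ z ∈ 𝒱 k,
    br x (br y z) = br (br x y) z + (i * j).negOnePow • br y (br x z)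
  leibniz : ∀ i j, ∀ x ∈ 𝒱 i, ∀ y ∈ 𝒱 j, D (br x y) = br (D x) y + i.negOnePow • br x (D y)

/-- The maps `f m`, `m ≥ 1`, form an `L_∞`-morphism from the `L_∞`-algebra `(𝒱, l)` to the dg Lie
algebra `(𝒱', D, br)` (in the conventions of Lada and Markl): `f m` is graded skew-symmetric of
degree `m - 1`, and for all `m ≥ 1`
`D f_m(x_1, …, x_m) + ∑_{j+k=m+1} ∑_{σ ∈ Sh(k,m-k)} χ(σ) (-1)^{k(j-1)+1}
  f_j(l_k(x_{σ(1)}, …, x_{σ(k)}), x_{σ(k+1)}, …, x_{σ(m)})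
+ ∑_{s+t=m} ∑_{τ ∈ Sh(s,m-s), τ(1) < τ(s+1)} χ(τ) (-1)^{s-1} (-1)^{(t-1) ∑_{p ≤ s} |x_{τ(p)}|}
  br(f_s(x_{τ(1)}, …, x_{τ(s)}), f_t(x_{τ(s+1)}, …, x_{τ(m)})) = 0`.
Below, `k = i + 1`, `j = m - k + 1` and `s = i + 1`, `t = m - s`. -/
structure IsLInftyMorphism (𝒱 : ℤ → Submodule ℝ V) (l : (k : ℕ) → (Fin k → V) → V)
    (𝒱' : ℤ → Submodule ℝ V') (D : V' → V') (br : V' → V' → V')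
    (f : (m : ℕ) → (Fin m → V) → V') : Prop where
  skew : ∀ m, 1 ≤ m → IsGradedSkew 𝒱 𝒱' m (m - 1) (f m)
  eq : ∀ m, 1 ≤ m → ∀ (e : Fin m → ℤ) (x : Fin m → V), (∀ a, x a ∈ 𝒱 (e a)) →
    D (f m x) +
    ∑ i : Fin m, ∑ σ ∈ Sh (i + 1) m, (χ σ e * (-1) ^ ((i + 1) * (m - (i + 1)) + 1)) •
      f (m - (i + 1) + 1)
        (Fin.cons (l (i + 1) (firstArgs i.isLt (x ∘ σ))) (lastArgs (i + 1) (x ∘ σ))) +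
    ∑ i : Fin (m - 1), ∑ τ ∈ (Sh (i + 1) m).filter
        (fun τ => τ ⟨0, by have := i.isLt; omega⟩ < τ ⟨i + 1, by have := i.isLt; omega⟩),
      (χ τ e * (-1) ^ (i : ℕ) *
        (((m : ℤ) - (i + 1) - 1) *
          ∑ p : Fin (i + 1), firstArgs (show (i : ℕ) + 1 ≤ m by have := i.isLt; omega) (e ∘ τ) p).negOnePow) •
      br (f (i + 1) (firstArgs (by have := i.isLt; omega) (x ∘ τ))) (f (m - (i + 1)) (lastArgs (i + 1) (x ∘ τ)))
    = 0

/-- The chain map `φ` between the complexes `(𝒱, D)` and `(𝒱', D')` is a quasi-isomorphism: in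
each degree the induced map on homology is injective and surjective. -/
def IsQuasiIso (𝒱 : ℤ → Submodule ℝ V) (D : V → V) (𝒱' : ℤ → Submodule ℝ V') (D' : V' → V')
    (φ : V → V') : Prop :=
  (∀ i, ∀ x ∈ 𝒱 i, D x = 0 → (∃ y ∈ 𝒱' (i + 1), D' y = φ x) → ∃ z ∈ 𝒱 (i + 1), D z = x) ∧
  (∀ i, ∀ y ∈ 𝒱' i, D' y = 0 → ∃ x ∈ 𝒱 i, D x = 0 ∧ ∃ z ∈ 𝒱' (i + 1), D' z = y - φ x)

end LInfty

/-! ### Local observables and infinitesimal quantomorphisms -/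

section Main

variable {E : Type*} [NormedAddCommGroup E] [NormedSpace ℝ E] [FiniteDimensional ℝ E]
  {X : Type*} [TopologicalSpace X] [ChartedSpace E X] [IsManifold 𝓘(ℝ, E) ∞ X]
  {κ : Type*} {𝒰 : κ → TopologicalSpace.Opens X}

/-- The sign `ς(k) = -(-1)^{k(k+1)/2}`. -/
def ς (k : ℕ) : ℝ := -(-1) ^ (k * (k + 1) / 2)

variable (E X) in
/-- The ambient space `𝔛(X) ⊕ Ω^•(X)`. -/
abbrev ObsAmb : Type _ := VField E X × Forms E (⊤ : TopologicalSpace.Opens X)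

/-- The space `Ham^{n-1}(X)` of Hamiltonian pairs: pairs `(v, H)` of a vector field and an
`(n-1)`-form with `ι_v ϖ + dH = 0`. -/
def Ham (n : ℕ) (ϖ : Forms E (⊤ : TopologicalSpace.Opens X)) : Submodule ℝ (ObsAmb E X) where
  carrier := {x | x.2 ∈ formsDeg E ⊤ ((n : ℤ) - 1) ∧ ι ⊤ x.1 ϖ + d ⊤ x.2 = 0}
  zero_mem' := ⟨Submodule.zero_mem _, by simp⟩
  add_mem' := by
    rintro x y ⟨h1, h2⟩ ⟨h3, h4⟩
    refine ⟨Submodule.add_mem _ h1 h3, ?_⟩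
    simp only [Prod.fst_add, Prod.snd_add, map_add, LinearMap.add_apply]
    rw [add_add_add_comm, h2, h4, add_zero]
  smul_mem' := by
    rintro r x ⟨h1, h2⟩
    refine ⟨Submodule.smul_mem _ r h1, ?_⟩
    simp only [Prod.smul_fst, Prod.smul_snd, map_smul, LinearMap.smul_apply]
    rw [← smul_add, h2, smul_zero]

/-- The graded vector space underlying `L_∞(X, ϖ)`: Hamiltonian pairs in degree `0` and
`Ω^{n-1-i}(X)` in degree `i` for `1 ≤ i ≤ n - 1`. -/
def obsDeg (n : ℕ) (ϖ : Forms E (⊤ : TopologicalSpace.Opens X)) (i : ℤ) :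
    Submodule ℝ (ObsAmb E X) :=
  if i = 0 then Ham n ϖ else if 0 < i then Submodule.prod ⊥ (formsDeg E ⊤ ((n : ℤ) - 1 - i)) else ⊥

/-- The brackets of `L_∞(X, ϖ)`: `l₁` is the de Rham differential on elements of positive degree
(forms of degree less than `n - 1`) and zero on degree `0`;
`l₂(x₁, x₂) = [v₁, v₂] + ι_{v₁ ∧ v₂} ϖ`; and `l_k(x₁, …, x_k) = ς(k) ι_{v₁ ∧ ⋯ ∧ v_k} ϖ` for
`k ≥ 3`. Here `x = v + η`, and `v = 0` if `x` has positive degree. -/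
def obsBracket (n : ℕ) (ϖ : Forms E (⊤ : TopologicalSpace.Opens X)) :
    (k : ℕ) → (Fin k → ObsAmb E X) → ObsAmb E X
  | 0, _ => 0
  | 1, x => (0, d ⊤ fun k => if k + 1 < n then (x 0).2 k else 0)
  | 2, x => ((x 0).1.bracket (x 1).1, ιMulti ⊤ 2 (fun a => (x a).1) ϖ)
  | k + 3, x => (0, ς (k + 3) • ιMulti ⊤ (k + 3) (fun a => (x a).1) ϖ)

variable (E 𝒰) in
/-- The ambient space `𝔛(X) ⊕ ⨁_{i,k} Č^i(𝒰, Ω^k)`. -/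
abbrev QuantAmb : Type _ := VField E X × Tot E 𝒰

/-- The degree `0` part of `dgLie_Qu(X, Ā)`: pairs `v + θ` with `θ` in `Tot^{n-1}(𝒰, Ω)` and
`𝓛_v Ā = d_Tot θ`. -/
def quantZero {n : ℕ} (A : DeligneCochain E 𝒰 n) : Submodule ℝ (QuantAmb E 𝒰) where
  carrier := {x | x.2 ∈ totDeg E 𝒰 ((n : ℤ) - 1) ∧ A.lie x.1 = dTot x.2}
  zero_mem' := ⟨Submodule.zero_mem _, by simp⟩
  add_mem' := by
    rintro x y ⟨h1, h2⟩ ⟨h3, h4⟩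
    exact ⟨Submodule.add_mem _ h1 h3, by simp [h2, h4]⟩
  smul_mem' := by
    rintro r x ⟨h1, h2⟩
    exact ⟨Submodule.smul_mem _ r h1, by simp [h2]⟩

/-- The graded vector space underlying `dgLie_Qu(X, Ā)`: `Tot^{n-1-i}(𝒰, Ω)` in degree `i` for
`1 ≤ i ≤ n - 1`. -/
def quantDeg {n : ℕ} (A : DeligneCochain E 𝒰 n) (i : ℤ) : Submodule ℝ (QuantAmb E 𝒰) :=
  if i = 0 then quantZero A
  else if 0 < i then Submodule.prod ⊥ (totDeg E 𝒰 ((n : ℤ) - 1 - i)) else ⊥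

/-- The differential of `dgLie_Qu(X, Ā)`: `d_Tot` on elements of positive degree (cochains of
total degree less than `n - 1`) and zero on degree `0`. -/
def quantDiff (n : ℕ) (x : QuantAmb E 𝒰) : QuantAmb E 𝒰 :=
  (0, dTot fun i α k => if i + k + 1 < n then x.2 i α k else 0)

/-- The Lie bracket of `dgLie_Qu(X, Ā)`:
`⟦v₁ + θ₁, v₂ + θ₂⟧ = [v₁, v₂] + 𝓛_{v₁} θ₂ - 𝓛_{v₂} θ₁`, where `v = 0` for elements of positive
degree. -/
def quantBracket (x y : QuantAmb E 𝒰) : QuantAmb E 𝒰 :=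
  (x.1.bracket y.1,
    Tot.map (fun U => lieD U x.1) y.2 - Tot.map (fun U => lieD U y.1) x.2)

/-- `S_m(x₁, …, x_m) = ∑_{i=1}^m (-1)^i ι_{v₁ ∧ ⋯ ∧ v̂_i ∧ ⋯ ∧ v_m} η_i` for `x_i = v_i + η_i`. -/
def S : (m : ℕ) → (Fin m → ObsAmb E X) → Forms E (⊤ : TopologicalSpace.Opens X)
  | 0, _ => 0
  | m + 1, x => ∑ i : Fin (m + 1),
      (-1 : ℝ) ^ ((i : ℕ) + 1) • ιMulti ⊤ m (i.removeNth fun a => (x a).1) (x i).2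

end Main

end Plectic

end

/-!
The two `L_∞`-structures are governed by the same algebra. On forms, and on the Čech–de Rham
complex with the interior product twisted by the sign `(-1)^i` in Čech degree `i`, there are a
differential `D` with `D² = 0` and anticommuting contractions `I_v` such that
`𝓛_v = D I_v + I_v D` satisfies `[𝓛_v, I_w] = I_{[v, w]}`; restriction of forms intertwines the two
structures. Everything algebraic is proved for such an abstract Cartan calculus
(`CartanCalculus`, `GradedCalculus`), in which `D_IM_eq_altSum` computes the commutator of `D` with
an iterated contraction.

All operations involved are alternating in pairs `(v, θ)` and vanish as soon as two of the vector
components vanish. As `v = 0` off degree zero, Koszul signs never matter: a sum over unshuffles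
either is zero or is an ordinary signed sum over subsets. The sums that are left are alternating
sums in which one entry, two entries, or all entries but one are singled out, together with a sum
of `ϖ`-terms that is a multiple of an alternating sum of binomial coefficients. The Jacobi
identities (`isLInfty_hamDeg`, `isDGLie_hamDeg`) and the morphism identity (`morph_identity`,
`isLInftyMorphism_qMorph`) then follow from `D_IM_eq_altSum`.

For a prequantization, the total differential of the form part of `Ā` agrees with the restriction
of `ϖ` up to the term `dlog A⁰`, which has form degree one and is killed by any two contractions.
This determines `𝓛_v Ā` and reduces the concrete structures to the abstract ones. The concrete
definitions single out degrees explicitly, for instance by projecting to the vector component or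
cutting off the morphism above `n`; on homogeneous elements this agrees with the uniform
formulas, and the structures only depend on the values there.

The linear part of the morphism is a quasi-isomorphism because the rows of the Čech–de Rham complex
are exact: a partition of unity contracts them, so a Čech–de Rham cochain whose differential is the
restriction of a form is itself the restriction of a form up to an exact term
(`exists_eq_resTot_add_dTot`, `isQuasiIso_linear_part`).
-/

noncomputable section

namespace Plectic

/-! ### Cartan calculus on a manifold -/

section CartanLocal

variable {E : Type*} [NormedAddCommGroup E] [NormedSpace ℝ E]

lemma hasFDerivAt_curryLeft {k : ℕ} {η : E → E [⋀^Fin (k + 1)]→L[ℝ] ℝ} {v : E → E} {y : E}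
    (hη : DifferentiableAt ℝ η y) (hv : DifferentiableAt ℝ v y) :
    HasFDerivAt (fun z => (η z).curryLeft (v z))
      ((η y).curryLeft ∘L fderiv ℝ v y +
        ((ContinuousAlternatingMap.curryLeftLI (𝕜 := ℝ) (E := E) (F := ℝ)
          (n := k)).toContinuousLinearMap ∘L fderiv ℝ η y).flip (v y)) y := by
  have h0 : HasFDerivAt (fun f : E [⋀^Fin (k + 1)]→L[ℝ] ℝ => f.curryLeft) _ (η y) :=
    (ContinuousAlternatingMap.curryLeftLI (𝕜 := ℝ) (E := E) (F := ℝ)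
      (n := k)).toContinuousLinearMap.hasFDerivAt
  have h1 := HasFDerivAt.comp (𝕜 := ℝ) (E := E) (F := E [⋀^Fin (k + 1)]→L[ℝ] ℝ)
    (G := E →L[ℝ] E [⋀^Fin k]→L[ℝ] ℝ) (f := η) (f' := fderiv ℝ η y)
    (g := fun f => f.curryLeft) y h0 hη.hasFDerivAt
  exact h1.clm_apply hv.hasFDerivAt

/-- `d ι_v η` in coordinates. -/
lemma extDeriv_curryLeft_apply {k : ℕ} {η : E → E [⋀^Fin (k + 1)]→L[ℝ] ℝ} {v : E → E} {y : E}
    (hη : DifferentiableAt ℝ η y) (hv : DifferentiableAt ℝ v y) (u : Fin (k + 1) → E) :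
    extDeriv (fun z => (η z).curryLeft (v z)) y u =
      ∑ j : Fin (k + 1), (-1 : ℝ) ^ (j : ℕ) *
        (fderiv ℝ η y (u j) (Matrix.vecCons (v y) (j.removeNth u)) +
          η y (Matrix.vecCons (fderiv ℝ v y (u j)) (j.removeNth u))) := by
  have h := hasFDerivAt_curryLeft hη hv
  rw [extDeriv, h.fderiv, ContinuousAlternatingMap.alternatizeUncurryFin_apply]
  refine Finset.sum_congr rfl fun j _ => ?_
  simp [ContinuousAlternatingMap.curryLeftLI]
  ring

lemma removeNth_succ_vecCons {α : Type*} {k : ℕ} (a : α) (u : Fin (k + 1) → α) (j : Fin (k + 1)) :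
    Fin.removeNth j.succ (Matrix.vecCons a u) = Matrix.vecCons a (j.removeNth u) := by
  funext i
  refine Fin.cases rfl (fun i => ?_) i
  simp [Fin.removeNth]

/-- `ι_v d η` in coordinates. -/
lemma extDeriv_apply_vecCons {k : ℕ} (η : E → E [⋀^Fin (k + 1)]→L[ℝ] ℝ) (y v : E)
    (u : Fin (k + 1) → E) :
    extDeriv η y (Matrix.vecCons v u) = fderiv ℝ η y v u -
      ∑ j : Fin (k + 1), (-1 : ℝ) ^ (j : ℕ) *
        fderiv ℝ η y (u j) (Matrix.vecCons v (j.removeNth u)) := by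
  rw [extDeriv, ContinuousAlternatingMap.alternatizeUncurryFin_apply, Fin.sum_univ_succ,
    sub_eq_add_neg, ← Finset.sum_neg_distrib]
  congr 1
  · have h0 : Fin.removeNth 0 (Matrix.vecCons v u) = u := rfl
    simp [h0]
  · refine Finset.sum_congr rfl fun j _ => ?_
    rw [removeNth_succ_vecCons]
    simp [pow_succ]

/-- The Lie derivative `d ι_v η + ι_v d η` in coordinates: differentiate the coefficients along
`v` and insert the derivative of `v` in the arguments. -/
lemma lie_coord {k : ℕ} {η : E → E [⋀^Fin (k + 1)]→L[ℝ] ℝ} {v : E → E} {y : E}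
    (hη : DifferentiableAt ℝ η y) (hv : DifferentiableAt ℝ v y) (u : Fin (k + 1) → E) :
    extDeriv (fun z => (η z).curryLeft (v z)) y u + (extDeriv η y).curryLeft (v y) u =
      fderiv ℝ η y (v y) u + ∑ j : Fin (k + 1), (-1 : ℝ) ^ (j : ℕ) *
        η y (Matrix.vecCons (fderiv ℝ v y (u j)) (j.removeNth u)) := by
  rw [ContinuousAlternatingMap.curryLeft_apply_apply, extDeriv_apply_vecCons,
    extDeriv_curryLeft_apply hη hv]
  simp only [mul_add, Finset.sum_add_distrib]
  ring

/-- The Lie derivative of a function in coordinates. -/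
lemma lie_coord_zero {η : E → E [⋀^Fin 0]→L[ℝ] ℝ} (v y : E) (u : Fin 0 → E) :
    (extDeriv η y).curryLeft v u = fderiv ℝ η y v u := by
  rw [ContinuousAlternatingMap.curryLeft_apply_apply, extDeriv,
    ContinuousAlternatingMap.alternatizeUncurryFin_apply, Fin.sum_univ_succ]
  have h0 : Fin.removeNth 0 (Matrix.vecCons v u) = u := rfl
  simp [h0]

/-- The Leibniz rule for the derivative of `ι_w η` along `v`, in coordinates. -/
lemma lie_coord_curryLeft {k : ℕ} {η : E → E [⋀^Fin (k + 1)]→L[ℝ] ℝ} {v w : E → E} {y : E}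
    (hη : DifferentiableAt ℝ η y) (hw : DifferentiableAt ℝ w y) (u : Fin k → E) :
    fderiv ℝ (fun z => (η z).curryLeft (w z)) y (v y) u =
      fderiv ℝ η y (v y) (Matrix.vecCons (w y) u) +
        η y (Matrix.vecCons (fderiv ℝ w y (v y)) u) := by
  have h := hasFDerivAt_curryLeft hη hw
  rw [h.fderiv]
  simp [ContinuousAlternatingMap.curryLeftLI]
  ring

/-- Swapping the first two arguments of an alternating form. -/
lemma map_vecCons_swap {k : ℕ} (f : E [⋀^Fin (k + 2)]→L[ℝ] ℝ) (a b : E) (u : Fin k → E) :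
    f (Matrix.vecCons a (Matrix.vecCons b u)) = - f (Matrix.vecCons b (Matrix.vecCons a u)) := by
  have h : f (Matrix.vecCons b (Matrix.vecCons a u) ∘ Equiv.swap 0 1) =
      - f (Matrix.vecCons b (Matrix.vecCons a u)) :=
    f.toAlternatingMap.map_swap _ (i := 0) (j := 1) (by simp)
  rw [← h]
  congr 1
  funext i
  refine Fin.cases ?_ (fun i => Fin.cases ?_ (fun i => ?_) i) i
  · simp
  · simp
  · have h0 : Equiv.swap (0 : Fin (k + 2)) 1 i.succ.succ = i.succ.succ :=
      Equiv.swap_apply_of_ne_of_ne (Fin.succ_ne_zero _)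
        (fun h => Fin.succ_ne_zero i (Fin.succ_injective _ h))
    simp only [Function.comp, h0, Matrix.cons_val_succ]

/-- `[𝓛_v, ι_w] η = ι_{[v,w]} η` in coordinates, for a form of degree at least two. -/
lemma lie_curryLeft_coord {k : ℕ} {η : E → E [⋀^Fin (k + 2)]→L[ℝ] ℝ} {v w : E → E} {y : E}
    (hη : DifferentiableAt ℝ η y) (hv : DifferentiableAt ℝ v y) (hw : DifferentiableAt ℝ w y) :
    extDeriv (fun z => ((η z).curryLeft (w z)).curryLeft (v z)) y +
        (extDeriv (fun z => (η z).curryLeft (w z)) y).curryLeft (v y) -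
      (extDeriv (fun z => (η z).curryLeft (v z)) y + (extDeriv η y).curryLeft (v y)).curryLeft
        (w y) = (η y).curryLeft (VectorField.lieBracket ℝ v w y) := by
  have hc : DifferentiableAt ℝ (fun z => (η z).curryLeft (w z)) y :=
    (hasFDerivAt_curryLeft hη hw).differentiableAt
  ext u
  have h1 := lie_coord hc hv u
  have h2 := lie_coord hη hv (Matrix.vecCons (w y) u)
  rw [lie_coord_curryLeft hη hw] at h1
  rw [Fin.sum_univ_succ] at h2
  have h0 : Fin.removeNth 0 (Matrix.vecCons (w y) u) = u := rfl
  simp only [h0, removeNth_succ_vecCons, Matrix.cons_val_zero, Matrix.cons_val_succ,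
    map_vecCons_swap _ _ (w y), Fin.val_zero, Fin.val_succ, pow_succ, pow_zero] at h2
  simp only [ContinuousAlternatingMap.sub_apply, ContinuousAlternatingMap.add_apply] at h1 h2 ⊢
  rw [h1]
  simp only [ContinuousAlternatingMap.curryLeft_apply_apply,
    ContinuousAlternatingMap.add_apply] at h2 ⊢
  rw [h2, VectorField.lieBracket]
  have h4 := (η y).curryLeft.map_sub (fderiv ℝ w y (v y)) (fderiv ℝ v y (w y))
  have h5 := congrArg (fun f => f u) h4
  simp only [ContinuousAlternatingMap.curryLeft_apply_apply,
    ContinuousAlternatingMap.sub_apply] at h5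
  rw [h5]
  simp only [mul_neg, mul_one, neg_mul, neg_neg, one_mul]
  ring

/-- `[𝓛_v, ι_w] η = ι_{[v,w]} η` in coordinates, for a `1`-form. -/
lemma lie_curryLeft_coord_one {η : E → E [⋀^Fin 1]→L[ℝ] ℝ} {v w : E → E} {y : E}
    (hη : DifferentiableAt ℝ η y) (hv : DifferentiableAt ℝ v y) (hw : DifferentiableAt ℝ w y) :
    (extDeriv (fun z => (η z).curryLeft (w z)) y).curryLeft (v y) -
      (extDeriv (fun z => (η z).curryLeft (v z)) y + (extDeriv η y).curryLeft (v y)).curryLeft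
        (w y) = (η y).curryLeft (VectorField.lieBracket ℝ v w y) := by
  ext u
  have h1 := lie_coord_zero (η := fun z => (η z).curryLeft (w z)) (v y) y u
  have h2 := lie_coord (k := 0) hη hv (Matrix.vecCons (w y) u)
  rw [lie_coord_curryLeft hη hw] at h1
  have h0 : Fin.removeNth 0 (Matrix.vecCons (w y) u) = u := rfl
  rw [Fin.sum_univ_one] at h2
  simp only [h0, Matrix.cons_val_zero, Fin.val_zero, pow_zero] at h2
  simp only [ContinuousAlternatingMap.sub_apply] at h1 h2 ⊢
  rw [h1]
  simp only [ContinuousAlternatingMap.curryLeft_apply_apply,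
    ContinuousAlternatingMap.add_apply] at h2 ⊢
  rw [h2, VectorField.lieBracket]
  have h4 := (η y).curryLeft.map_sub (fderiv ℝ w y (v y)) (fderiv ℝ v y (w y))
  have h5 := congrArg (fun f => f u) h4
  simp only [ContinuousAlternatingMap.curryLeft_apply_apply,
    ContinuousAlternatingMap.sub_apply] at h5
  rw [h5]
  simp

end CartanLocal

section CartanManifold

variable {E : Type*} [NormedAddCommGroup E] [NormedSpace ℝ E] [FiniteDimensional ℝ E]
  {X : Type*} [TopologicalSpace X] [ChartedSpace E X] [IsManifold 𝓘(ℝ, E) ∞ X]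

open VectorField in
/-- In the preferred chart at `x`, the Lie bracket of vector fields is the Lie bracket of their
coordinate expressions. -/
lemma VField.bracket_val (v w : VField E X) (x : X) :
    (v.bracket w).val x = lieBracket ℝ (v.rep x) (w.rep x) (extChartAt 𝓘(ℝ, E) x x) := by
  have hrep (v : VField E X) : ∀ y ∈ (extChartAt 𝓘(ℝ, E) x).target,
      mpullbackWithin 𝓘(ℝ, E) 𝓘(ℝ, E) (extChartAt 𝓘(ℝ, E) x).symm v (range 𝓘(ℝ, E)) y =
        v.rep x y := by
    intro y hy
    have hs : (extChartAt 𝓘(ℝ, E) x).symm y ∈ (chartAt E x).source := by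
      rw [← extChartAt_source 𝓘(ℝ, E)]
      exact (extChartAt 𝓘(ℝ, E) x).map_target hy
    rw [mpullbackWithin_apply, ContinuousLinearMap.inverse_eq
      (mfderivWithin_extChartAt_symm_comp_mfderiv_extChartAt hy)
      (mfderiv_extChartAt_comp_mfderivWithin_extChartAt_symm hy),
      ← TangentBundle.continuousLinearMapAt_trivializationAt hs,
      TangentBundle.continuousLinearMapAt_trivializationAt_eq_core hs]
    rfl
  have hev (v : VField E X) :
      mpullbackWithin 𝓘(ℝ, E) 𝓘(ℝ, E) (extChartAt 𝓘(ℝ, E) x).symm v (range 𝓘(ℝ, E))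
        =ᶠ[𝓝 (extChartAt 𝓘(ℝ, E) x x)] v.rep x := by
    filter_upwards [extChartAt_target_mem_nhds (I := 𝓘(ℝ, E)) x] with y hy using hrep v y hy
  change mlieBracketWithin 𝓘(ℝ, E) v w univ x = _
  have hid (z : E) : (ContinuousLinearMap.id ℝ E).inverse z = z := by
    rw [ContinuousLinearMap.inverse_id, ContinuousLinearMap.id_apply]
  rw [mlieBracketWithin_apply, mfderiv_extChartAt_self]
  refine (hid _).trans ?_
  rw [preimage_univ, univ_inter, ModelWithCorners.range_eq_univ]
  rw [ModelWithCorners.range_eq_univ] at hev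
  refine (congrFun (lieBracketWithin_univ (𝕜 := ℝ) (E := E)) _).trans ?_
  exact (hev v).lieBracket_vectorField_eq (hev w)

variable {U : TopologicalSpace.Opens X}

lemma mem_chartDom {x : X} (hx : x ∈ U) : extChartAt 𝓘(ℝ, E) x x ∈ chartDom (E := E) x U :=
  ⟨mem_extChartAt_target x, by simpa using hx⟩

lemma rep_self {k : ℕ} (η : X → E [⋀^Fin k]→L[ℝ] ℝ) (x : X) :
    rep x η (extChartAt 𝓘(ℝ, E) x x) = η x := by
  ext v
  simp only [rep, ContinuousAlternatingMap.compContinuousLinearMap_apply, extChartAt_to_inv]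
  congr 1
  funext i
  exact tangentCoordChange_self (I := 𝓘(ℝ, E)) (mem_extChartAt_source x)

lemma VField.rep_self (v : VField E X) (x : X) : v.rep x (extChartAt 𝓘(ℝ, E) x x) = v.val x := by
  simp only [VField.rep, extChartAt_to_inv]
  exact tangentCoordChange_self (I := 𝓘(ℝ, E)) (mem_extChartAt_source x)

lemma rep_contractRaw {k : ℕ} (v : VField E X) (η : X → E [⋀^Fin (k + 1)]→L[ℝ] ℝ) (c : X) {y : E}
    (hy : y ∈ (extChartAt 𝓘(ℝ, E) c).target) :
    rep c (contractRaw v η) y = (rep c η y).curryLeft (v.rep c y) := by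
  simp only [Plectic.rep, contractRaw]
  rw [ContinuousAlternatingMap.curryLeft_compContinuousLinearMap, v.val_eq_rep c hy]

lemma rep_contractRaw_eventuallyEq {k : ℕ} (v : VField E X) (η : X → E [⋀^Fin (k + 1)]→L[ℝ] ℝ)
    (x : X) : rep x (contractRaw v η) =ᶠ[𝓝 (extChartAt 𝓘(ℝ, E) x x)]
      fun y => (rep x η y).curryLeft (v.rep x y) := by
  filter_upwards [extChartAt_target_mem_nhds (I := 𝓘(ℝ, E)) x] with y hy
    using rep_contractRaw v η x hy

lemma contDiffAt_rep {k : ℕ} {η : X → E [⋀^Fin k]→L[ℝ] ℝ} (hη : η ∈ DForm E U k) {x : X}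
    (hx : x ∈ U) : ContDiffAt ℝ ∞ (rep x η) (extChartAt 𝓘(ℝ, E) x x) :=
  (hη.1 x).contDiffAt ((isOpen_chartDom x U).mem_nhds (mem_chartDom hx))

lemma VField.differentiableAt_rep (v : VField E X) (x : X) :
    DifferentiableAt ℝ (v.rep x) (extChartAt 𝓘(ℝ, E) x x) :=
  ((v.contDiffOn_rep x).contDiffAt (extChartAt_target_mem_nhds x)).differentiableAt (by simp)

lemma extD_apply {k : ℕ} (η : X → E [⋀^Fin k]→L[ℝ] ℝ) {x : X} (hx : x ∈ U) :
    extD U η x = extDeriv (rep x η) (extChartAt 𝓘(ℝ, E) x x) :=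
  Set.indicator_of_mem (by simpa using hx) _

lemma extD_contractRaw {k : ℕ} (v : VField E X) (η : X → E [⋀^Fin (k + 1)]→L[ℝ] ℝ) {x : X}
    (hx : x ∈ U) : extD U (contractRaw v η) x =
      extDeriv (fun y => (rep x η y).curryLeft (v.rep x y)) (extChartAt 𝓘(ℝ, E) x x) := by
  rw [extD_apply _ hx, (rep_contractRaw_eventuallyEq v η x).extDeriv_eq]

lemma extD_extD {k : ℕ} {η : X → E [⋀^Fin k]→L[ℝ] ℝ} (hη : η ∈ DForm E U k) :
    extD U (extD U η) = 0 := by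
  funext x
  by_cases hx : x ∈ U
  · have hev : rep x (extD U η) =ᶠ[𝓝 (extChartAt 𝓘(ℝ, E) x x)] extDeriv (rep x η) := by
      filter_upwards [(isOpen_chartDom x U).mem_nhds (mem_chartDom hx)] with y hy
        using rep_extD hη x hy
    rw [extD_apply _ hx, hev.extDeriv_eq, extDeriv_extDeriv_apply (contDiffAt_rep hη hx)
      (by simp; exact two_le_infty)]
    rfl
  · exact Set.indicator_of_notMem (by simpa using hx) _

lemma d_d (η : Forms E U) : d U (d U η) = 0 := by
  funext k
  match k with
  | 0 => rfl
  | 1 =>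
    refine Subtype.ext ?_
    change extD U ((0 : DForm E U 0) : X → E [⋀^Fin 0]→L[ℝ] ℝ) = 0
    have h := extD_smul (U := U) 0 (0 : X → E [⋀^Fin 0]→L[ℝ] ℝ)
    simpa using h
  | k + 2 => exact Subtype.ext (extD_extD (η k).2)

lemma ι_apply (v : VField E X) (η : Forms E U) (k : ℕ) :
    ((ι U v η k : DForm E U k) : X → E [⋀^Fin k]→L[ℝ] ℝ) = contractRaw v (η (k + 1)).1 := rfl

lemma d_apply_succ (η : Forms E U) (k : ℕ) :
    ((d U η (k + 1) : DForm E U (k + 1)) : X → E [⋀^Fin (k + 1)]→L[ℝ] ℝ) = extD U (η k).1 := rfl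

lemma d_apply_zero (η : Forms E U) : d U η 0 = 0 := rfl

lemma ι_ι_self (v : VField E X) (η : Forms E U) : ι U v (ι U v η) = 0 := by
  funext k
  refine Subtype.ext (funext fun x => ?_)
  exact ContinuousAlternatingMap.curryLeft_same _ _

/-- The Cartan relation `[𝓛_v, ι_w] = ι_{[v,w]}`. -/
lemma lieD_ι (v w : VField E X) (η : Forms E U) :
    lieD U v (ι U w η) - ι U w (lieD U v η) = ι U (v.bracket w) η := by
  funext k
  refine Subtype.ext (funext fun x => ?_)
  by_cases hx : x ∈ U
  · have hη : DifferentiableAt ℝ (rep x (η (k + 1)).1) (extChartAt 𝓘(ℝ, E) x x) :=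
      (contDiffAt_rep (η (k + 1)).2 hx).differentiableAt (by simp)
    have hv := v.differentiableAt_rep x
    have hw := w.differentiableAt_rep x
    cases k with
    | zero =>
      have h := lie_curryLeft_coord_one hη hv hw
      rw [← VField.bracket_val, rep_self, v.rep_self, w.rep_self, ← extD_contractRaw w _ hx,
        ← extD_contractRaw v _ hx, ← extD_apply _ hx] at h
      have e (a b c d : E [⋀^Fin 0]→L[ℝ] ℝ) (h : a - b = c) : 0 + a - b = c := by
        rw [zero_add, h]
      exact e _ _ _ 0 h
    | succ k =>
      have h := lie_curryLeft_coord hη hv hw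
      have hev : (fun y => ((rep x (η (k + 2)).1 y).curryLeft (w.rep x y)).curryLeft (v.rep x y))
          =ᶠ[𝓝 (extChartAt 𝓘(ℝ, E) x x)]
          fun y => (rep x (contractRaw w (η (k + 2)).1) y).curryLeft (v.rep x y) := by
        filter_upwards [rep_contractRaw_eventuallyEq w (η (k + 2)).1 x] with y hy
        rw [hy]
      rw [hev.extDeriv_eq, ← extD_contractRaw v _ hx, ← VField.bracket_val, rep_self, v.rep_self,
        w.rep_self, ← extD_contractRaw w _ hx, ← extD_contractRaw v _ hx, ← extD_apply _ hx] at h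
      exact h
  -- off `U` both sides vanish, being extended by zero
  · rw [(((lieD U v) (((ι U) w) η) - ((ι U) w) ((lieD U v) η)) k).2.2 x hx,
      ((ι U (v.bracket w) η) k).2.2 x hx]

lemma VField.mdifferentiableAt (v : VField E X) (x : X) :
    MDifferentiableAt 𝓘(ℝ, E) 𝓘(ℝ, E).tangent (fun x => (⟨x, v x⟩ : TangentBundle 𝓘(ℝ, E) X)) x :=
  v.contMDiff.contMDiffAt.mdifferentiableAt (by simp)

lemma VField.bracket_swap (v w : VField E X) : v.bracket w = - w.bracket v :=
  ContMDiffSection.ext fun _ => VectorField.mlieBracket_swap_apply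

lemma isManifold_two : IsManifold 𝓘(ℝ, E) 2 X := IsManifold.of_le (n := ∞) two_le_infty

lemma VField.bracket_add (u v w : VField E X) :
    u.bracket (v + w) = u.bracket v + u.bracket w :=
  haveI := isManifold_two (E := E) (X := X)
  ContMDiffSection.ext fun x => VectorField.mlieBracket_add_right
    (v.mdifferentiableAt x) (w.mdifferentiableAt x)

lemma VField.bracket_smul (u v : VField E X) (r : ℝ) :
    u.bracket (r • v) = r • u.bracket v :=
  haveI := isManifold_two (E := E) (X := X)
  ContMDiffSection.ext fun x => VectorField.mlieBracket_const_smul_right (v.mdifferentiableAt x)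

/-- The Jacobi identity for vector fields. -/
lemma VField.bracket_leibniz (u v w : VField E X) :
    u.bracket (v.bracket w) = (u.bracket v).bracket w + v.bracket (u.bracket w) := by
  have : CompleteSpace E := FiniteDimensional.complete ℝ E
  have : IsManifold 𝓘(ℝ, E) (minSmoothness ℝ 3) X := IsManifold.of_le (n := ∞) (by
    simp only [minSmoothness_of_isRCLikeNormedField]
    exact WithTop.coe_le_coe.2 (le_top : (3 : ℕ∞) ≤ ⊤))
  have h (v : VField E X) : ContMDiff 𝓘(ℝ, E) 𝓘(ℝ, E).tangent (minSmoothness ℝ 2)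
      (fun x => (⟨x, v x⟩ : TangentBundle 𝓘(ℝ, E) X)) :=
    v.contMDiff.of_le (by simp; exact two_le_infty)
  exact ContMDiffSection.ext fun x => VectorField.leibniz_identity_mlieBracket_apply
    (h u x) (h v x) (h w x)

end CartanManifold

/-! ### Alternating sums and abstract Cartan calculi -/

section AltSum

variable {α N N' : Type*} [AddCommGroup N] [Module ℝ N] [AddCommGroup N'] [Module ℝ N']

/-- The signed sum `∑ i, (-1)^i G(x_i; x_0, …, x̂_i, …, x_m)` over all ways to single out one
entry of a tuple. -/
def altSum {m : ℕ} (G : α → (Fin m → α) → N) (x : Fin (m + 1) → α) : N :=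
  ∑ i : Fin (m + 1), (-1 : ℝ) ^ (i : ℕ) • G (x i) (i.removeNth x)

lemma altSum_add {m : ℕ} (G H : α → (Fin m → α) → N) (x : Fin (m + 1) → α) :
    altSum (fun a y => G a y + H a y) x = altSum G x + altSum H x := by
  simp [altSum, Finset.sum_add_distrib]

lemma altSum_sub {m : ℕ} (G H : α → (Fin m → α) → N) (x : Fin (m + 1) → α) :
    altSum (fun a y => G a y - H a y) x = altSum G x - altSum H x := by
  simp [altSum, Finset.sum_sub_distrib, smul_sub]

lemma altSum_smul {m : ℕ} (c : ℝ) (G : α → (Fin m → α) → N) (x : Fin (m + 1) → α) :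
    altSum (fun a y => c • G a y) x = c • altSum G x := by
  simp [altSum, Finset.smul_sum, smul_comm c]

lemma altSum_neg {m : ℕ} (G : α → (Fin m → α) → N) (x : Fin (m + 1) → α) :
    altSum (fun a y => - G a y) x = - altSum G x := by
  simp [altSum]

lemma map_altSum {m : ℕ} (φ : N →ₗ[ℝ] N') (G : α → (Fin m → α) → N) (x : Fin (m + 1) → α) :
    φ (altSum G x) = altSum (fun a y => φ (G a y)) x := by
  simp [altSum]

lemma altSum_eq_zero {m : ℕ} {G : α → (Fin m → α) → N} {x : Fin (m + 1) → α}
    (h : ∀ i, G (x i) (i.removeNth x) = 0) : altSum G x = 0 := by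
  simp [altSum, h]

lemma altSum_one (G : α → (Fin 0 → α) → N) (x : Fin 1 → α) :
    altSum G x = G (x 0) (Fin.removeNth 0 x) := by
  simp [altSum]

/-- Singling out two entries in the opposite order changes the sign. -/
lemma altSum_altSum_swap {m : ℕ} (G : α → α → (Fin m → α) → N) (x : Fin (m + 2) → α) :
    altSum (fun a y => altSum (fun b z => G a b z) y) x =
      - altSum (fun a y => altSum (fun b z => G b a z) y) x := by
  simp only [altSum, Finset.smul_sum, ← Finset.sum_neg_distrib]
  rw [← Finset.univ.sum_product' Finset.univ (fun (i : Fin (m + 2)) (j : Fin (m + 1)) =>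
      (-1 : ℝ) ^ (i : ℕ) • (-1 : ℝ) ^ (j : ℕ) •
        G (x i) (Fin.removeNth i x j) (Fin.removeNth j (Fin.removeNth i x))),
    ← Finset.univ.sum_product' Finset.univ (fun (i : Fin (m + 2)) (j : Fin (m + 1)) =>
      - ((-1 : ℝ) ^ (i : ℕ) • (-1 : ℝ) ^ (j : ℕ) •
        G (Fin.removeNth i x j) (x i) (Fin.removeNth j (Fin.removeNth i x))))]
  -- the involution that exchanges the two entries singled out changes the parity of `i + j`
  have hinv (p : Fin (m + 2) × Fin (m + 1)) :
      ((p.1.succAbove p.2).succAbove (p.2.predAbove p.1),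
        (p.2.predAbove p.1).predAbove (p.1.succAbove p.2)) = p := by
    ext1
    · exact Fin.succAbove_succAbove_predAbove _ _
    · exact Fin.predAbove_predAbove_succAbove _ _
  refine Finset.sum_nbij' (fun p => (p.1.succAbove p.2, p.2.predAbove p.1))
    (fun p => (p.1.succAbove p.2, p.2.predAbove p.1)) (by simp) (by simp)
    (fun p _ => hinv p) (fun p _ => hinv p) ?_
  rintro ⟨i, j⟩ -
  simp only
  rw [Fin.removeNth_removeNth_eq_swap, smul_smul, smul_smul, ← pow_add, ← pow_add,
    Fin.neg_one_pow_succAbove_add_predAbove, neg_smul, neg_neg]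
  congr 2
  simp only [Fin.removeNth]
  rw [Fin.succAbove_succAbove_predAbove]

end AltSum

/-- An abstract Cartan calculus: a differential `D` on a real vector space `M`, and interior
products `I v` with elements of a vector space `V` with a bracket `br`, such that the Lie derivatives
`D I_v + I_v D` satisfy `[𝓛_v, I_w] = I_{[v,w]}`. -/
structure CartanCalculus (V M : Type*) [AddCommGroup V] [Module ℝ V] [AddCommGroup M]
    [Module ℝ M] where
  /-- the bracket of vector fields -/
  br : V → V → V
  /-- the differential -/
  D : Module.End ℝ M
  /-- the interior product -/
  I : V →ₗ[ℝ] Module.End ℝ M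
  D_D : D * D = 0
  I_I : ∀ v, I v * I v = 0
  lie_I : ∀ v w, (D * I v + I v * D) * I w - I w * (D * I v + I v * D) = I (br v w)

namespace CartanCalculus

variable {V M : Type*} [AddCommGroup V] [Module ℝ V] [AddCommGroup M] [Module ℝ M]
  (C : CartanCalculus V M)

/-- The Lie derivative `D I_v + I_v D`. -/
def L (v : V) : Module.End ℝ M := C.D * C.I v + C.I v * C.D

lemma L_zero : C.L 0 = 0 := by simp [L]

lemma L_I (v w : V) : C.L v * C.I w = C.I w * C.L v + C.I (C.br v w) := by
  rw [← C.lie_I, L]; abel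

lemma D_L (v : V) : C.D * C.L v = C.L v * C.D := by
  rw [L, mul_add, add_mul, ← mul_assoc, C.D_D, zero_mul, zero_add, mul_assoc _ _ C.D,
    mul_assoc _ C.D C.D, C.D_D, mul_zero, add_zero]

/-- `[𝓛_v, 𝓛_w] = 𝓛_{[v,w]}`. -/
lemma L_L (v w : V) : C.L v * C.L w = C.L w * C.L v + C.L (C.br v w) := by
  have h1 : C.L v * (C.D * C.I w) = C.D * (C.I w * C.L v + C.I (C.br v w)) := by
    rw [← mul_assoc, ← D_L, mul_assoc, L_I]
  have h2 : C.L v * (C.I w * C.D) = (C.I w * C.L v + C.I (C.br v w)) * C.D := by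
    rw [← mul_assoc, L_I]
  rw [L.eq_1 C w, mul_add, h1, h2, L.eq_1 C (C.br v w), mul_add, add_mul, add_mul, mul_assoc (C.I w),
    ← D_L]
  noncomm_ring

lemma I_anticomm (v w : V) : C.I v * C.I w = - (C.I w * C.I v) := by
  have h := C.I_I (v + w)
  rw [map_add, add_mul, mul_add, mul_add, C.I_I, C.I_I, zero_add, add_zero] at h
  exact eq_neg_of_add_eq_zero_left h

lemma I_br_swap (v w : V) : C.I (C.br v w) = - C.I (C.br w v) := by
  rw [← C.lie_I, ← C.lie_I]
  have h := C.I_anticomm v w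
  have h1 : C.D * C.I v * C.I w = - (C.D * C.I w * C.I v) := by
    rw [mul_assoc, h, mul_neg, mul_assoc]
  have h2 : C.I v * (C.I w * C.D) = - (C.I w * (C.I v * C.D)) := by
    rw [← mul_assoc, h, neg_mul, mul_assoc]
  rw [add_mul, mul_add, add_mul, mul_add, h1, h2]
  noncomm_ring

/-- The iterated interior product as a multilinear map, see `CartanCalculus.IM`. -/
def IMulti : (m : ℕ) → MultilinearMap ℝ (fun _ : Fin m => V) (Module.End ℝ M)
  | 0 => MultilinearMap.constOfIsEmpty ℝ _ 1
  | m + 1 => LinearMap.uncurryLeft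
    { toFun := fun v => (LinearMap.mulRight ℝ (C.I v)).compMultilinearMap (IMulti m)
      map_add' := fun v w => by ext; simp [mul_add]
      map_smul' := fun r v => by ext; simp }

lemma IMulti_succ {m : ℕ} (v : Fin (m + 1) → V) :
    C.IMulti (m + 1) v = C.IMulti m (Fin.tail v) * C.I (v 0) := rfl

lemma IMulti_mul_I_eq_zero {m : ℕ} (v : Fin m → V) (j : Fin m) :
    C.IMulti m v * C.I (v j) = 0 := by
  induction m with
  | zero => exact j.elim0
  | succ m ih =>
    rw [IMulti_succ]
    refine Fin.cases ?_ (fun j => ?_) j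
    · rw [mul_assoc, C.I_I, mul_zero]
    · rw [mul_assoc, I_anticomm, mul_neg, ← mul_assoc]
      have := ih (Fin.tail v) j
      rw [Fin.tail] at this
      rw [this, zero_mul, neg_zero]

/-- The iterated interior product `I_{v_1 ∧ ⋯ ∧ v_m} = I_{v_m} ⋯ I_{v_1}`. -/
def IM (m : ℕ) : V [⋀^Fin m]→ₗ[ℝ] Module.End ℝ M where
  __ := C.IMulti m
  map_eq_zero_of_eq' := by
    have key (m : ℕ) (v : Fin m → V) (i j : Fin m) (hv : v i = v j) (hij : i < j) :
        C.IMulti m v = 0 := by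
      induction m with
      | zero => exact i.elim0
      | succ m ih =>
        rw [IMulti_succ]
        obtain ⟨j, rfl⟩ := Fin.exists_succ_eq.2 (Fin.ne_zero_of_lt hij)
        induction i using Fin.cases with
        | zero => rw [hv]; exact C.IMulti_mul_I_eq_zero (Fin.tail v) j
        | succ i => rw [ih (Fin.tail v) i j hv (Fin.succ_lt_succ_iff.1 hij), zero_mul]
    intro v i j hv hij
    rcases lt_or_gt_of_ne hij with h | h
    · exact key m v i j hv h
    · exact key m v j i hv.symm h

lemma IM_zero (v : Fin 0 → V) : C.IM 0 v = 1 := rfl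

lemma IM_succ {m : ℕ} (v : Fin (m + 1) → V) :
    C.IM (m + 1) v = C.IM m (Fin.tail v) * C.I (v 0) := rfl

lemma IM_cons {m : ℕ} (a : V) (v : Fin m → V) :
    C.IM (m + 1) (Fin.cons a v) = C.IM m v * C.I a := rfl

/-- Moving the `j`-th entry to the front. -/
lemma IM_update {m : ℕ} (v : Fin (m + 1) → V) (j : Fin (m + 1)) (a : V) :
    C.IM (m + 1) (Function.update v j a) =
      (-1 : ℝ) ^ (j : ℕ) • C.IM (m + 1) (Fin.cons a (j.removeNth v)) := by
  have h := (C.IM (m + 1)).map_insertNth j a (j.removeNth v)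
  rw [Fin.insertNth_removeNth] at h
  rw [h]
  rw [← Int.cast_smul_eq_zsmul ℝ]
  norm_num
  rfl

/-- `𝓛_w` acts on iterated interior products as a derivation. -/
lemma lie_IM {m : ℕ} (w : V) (v : Fin m → V) :
    C.L w * C.IM m v - C.IM m v * C.L w =
      ∑ j, C.IM m (Function.update v j (C.br w (v j))) := by
  induction m with
  | zero => simp [IM_zero]
  | succ m ih =>
    have h := ih (Fin.tail v)
    rw [Fin.sum_univ_succ]
    simp only [IM_succ, Fin.tail_update_succ, Fin.tail_update_zero, Function.update_self]
    have h2 (j : Fin m) : Function.update v j.succ (C.br w (v j.succ)) 0 = v 0 :=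
      Function.update_of_ne (Fin.succ_ne_zero j).symm _ _
    simp only [h2]
    rw [← Finset.sum_mul]
    have h3 : ∑ j, C.IM m (Function.update (Fin.tail v) j (C.br w (v j.succ))) =
      C.L w * C.IM m (Fin.tail v) - C.IM m (Fin.tail v) * C.L w := h.symm
    rw [h3, sub_mul, mul_assoc _ (C.L w), L_I]
    noncomm_ring

/-- `[𝓛_w, I_{v_0 ∧ ⋯ ∧ v_m}] = ∑_j (-1)^j I_{[w, v_j] ∧ v_0 ∧ ⋯ v̂_j ⋯ ∧ v_m}`. -/
lemma lie_IM_eq_altSum {m : ℕ} (w : V) (v : Fin (m + 1) → V) :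
    C.L w * C.IM (m + 1) v - C.IM (m + 1) v * C.L w =
      altSum (fun b z => C.IM (m + 1) (Fin.cons (C.br w b) z)) v := by
  rw [lie_IM]
  exact Finset.sum_congr rfl fun j _ => C.IM_update v j _

lemma removeNth_succ {α : Type*} {m : ℕ} (v : Fin (m + 2) → α) (j : Fin (m + 1)) :
    Fin.removeNth j.succ v = Fin.cons (v 0) (j.removeNth (Fin.tail v)) := by
  funext i
  refine Fin.cases rfl (fun i => ?_) i
  simp [Fin.removeNth, Fin.tail]

/-- The iterated Cartan formula, in a form that is symmetric in the order of `𝓛` and `I` and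
therefore can be proved by induction on the number of entries. -/
lemma D_IM_aux {m : ℕ} (v : Fin (m + 1) → V) :
    (2 : ℝ) • (C.D * C.IM (m + 1) v + (-1 : ℝ) ^ m • (C.IM (m + 1) v * C.D)) =
      (-1 : ℝ) ^ m • altSum (fun a y => C.L a * C.IM m y + C.IM m y * C.L a) v := by
  induction m with
  | zero =>
    rw [altSum_one]
    simp [IM_zero, IM_succ, two_smul, L]
    abel
  | succ m ih =>
    have hT : altSum (fun a y => C.L a * C.IM (m + 1) y + C.IM (m + 1) y * C.L a) v =
        - (altSum (fun a y => C.L a * C.IM m y + C.IM m y * C.L a) (Fin.tail v) * C.I (v 0)) +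
          (2 : ℝ) • (C.IM (m + 1) (Fin.tail v) * C.L (v 0)) := by
      -- split off the summand of `v 0`, and commute `I (v 0)` past the Lie derivatives in the others
      have h1 : C.L (v 0) * C.IM (m + 1) (Fin.tail v) = C.IM (m + 1) (Fin.tail v) * C.L (v 0) +
          altSum (fun b z => C.IM (m + 1) (Fin.cons (C.br (v 0) b) z)) (Fin.tail v) := by
        rw [← lie_IM_eq_altSum]; abel
      rw [altSum, Fin.sum_univ_succ]
      have h0 : Fin.removeNth 0 v = Fin.tail v := rfl
      simp only [h0, Fin.val_zero, pow_zero, one_smul, removeNth_succ, IM_cons]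
      rw [h1]
      simp only [altSum, IM_cons, Finset.sum_mul]
      rw [← Finset.sum_neg_distrib, two_smul]
      have h3 : ∑ i : Fin (m + 1), (-1 : ℝ) ^ (i.succ : ℕ) •
          (C.L (v i.succ) * (C.IM m (i.removeNth (Fin.tail v)) * C.I (v 0)) +
            C.IM m (i.removeNth (Fin.tail v)) * C.I (v 0) * C.L (v i.succ)) =
          ∑ i : Fin (m + 1), - ((-1 : ℝ) ^ (i : ℕ) •
            (C.L (Fin.tail v i) * C.IM m (i.removeNth (Fin.tail v)) +
              C.IM m (i.removeNth (Fin.tail v)) * C.L (Fin.tail v i)) * C.I (v 0)) -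
          ∑ i : Fin (m + 1), (-1 : ℝ) ^ (i : ℕ) •
            (C.IM m (i.removeNth (Fin.tail v)) * C.I (C.br (v 0) (Fin.tail v i))) := by
        rw [← Finset.sum_sub_distrib]
        refine Finset.sum_congr rfl fun i _ => ?_
        have h4 : C.I (v 0) * C.L (v i.succ) =
            C.L (v i.succ) * C.I (v 0) + C.I (C.br (v 0) (v i.succ)) := by
          rw [C.L_I, C.I_br_swap (v 0)]; abel
        rw [mul_assoc (C.IM m _) (C.I (v 0)), h4]
        simp only [Fin.tail, Fin.val_succ, pow_succ, mul_add, add_mul, smul_add, mul_assoc,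
          smul_mul_assoc]
        module
      rw [h3]
      abel
    -- now everything is a combination of the case `m` multiplied by `I (v 0)` from the right
    rw [hT, IM_succ, pow_succ]
    have h := congrArg (fun z => z * C.I (v 0)) (ih (Fin.tail v))
    simp only [smul_mul_assoc, add_mul] at h
    rw [L]
    simp only [mul_assoc, mul_add] at h ⊢
    linear_combination (norm := module) h

/-- The iterated Cartan formula
`D I_{v_0 ∧ ⋯ ∧ v_m} + (-1)^m I_{v_0 ∧ ⋯ ∧ v_m} D
  = (-1)^m (∑_i (-1)^i 𝓛_{v_i} I_{⋯ v̂_i ⋯} - ½ ∑_i (-1)^i [𝓛_{v_i}, I_{⋯ v̂_i ⋯}])`. -/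
lemma D_IM {m : ℕ} (v : Fin (m + 1) → V) :
    C.D * C.IM (m + 1) v = (-1 : ℝ) ^ m • (altSum (fun a y => C.L a * C.IM m y) v -
      (2⁻¹ : ℝ) • altSum (fun a y => C.L a * C.IM m y - C.IM m y * C.L a) v -
      C.IM (m + 1) v * C.D) := by
  have h := C.D_IM_aux v
  rw [altSum_add] at h
  rw [altSum_sub]
  have h2 := congrArg (fun z => (2⁻¹ : ℝ) • z) h
  simp only [smul_smul, inv_mul_cancel₀ (two_ne_zero (α := ℝ)), one_smul] at h2
  rw [eq_sub_of_add_eq h2]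
  module

end CartanCalculus

/-! ### The commutator of the differential with iterated contractions -/

lemma ς_succ (m : ℕ) : ς (m + 1) = (-1) ^ (m + 1) * ς m := by
  have h : (m + 1) * (m + 1 + 1) / 2 = m * (m + 1) / 2 + (m + 1) := by
    rw [show (m + 1) * (m + 1 + 1) = m * (m + 1) + (m + 1) * 2 by ring,
      Nat.add_mul_div_right _ _ two_pos]
  rw [ς, ς, h, pow_add]
  ring

lemma ς_one : ς 1 = 1 := by norm_num [ς]

lemma ς_two : ς 2 = 1 := by norm_num [ς]

namespace CartanCalculus

variable {V M : Type*} [AddCommGroup V] [Module ℝ V] [AddCommGroup M] [Module ℝ M]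
  (C : CartanCalculus V M)

/-- The alternating map `(v_i, a_i)_i ↦ ∑_i (-1)^i I_{v_0 ∧ ⋯ v̂_i ⋯ ∧ v_m} a_i`. -/
def contractSum (m : ℕ) : (V × M) [⋀^Fin (m + 1)]→ₗ[ℝ] M :=
  AlternatingMap.alternatizeUncurryFin
    { toFun := fun a => ((LinearMap.applyₗ a.2).compAlternatingMap (C.IM m)).compLinearMap
        (LinearMap.fst ℝ V M)
      map_add' := fun a b => by ext; simp
      map_smul' := fun r a => by ext; simp }

lemma contractSum_apply {m : ℕ} (x : Fin (m + 1) → V × M) :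
    C.contractSum m x = altSum (fun a y => C.IM m (Prod.fst ∘ y) a.2) x := by
  rw [contractSum, AlternatingMap.alternatizeUncurryFin_apply, altSum]
  refine Finset.sum_congr rfl fun i _ => ?_
  rw [← Int.cast_smul_eq_zsmul ℝ]
  simp
  rfl

/-- The form components
`ς(m) (-∑_i (-1)^i I_{v_0 ∧ ⋯ v̂_i ⋯ ∧ v_{m-1}} a_i + I_{v_0 ∧ ⋯ ∧ v_{m-1}} A)`
of the `L_∞`-morphism, as alternating maps. Entries are numbered from `0` here, whence the sign
of the sum. -/
def morph (A : M) : (m : ℕ) → (V × M) [⋀^Fin m]→ₗ[ℝ] M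
  | 0 => 0
  | m + 1 => ς (m + 1) • (-C.contractSum m +
      ((LinearMap.applyₗ A).compAlternatingMap (C.IM (m + 1))).compLinearMap
        (LinearMap.fst ℝ V M))

lemma morph_succ (A : M) {m : ℕ} (x : Fin (m + 1) → V × M) :
    C.morph A (m + 1) x = ς (m + 1) • (-altSum (fun a y => C.IM m (Prod.fst ∘ y) a.2) x +
      C.IM (m + 1) (Prod.fst ∘ x) A) := by
  rw [← contractSum_apply]; rfl

lemma morph_one (A : M) (x : Fin 1 → V × M) :
    C.morph A 1 x = - (x 0).2 + C.I (x 0).1 A := by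
  rw [morph_succ, altSum_one, ς_one, one_smul]
  rfl

lemma IM_eq_zero {m : ℕ} {v : Fin m → V} (i : Fin m) (h : v i = 0) : C.IM m v = 0 :=
  (C.IM m).map_coord_zero i h

lemma altSum_cons {α N : Type*} [AddCommGroup N] [Module ℝ N] {m : ℕ}
    (G : α → (Fin (m + 1) → α) → N) (a : α) (x : Fin (m + 1) → α) :
    altSum G (Fin.cons a x) = G a x - altSum (fun b y => G b (Fin.cons a y)) x := by
  rw [altSum, Fin.sum_univ_succ, sub_eq_add_neg, altSum, ← Finset.sum_neg_distrib]
  congr 1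
  · simp
  · refine Finset.sum_congr rfl fun i _ => ?_
    rw [removeNth_succ, Fin.tail_cons]
    simp [pow_succ]

lemma morph_cons_zero (A : M) {m : ℕ} (y : M) (x : Fin m → V × M) :
    C.morph A (m + 1) (Fin.cons (0, y) x) = -(ς (m + 1) • C.IM m (Prod.fst ∘ x) y) := by
  rw [morph_succ, C.IM_eq_zero (0 : Fin (m + 1)) (by simp), LinearMap.zero_apply, add_zero,
    smul_neg]
  congr 2
  cases m with
  | zero => rw [altSum_one]; rfl
  | succ m =>
    rw [altSum_cons, sub_eq_self]
    refine altSum_eq_zero fun i => ?_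
    rw [C.IM_eq_zero (0 : Fin (m + 1)) (by simp), LinearMap.zero_apply]

/-- Every term contracts with all vector components but at most one, so two vanishing vector
components suffice for the value to vanish. -/
lemma morph_eq_zero (A : M) {m : ℕ} {x : Fin m → V × M} {i j : Fin m} (hij : i ≠ j)
    (hi : (x i).1 = 0) (hj : (x j).1 = 0) : C.morph A m x = 0 := by
  cases m with
  | zero => exact i.elim0
  | succ m =>
    rw [morph_succ, C.IM_eq_zero i (by simpa using hi), LinearMap.zero_apply, add_zero,
      altSum_eq_zero, neg_zero, smul_zero]
    intro k
    have h (l : Fin (m + 1)) (hl : (x l).1 = 0) (hk : l ≠ k) :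
        C.IM m (Prod.fst ∘ k.removeNth x) (x k).2 = 0 := by
      obtain ⟨p, rfl⟩ := Fin.exists_succAbove_eq hk
      rw [C.IM_eq_zero p (by simpa [Fin.removeNth] using hl), LinearMap.zero_apply]
    by_cases hk : i = k
    · exact h j hj (fun h => hij (hk.trans h.symm))
    · exact h i hi hk

lemma altSum_fst {N : Type*} [AddCommGroup N] [Module ℝ N] {m : ℕ} (G : V → (Fin m → V) → N)
    (x : Fin (m + 1) → V × M) :
    altSum G (Prod.fst ∘ x) = altSum (fun a y => G a.1 (Prod.fst ∘ y)) x := rfl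

lemma altSum_apply {α : Type*} {m : ℕ} (G : α → (Fin m → α) → Module.End ℝ M)
    (x : Fin (m + 1) → α) (y : M) : altSum G x y = altSum (fun a z => G a z y) x :=
  map_altSum (LinearMap.applyₗ y) G x

/-- The part of the morphism equation that involves the forms `a_i`. -/
lemma D_contractSum {m : ℕ} (x : Fin (m + 2) → V × M) :
    C.D (C.contractSum (m + 1) x) = (-1 : ℝ) ^ m •
      (-altSum (fun a y => C.IM (m + 1) (Prod.fst ∘ y) (C.D a.2)) x -
        altSum (fun a y => C.L a.1 (C.contractSum m y)) x +
        (2⁻¹ : ℝ) • altSum (fun a y => altSum (fun b z =>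
          C.contractSum m (Fin.cons (C.br a.1 b.1, 0) z)) y) x) := by
  have h1 (a : V × M) (y : Fin (m + 1) → V × M) :
      C.D (C.IM (m + 1) (Prod.fst ∘ y) a.2) = (-1 : ℝ) ^ m •
        (altSum (fun b z => C.L b.1 (C.IM m (Prod.fst ∘ z) a.2)) y -
          (2⁻¹ : ℝ) • altSum (fun b z => (C.L b.1 * C.IM m (Prod.fst ∘ z) -
            C.IM m (Prod.fst ∘ z) * C.L b.1) a.2) y -
          C.IM (m + 1) (Prod.fst ∘ y) (C.D a.2)) := by
    have h := congrArg (fun T => T a.2) (C.D_IM (Prod.fst ∘ y))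
    simp only [altSum_fst] at h
    simp only [Module.End.mul_apply, LinearMap.smul_apply, LinearMap.sub_apply, altSum_apply] at h
    exact h
  -- the commutators `[𝓛_{v_b}, I_⋯]` in `h1` produce the terms with brackets
  have h2 : altSum (fun a y => altSum (fun b z =>
      C.contractSum m (Fin.cons (C.br a.1 b.1, 0) z)) y) x =
      - altSum (fun a y => altSum (fun b z => (C.L b.1 * C.IM m (Prod.fst ∘ z) -
        C.IM m (Prod.fst ∘ z) * C.L b.1) a.2) y) x := by
    cases m with
    | zero =>
      simp only [altSum_one, contractSum_apply, IM_zero]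
      simp [altSum]
    | succ m =>
      have h3 (a b : V × M) (z : Fin (m + 1) → V × M) :
          C.contractSum (m + 1) (Fin.cons (C.br a.1 b.1, 0) z) =
          - altSum (fun c w => C.IM (m + 1) (Fin.cons (C.br a.1 b.1) (Prod.fst ∘ w)) c.2) z := by
        rw [contractSum_apply, altSum_cons, map_zero, zero_sub]
        congr 2
      have h4 (a b : V × M) (z : Fin (m + 1) → V × M) :
          (C.L b.1 * C.IM (m + 1) (Prod.fst ∘ z) - C.IM (m + 1) (Prod.fst ∘ z) * C.L b.1) a.2 =
          altSum (fun c w => C.IM (m + 1) (Fin.cons (C.br b.1 c.1) (Prod.fst ∘ w)) a.2) z := by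
        rw [lie_IM_eq_altSum, altSum_fst, altSum_apply]
      simp only [h3, h4, altSum_neg]
      congr 1
      -- move the entry that carries the form past the two entries of the bracket
      rw [altSum_altSum_swap (fun a b z => altSum (fun c w =>
        C.IM (m + 1) (Fin.cons (C.br b.1 c.1) (Prod.fst ∘ w)) a.2) z) x]
      have h5 (a : V × M) (y : Fin (m + 2) → V × M) := altSum_altSum_swap (fun b c w =>
        C.IM (m + 1) (Fin.cons (C.br a.1 c.1) (Prod.fst ∘ w)) b.2) y
      simp only [h5, altSum_neg, neg_neg]
  have h6 : altSum (fun a y => C.L a.1 (C.contractSum m y)) x =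
      - altSum (fun a y => altSum (fun b z => C.L b.1 (C.IM m (Prod.fst ∘ z) a.2)) y) x := by
    simp only [contractSum_apply, map_altSum]
    rw [altSum_altSum_swap]
  rw [contractSum_apply, map_altSum, h2, h6]
  simp only [h1, altSum_smul, altSum_sub]
  module

/-- The morphism equation, with the sums over unshuffles written as signed sums over entries of
the tuple. -/
theorem morph_identity (A W : M) {m : ℕ} (x : Fin (m + 2) → V × M)
    (h : C.IM (m + 2) (Prod.fst ∘ x) (C.D A) = C.IM (m + 2) (Prod.fst ∘ x) W) :
    C.D (C.morph A (m + 2) x) +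
      ((-1) ^ (m + 1) * ς (m + 2)) • altSum (fun a y => C.IM (m + 1) (Prod.fst ∘ y) (C.D a.2)) x -
      (2⁻¹ : ℝ) • altSum (fun a y => altSum (fun b z =>
        C.morph A (m + 1) (Fin.cons (C.br a.1 b.1, 0) z)) y) x -
      ((-1) ^ m * ς (m + 2)) • C.IM (m + 2) (Prod.fst ∘ x) W +
      altSum (fun a y => C.L a.1 (C.morph A (m + 1) y)) x = 0 := by
  have h1 := congrArg (fun T => T A) (C.D_IM (Prod.fst ∘ x))
  simp only [altSum_fst, lie_IM_eq_altSum] at h1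
  simp only [Module.End.mul_apply, LinearMap.smul_apply, LinearMap.sub_apply, altSum_apply, h]
    at h1
  have h2 (a b : V × M) (z : Fin m → V × M) :
      C.morph A (m + 1) (Fin.cons (C.br a.1 b.1, 0) z) =
      ς (m + 1) • (-C.contractSum m (Fin.cons (C.br a.1 b.1, 0) z) +
        C.IM (m + 1) (Fin.cons (C.br a.1 b.1) (Prod.fst ∘ z)) A) := by
    rw [morph_succ, contractSum_apply]
    congr 4
    funext i
    refine Fin.cases rfl (fun i => rfl) i
  simp only [h2, morph_succ, ← contractSum_apply, map_smul, map_add, map_neg, D_contractSum, h1,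
    altSum_smul, altSum_add, altSum_neg, ς_succ (m + 1)]
  rcases neg_one_pow_eq_or ℝ m with h3 | h3 <;> simp only [pow_succ, h3] <;> module

/-- The generalized Jacobi identity of the brackets `ς(k) I_{v_1 ∧ ⋯ ∧ v_k} W`, with the sums over
unshuffles written as signed sums. -/
theorem D_IM_eq_altSum (W : M) {m : ℕ} (v : Fin (m + 2) → V) (hD : C.D W = 0)
    (hL : ∀ i, C.L (v i) W = 0) :
    C.D (C.IM (m + 2) v W) = (-1 : ℝ) ^ (m + 1) • (2⁻¹ : ℝ) •
      altSum (fun a y => altSum (fun b z => C.IM (m + 1) (Fin.cons (C.br a b) z) W) y) v := by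
  have h1 := congrArg (fun T => T W) (C.D_IM v)
  simp only [Module.End.mul_apply, LinearMap.smul_apply, LinearMap.sub_apply, altSum_apply, hD,
    map_zero, sub_zero] at h1
  have h2 : altSum (fun a z => C.IM (m + 1) z (C.L a W)) v = 0 :=
    altSum_eq_zero fun i => by rw [hL, map_zero]
  -- `𝓛_{v_a}` annihilates `W`, so its commutator with `I` applied to `W` is just `𝓛_{v_a} I W`
  have h3 : altSum (fun a y => altSum (fun b z => C.IM (m + 1) (Fin.cons (C.br a b) z) W) y) v =
      altSum (fun a z => C.L a (C.IM (m + 1) z W)) v := by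
    rw [← sub_zero (altSum (fun a z => C.L a (C.IM (m + 1) z W)) v), ← h2, ← altSum_sub]
    congr 1
    funext a y
    rw [← altSum_apply, ← lie_IM_eq_altSum]
    rfl
  rw [h1, h3, altSum_sub, h2, sub_zero]
  module

end CartanCalculus

/-! ### Unshuffles -/

/-- Permutations that agree off `S` and are strictly increasing on `S` are equal. -/
lemma perm_eq_of_strictMonoOn {m : ℕ} {σ τ : Equiv.Perm (Fin m)} {S : Set (Fin m)}
    (hσ : StrictMonoOn σ S) (hτ : StrictMonoOn τ S) (h : ∀ a ∉ S, σ a = τ a) : σ = τ := by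
  have key {σ τ : Equiv.Perm (Fin m)} (hτ : StrictMonoOn τ S) (h : ∀ a ∉ S, σ a = τ a)
      (a : Fin m) (ha : a ∈ S) (ih : ∀ b < a, σ b = τ b) : ¬ σ a < τ a := by
    intro hlt
    obtain ⟨b, hb⟩ := τ.surjective (σ a)
    have hne : b ≠ a := by rintro rfl; exact absurd hb.symm (ne_of_lt hlt)
    rcases lt_or_gt_of_ne hne with hba | hba
    · exact hne (σ.injective ((ih b hba).trans hb))
    · by_cases hbS : b ∈ S
      · have := hτ ha hbS hba
        rw [hb] at this
        exact lt_asymm this hlt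
      · exact hne (σ.injective ((h b hbS).trans hb))
  refine Equiv.ext fun a => ?_
  induction a using WellFoundedLT.induction with
  | ind a ih =>
    by_cases ha : a ∈ S
    · exact le_antisymm (not_lt.1 (key hσ (fun a ha => (h a ha).symm) a ha
        fun b hb => (ih b hb).symm)) (not_lt.1 (key hτ h a ha ih))
    · exact h a ha

/-- The permutation `0 ↦ i`, `j + 1 ↦ i.succAbove (τ j)`. -/
def consPerm {m : ℕ} (i : Fin (m + 1)) (τ : Equiv.Perm (Fin m)) : Equiv.Perm (Fin (m + 1)) :=
  i.cycleRange.symm * Equiv.Perm.decomposeFin.symm (0, τ)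

@[simp] lemma consPerm_zero {m : ℕ} (i : Fin (m + 1)) (τ : Equiv.Perm (Fin m)) :
    consPerm i τ 0 = i := by simp [consPerm]

@[simp] lemma consPerm_succ {m : ℕ} (i : Fin (m + 1)) (τ : Equiv.Perm (Fin m)) (j : Fin m) :
    consPerm i τ j.succ = i.succAbove (τ j) := by simp [consPerm]

lemma sign_consPerm {m : ℕ} (i : Fin (m + 1)) (τ : Equiv.Perm (Fin m)) :
    Equiv.Perm.sign (consPerm i τ) = (-1) ^ (i : ℕ) * Equiv.Perm.sign τ := by
  simp [consPerm]

lemma comp_consPerm {α : Type*} {m : ℕ} (x : Fin (m + 1) → α) (i : Fin (m + 1))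
    (τ : Equiv.Perm (Fin m)) : x ∘ consPerm i τ = Fin.cons (x i) (i.removeNth x ∘ τ) := by
  funext j
  refine Fin.cases ?_ (fun j => ?_) j
  · simp
  · simp [Fin.removeNth]

lemma mem_Sh {k m : ℕ} {σ : Equiv.Perm (Fin m)} :
    σ ∈ Sh k m ↔ StrictMonoOn σ {a | (a : ℕ) < k} ∧ StrictMonoOn σ {a | k ≤ (a : ℕ)} := by
  simp only [Sh, Finset.mem_filter, Finset.mem_univ, true_and]
  refine and_congr ⟨fun h a _ b hb hab => h a b hab hb, fun h a b hab hb => h ?_ hb hab⟩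
    ⟨fun h a ha b _ hab => h a b ha hab, fun h a b ha hab => h ha ?_ hab⟩
  · exact lt_trans (show (a : ℕ) < b from hab) hb
  · exact le_trans ha (le_of_lt (show (a : ℕ) < b from hab))

section Sums

variable {N : Type*} [AddCommMonoid N]

lemma consPerm_injective {m : ℕ} (τ : Equiv.Perm (Fin m)) :
    Function.Injective fun i => consPerm i τ := fun i j h => by
  simpa using congrArg (fun σ => σ 0) h

/-- The `(1, m)`-unshuffles are indexed by the entry moved to the front. -/
lemma sum_Sh_one {m : ℕ} (F : Equiv.Perm (Fin (m + 1)) → N) :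
    ∑ σ ∈ Sh 1 (m + 1), F σ = ∑ i, F (consPerm i 1) := by
  have hmono (i : Fin (m + 1)) : StrictMonoOn (consPerm i (1 : Equiv.Perm (Fin m)))
      {a | 1 ≤ (a : ℕ)} := by
    intro a ha b hb hab
    obtain ⟨a, rfl⟩ := Fin.exists_succ_eq.2 (show a ≠ 0 by rintro rfl; simp at ha)
    obtain ⟨b, rfl⟩ := Fin.exists_succ_eq.2 (show b ≠ 0 by rintro rfl; simp at hb)
    simpa using hab
  refine (Finset.sum_nbij (fun i => consPerm i 1) (fun i _ => mem_Sh.2 ⟨?_, hmono i⟩)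
    (consPerm_injective 1).injOn (fun σ hσ => ⟨σ 0, Finset.mem_coe.2 (Finset.mem_univ _), ?_⟩)
    fun _ _ => rfl).symm
  · intro a ha b hb hab
    have : (a : ℕ) < b := hab
    simp only [Set.mem_ofPred_eq] at hb
    omega
  · refine perm_eq_of_strictMonoOn (hmono _) (mem_Sh.1 hσ).2 fun a ha => ?_
    have : a = 0 := Fin.ext (by simp at ha; simpa using ha)
    rw [this, consPerm_zero]

lemma consPerm_mul_finRotate_last {m : ℕ} (i : Fin (m + 1)) (τ : Equiv.Perm (Fin m)) :
    (consPerm i τ * finRotate (m + 1)) (Fin.last m) = i := by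
  simp

lemma consPerm_mul_finRotate_castSucc {m : ℕ} (i : Fin (m + 1)) (τ : Equiv.Perm (Fin m))
    (j : Fin m) : (consPerm i τ * finRotate (m + 1)) j.castSucc = i.succAbove (τ j) := by
  rw [Equiv.Perm.mul_apply, finRotate_apply, ← consPerm_succ]
  simp

/-- The `(m, 1)`-unshuffles are indexed by the entry moved to the end. -/
lemma sum_Sh_last {m : ℕ} (F : Equiv.Perm (Fin (m + 1)) → N) :
    ∑ σ ∈ Sh m (m + 1), F σ = ∑ i, F (consPerm i 1 * finRotate (m + 1)) := by
  have hmono (i : Fin (m + 1)) :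
      StrictMonoOn (consPerm i (1 : Equiv.Perm (Fin m)) * finRotate (m + 1)) {a | (a : ℕ) < m} := by
    intro a ha b hb hab
    obtain ⟨a, rfl⟩ : ∃ a' : Fin m, a'.castSucc = a := ⟨⟨a, ha⟩, rfl⟩
    obtain ⟨b, rfl⟩ : ∃ b' : Fin m, b'.castSucc = b := ⟨⟨b, hb⟩, rfl⟩
    rw [consPerm_mul_finRotate_castSucc, consPerm_mul_finRotate_castSucc]
    simpa using hab
  have hlast (a : Fin (m + 1)) (ha : m ≤ (a : ℕ)) : a = Fin.last m :=
    Fin.ext (le_antisymm (Nat.lt_succ_iff.1 a.2) ha)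
  refine (Finset.sum_nbij (fun i => consPerm i 1 * finRotate (m + 1))
    (fun i _ => mem_Sh.2 ⟨hmono i, ?_⟩) ?_
    (fun σ hσ => ⟨σ (Fin.last m), Finset.mem_coe.2 (Finset.mem_univ _), ?_⟩)
    fun _ _ => rfl).symm
  · intro a ha b hb hab
    rw [hlast a ha, hlast b hb] at hab
    exact absurd hab (lt_irrefl _)
  · exact fun i _ j _ h => consPerm_injective 1 (mul_right_cancel h)
  · refine perm_eq_of_strictMonoOn (hmono _) (mem_Sh.1 hσ).1 fun a ha => ?_
    rw [hlast a (not_lt.1 ha), consPerm_mul_finRotate_last]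

/-- The ordered pairs of entries moved to the front are counted twice if the summand is symmetric in
them. -/
lemma sum_Sh_two {m : ℕ} (F : Equiv.Perm (Fin (m + 2)) → N)
    (hF : ∀ σ, F (σ * Equiv.swap 0 1) = F σ) :
    2 • ∑ σ ∈ Sh 2 (m + 2), F σ = ∑ i, ∑ j, F (consPerm i (consPerm j 1)) := by
  classical
  set S : Set (Fin (m + 2)) := {a | 2 ≤ (a : ℕ)} with hS
  set T : Finset (Equiv.Perm (Fin (m + 2))) := {σ | StrictMonoOn σ S} with hT
  have hcases (a : Fin (m + 2)) (ha : a ∉ S) : a = 0 ∨ a = 1 := by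
    simp only [hS, Set.mem_ofPred_eq, not_le] at ha
    rcases (show (a : ℕ) = 0 ∨ (a : ℕ) = 1 by omega) with h | h
    · exact Or.inl (Fin.ext h)
    · exact Or.inr (Fin.ext (by simpa using h))
  have hsucc (a : Fin (m + 2)) (ha : a ∈ S) : ∃ b : Fin m, b.succ.succ = a := by
    have h2 : 2 ≤ (a : ℕ) := ha
    exact ⟨⟨a - 2, by omega⟩, Fin.ext (by simp; omega)⟩
  -- the double sum runs over all permutations that increase from the third entry on; half of them
  -- are unshuffles, and the transposition of the first two entries exchanges the two halves
  have h1 : ∑ i, ∑ j, F (consPerm i (consPerm j 1)) = ∑ σ ∈ T, F σ := by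
    have hmono (i : Fin (m + 2)) (j : Fin (m + 1)) :
        StrictMonoOn (consPerm i (consPerm j 1)) S := by
      intro a ha b hb hab
      obtain ⟨a, rfl⟩ := hsucc a ha
      obtain ⟨b, rfl⟩ := hsucc b hb
      simpa using hab
    have hone (i : Fin (m + 2)) (j : Fin (m + 1)) :
        consPerm i (consPerm j 1) 1 = i.succAbove j := by
      rw [← Fin.succ_zero_eq_one, consPerm_succ, consPerm_zero]
    rw [← Finset.univ.sum_product' Finset.univ
      (fun (i : Fin (m + 2)) (j : Fin (m + 1)) => F (consPerm i (consPerm j 1)))]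
    refine Finset.sum_nbij (fun p => consPerm p.1 (consPerm p.2 1))
      (fun p _ => by simpa [hT] using hmono p.1 p.2) ?_ ?_ fun _ _ => rfl
    · rintro ⟨i, j⟩ - ⟨i', j'⟩ - h
      have h0 : i = i' := by simpa using congrArg (fun σ => σ 0) h
      subst h0
      have h1 := congrArg (fun σ => σ 1) h
      simp only [hone] at h1
      rw [Fin.succAbove_right_injective h1]
    · intro σ hσ
      have hσ : StrictMonoOn σ S := by simpa [hT] using hσ
      have hne : σ 1 ≠ σ 0 := fun h => by simpa using σ.injective h
      obtain ⟨j, hj⟩ := Fin.exists_succAbove_eq hne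
      refine ⟨(σ 0, j), by simp, perm_eq_of_strictMonoOn (hmono _ _) hσ fun a ha => ?_⟩
      rcases hcases a ha with rfl | rfl
      · simp
      · rw [hone]; exact hj
  have h2 : T.filter (fun σ => σ 0 < σ 1) = Sh 2 (m + 2) := by
    ext σ
    rw [Finset.mem_filter, mem_Sh, and_comm]
    refine and_congr ⟨fun h a ha b hb hab => ?_, fun h => h (by simp) (by simp) (by simp)⟩
      (by simp [hT, hS])
    have hb2 : (b : ℕ) < 2 := hb
    have hab' : (a : ℕ) < b := hab
    have ha0 : a = 0 := Fin.ext (by rw [Fin.val_zero]; omega)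
    have hb1 : b = 1 := Fin.ext (by rw [Fin.val_one]; omega)
    rwa [ha0, hb1]
  have hsw {σ : Equiv.Perm (Fin (m + 2))} (h : StrictMonoOn σ S) :
      StrictMonoOn (σ * Equiv.swap (0 : Fin (m + 2)) 1 : Equiv.Perm _) S := by
    have h0 (a : Fin (m + 2)) (ha : a ∈ S) : Equiv.swap (0 : Fin (m + 2)) 1 a = a := by
      refine Equiv.swap_apply_of_ne_of_ne ?_ ?_ <;> rintro rfl <;> simp [hS] at ha
    intro a ha b hb hab
    simpa [h0 a ha, h0 b hb] using h ha hb hab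
  have h3 : ∑ σ ∈ T.filter (fun σ => ¬ σ 0 < σ 1), F σ =
      ∑ σ ∈ T.filter (fun σ => σ 0 < σ 1), F σ := by
    refine Finset.sum_nbij' (fun σ => σ * Equiv.swap 0 1) (fun σ => σ * Equiv.swap 0 1) ?_ ?_
      (fun σ _ => by rw [mul_assoc, Equiv.swap_mul_self, mul_one])
      (fun σ _ => by rw [mul_assoc, Equiv.swap_mul_self, mul_one]) (fun σ _ => (hF σ).symm)
    · intro σ hσ
      rw [Finset.mem_filter] at hσ ⊢
      have hne : σ 1 ≠ σ 0 := fun h => by simpa using σ.injective h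
      refine ⟨by simpa [hT] using hsw (by simpa [hT] using hσ.1), ?_⟩
      simpa using lt_of_le_of_ne (not_lt.1 hσ.2) hne
    · intro σ hσ
      rw [Finset.mem_filter] at hσ ⊢
      refine ⟨by simpa [hT] using hsw (by simpa [hT] using hσ.1), ?_⟩
      simpa using hσ.2.le
  rw [h1, ← Finset.sum_filter_add_sum_filter_not T (fun σ => σ 0 < σ 1), h3, h2, two_nsmul]

end Sums

/-- An unshuffle is determined by the image of the first `k` entries, which is any `k`-subset. -/
lemma card_Sh {k m : ℕ} (h : k ≤ m) : (Sh k m).card = m.choose k := by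
  classical
  have h1 := Finset.card_powersetCard k (Finset.univ : Finset (Fin m))
  rw [Finset.card_univ, Fintype.card_fin] at h1
  set P : Finset (Fin m) := {a | (a : ℕ) < k} with hP
  have hPc : P.card = k := by
    have : P = Finset.univ.map (Fin.castLEEmb h) := by
      ext a
      simp only [hP, Finset.mem_filter, Finset.mem_univ, true_and, Finset.mem_map]
      exact ⟨fun ha => ⟨⟨a, ha⟩, rfl⟩, by rintro ⟨b, rfl⟩; exact b.2⟩
    rw [this, Finset.card_map, Finset.card_univ, Fintype.card_fin]
  rw [← h1]
  refine Finset.card_nbij (fun σ => P.map σ.toEmbedding) (fun σ _ => ?_) ?_ ?_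
  · refine Finset.mem_coe.2 (Finset.mem_powersetCard.2 ?_)
    exact ⟨Finset.subset_univ _, by rw [Finset.card_map, hPc]⟩
  · intro σ hσ τ hτ hst
    -- both are the increasing enumerations of the same set and of its complement
    obtain ⟨hσ1, hσ2⟩ := mem_Sh.1 (Finset.mem_coe.1 hσ)
    obtain ⟨hτ1, hτ2⟩ := mem_Sh.1 (Finset.mem_coe.1 hτ)
    simp only at hst
    have hmem (a : Fin m) : a ∈ P ↔ τ⁻¹ (σ a) ∈ P := by
      have : σ a ∈ P.map σ.toEmbedding ↔ σ a ∈ P.map τ.toEmbedding := by rw [hst]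
      rw [Finset.mem_map_equiv, Finset.mem_map_equiv] at this
      simpa using this
    have hmem' (a : Fin m) : (τ⁻¹ * σ) a ∈ P ↔ a ∈ P := (hmem a).symm
    have hP' (a : Fin m) : a ∈ P ↔ (a : ℕ) < k := by simp [hP]
    simp only [hP'] at hmem'
    have hστ (a : Fin m) : τ ((τ⁻¹ * σ) a) = σ a := by simp
    suffices h : τ⁻¹ * σ = 1 from (inv_mul_eq_one.1 h).symm
    refine perm_eq_of_strictMonoOn (S := Set.univ) ?_ (fun a _ b _ h => h) (by simp)
    intro a _ b _ hab
    have hab' : (a : ℕ) < b := hab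
    by_cases ha : (a : ℕ) < k
    · by_cases hb : (b : ℕ) < k
      · refine (hτ1.lt_iff_lt ((hmem' a).2 ha) ((hmem' b).2 hb)).1 ?_
        rw [hστ, hστ]
        exact hσ1 ha hb hab
      · have h2 := (hmem' a).2 ha
        have h3 := mt (hmem' b).1 hb
        exact Fin.lt_def.2 (by omega)
    · have hb : ¬ (b : ℕ) < k := by omega
      refine (hτ2.lt_iff_lt (not_lt.1 (mt (hmem' a).1 ha)) (not_lt.1 (mt (hmem' b).1 hb))).1 ?_
      rw [hστ, hστ]
      exact hσ2 (not_lt.1 ha) (not_lt.1 hb) hab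
  -- conversely, enumerate a subset and its complement increasingly
  · intro s hs
    have hs : s.card = k := (Finset.mem_powersetCard.1 (Finset.mem_coe.1 hs)).2
    have hsc : sᶜ.card = m - k := by rw [Finset.card_compl, hs, Fintype.card_fin]
    set ψ := finSumEquivOfFinset hs hsc with hψ
    set φ : Fin k ⊕ Fin (m - k) ≃ Fin m := finSumFinEquiv.trans (finCongr (by omega)) with hφ
    have hl (a : Fin m) (ha : (a : ℕ) < k) : φ.symm a = Sum.inl ⟨a, ha⟩ := by
      rw [Equiv.symm_apply_eq]; exact Fin.ext rfl
    have hr (a : Fin m) (ha : k ≤ (a : ℕ)) : φ.symm a = Sum.inr ⟨a - k, by omega⟩ := by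
      rw [Equiv.symm_apply_eq]
      exact Fin.ext (by simp [hφ]; omega)
    refine ⟨φ.symm.trans ψ, Finset.mem_coe.2 (mem_Sh.2 ⟨?_, ?_⟩), ?_⟩
    · intro a ha b hb hab
      have ha : (a : ℕ) < k := ha
      have hb : (b : ℕ) < k := hb
      simp only [Equiv.trans_apply, hl a ha, hl b hb, hψ, finSumEquivOfFinset_inl]
      exact (s.orderEmbOfFin hs).strictMono hab
    · intro a ha b hb hab
      have ha : k ≤ (a : ℕ) := ha
      have hb : k ≤ (b : ℕ) := hb
      have hab : (a : ℕ) < b := hab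
      simp only [Equiv.trans_apply, hr a ha, hr b hb, hψ, finSumEquivOfFinset_inr]
      refine (sᶜ.orderEmbOfFin hsc).strictMono (Fin.lt_def.2 ?_)
      simp only
      omega
    · refine Finset.eq_of_subset_of_card_le ?_ (by rw [Finset.card_map, hPc, hs])
      intro c hc
      obtain ⟨a, ha, rfl⟩ := Finset.mem_map.1 hc
      have ha : (a : ℕ) < k := by simpa [hP] using ha
      simp only [Equiv.toEmbedding_apply, Equiv.trans_apply, hl a ha, hψ, finSumEquivOfFinset_inl]
      exact Finset.orderEmbOfFin_mem _ _ _

section Signed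

variable {α N : Type*} [AddCommGroup N] [Module ℝ N]

lemma neg_one_units_pow_smul (k : ℕ) (y : N) : ((-1 : ℤˣ) ^ k) • y = (-1 : ℝ) ^ k • y := by
  rw [Units.smul_def, ← Int.cast_smul_eq_zsmul ℝ]
  simp

lemma sum_sign_Sh_one {m : ℕ} (G : (Fin (m + 1) → α) → N) (x : Fin (m + 1) → α) :
    ∑ σ ∈ Sh 1 (m + 1), Equiv.Perm.sign σ • G (x ∘ σ) =
      altSum (fun a y => G (Fin.cons a y)) x := by
  rw [sum_Sh_one]
  refine Finset.sum_congr rfl fun i _ => ?_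
  rw [comp_consPerm, sign_consPerm, map_one, mul_one, neg_one_units_pow_smul]
  rfl

lemma sum_sign_Sh_two {m : ℕ} (G : (Fin (m + 2) → α) → N)
    (hG : ∀ y, G (y ∘ Equiv.swap 0 1) = - G y) (x : Fin (m + 2) → α) :
    ∑ σ ∈ Sh 2 (m + 2), Equiv.Perm.sign σ • G (x ∘ σ) =
      (2⁻¹ : ℝ) • altSum (fun a y => altSum (fun b z => G (Fin.cons a (Fin.cons b z))) y) x := by
  have h := sum_Sh_two (fun σ => Equiv.Perm.sign σ • G (x ∘ σ)) (fun σ => by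
    rw [Equiv.Perm.sign_mul, Equiv.Perm.sign_swap (by simp), Equiv.Perm.coe_mul,
      ← Function.comp_assoc, hG]
    simp)
  have h2 : ∑ i, ∑ j, Equiv.Perm.sign (consPerm i (consPerm j 1)) •
      G (x ∘ consPerm i (consPerm j 1)) =
      altSum (fun a y => altSum (fun b z => G (Fin.cons a (Fin.cons b z))) y) x := by
    refine Finset.sum_congr rfl fun i _ => ?_
    simp only [altSum, Finset.smul_sum]
    refine Finset.sum_congr rfl fun j _ => ?_
    rw [comp_consPerm, comp_consPerm, sign_consPerm, sign_consPerm, map_one, mul_one, mul_smul,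
      neg_one_units_pow_smul, neg_one_units_pow_smul]
    rfl
  rw [← h2, ← h, ← Nat.cast_smul_eq_nsmul ℝ, smul_smul]
  norm_num

/-- The `(m + 1, 1)`-unshuffles `τ` of `m + 2` entries with `τ(1) < τ(m + 2)` are those that do not
move the first entry to the end, so their signed sum lacks one summand. -/
lemma sum_sign_Sh_last {m : ℕ} (G : (Fin (m + 2) → α) → N) (x : Fin (m + 2) → α) :
    ∑ σ ∈ (Sh (m + 1) (m + 2)).filter (fun τ => τ 0 < τ (Fin.last (m + 1))),
        Equiv.Perm.sign σ • G (x ∘ σ) =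
      (-1 : ℝ) ^ (m + 1) • (altSum (fun a y => G (Fin.snoc y a)) x -
        G (Fin.snoc (Fin.tail x) (x 0))) := by
  have hR : altSum (fun a y => G (Fin.snoc y a)) x = G (Fin.snoc (Fin.tail x) (x 0)) +
      ∑ i : Fin (m + 1), (-1 : ℝ) ^ (i.succ : ℕ) • G (Fin.snoc (i.succ.removeNth x) (x i.succ)) := by
    rw [altSum, Fin.sum_univ_succ, Fin.val_zero, pow_zero, one_smul]
    rfl
  rw [Finset.sum_filter, sum_Sh_last, Fin.sum_univ_succ, hR]
  have h0 : ¬ ((consPerm 0 (1 : Equiv.Perm (Fin (m + 1))) * finRotate (m + 1 + 1)) 0 <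
      (consPerm 0 (1 : Equiv.Perm (Fin (m + 1))) * finRotate (m + 1 + 1)) (Fin.last (m + 1))) := by
    rw [consPerm_mul_finRotate_last]; exact Fin.not_lt_zero _
  have h1 (i : Fin (m + 1)) :
      (consPerm i.succ (1 : Equiv.Perm (Fin (m + 1))) * finRotate (m + 1 + 1)) 0 <
      (consPerm i.succ (1 : Equiv.Perm (Fin (m + 1))) * finRotate (m + 1 + 1)) (Fin.last (m + 1)) := by
    rw [consPerm_mul_finRotate_last, ← Fin.castSucc_zero, consPerm_mul_finRotate_castSucc]
    simp
  have h2 (i : Fin (m + 2)) : x ∘ (consPerm i (1 : Equiv.Perm (Fin (m + 1))) * finRotate (m + 1 + 1))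
      = Fin.snoc (i.removeNth x) (x i) := by
    funext j
    refine Fin.lastCases ?_ (fun j => ?_) j
    · rw [Function.comp, consPerm_mul_finRotate_last, Fin.snoc_last]
    · rw [Function.comp, consPerm_mul_finRotate_castSucc, Fin.snoc_castSucc]
      rfl
  rw [if_neg h0]
  simp only [if_pos (h1 _), h2]
  rw [add_sub_cancel_left, zero_add, Finset.smul_sum]
  refine Finset.sum_congr rfl fun i _ => ?_
  rw [Equiv.Perm.sign_mul, sign_consPerm, sign_finRotate, map_one, mul_one, ← pow_add,
    neg_one_units_pow_smul, smul_smul, ← pow_add, add_comm]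
  rfl

lemma filter_Sh_one {m : ℕ} :
    (Sh 1 (m + 2)).filter (fun τ => τ 0 < τ 1) = {1} := by
  ext τ
  rw [Finset.mem_filter, Finset.mem_singleton]
  constructor
  · rintro ⟨h, h0⟩
    refine perm_eq_of_strictMonoOn (S := Set.univ) ?_ (fun a _ b _ h => h) (by simp)
    intro a _ b _ hab
    have hab' : (a : ℕ) < b := hab
    have hmono := (mem_Sh.1 h).2
    by_cases ha : a = 0
    · subst ha
      by_cases hb : b = 1
      · rwa [hb]
      · rw [Fin.ext_iff, Fin.val_one] at hb
        refine h0.trans (hmono (by simp) (show 1 ≤ (b : ℕ) by omega) (Fin.lt_def.2 ?_))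
        rw [Fin.val_zero] at hab'
        rw [Fin.val_one]
        omega
    · rw [Fin.ext_iff, Fin.val_zero] at ha
      exact hmono (show 1 ≤ (a : ℕ) by omega) (show 1 ≤ (b : ℕ) by omega) hab
  · rintro rfl
    exact ⟨mem_Sh.2 ⟨fun a _ b _ h => h, fun a _ b _ h => h⟩, by simp⟩

end Signed

/-- If at most one of the degrees is nonzero, the Koszul sign is trivial. -/
lemma χ_eq_sign {m : ℕ} (σ : Equiv.Perm (Fin m)) {e : Fin m → ℤ}
    (h : ∀ a b, a ≠ b → e a = 0 ∨ e b = 0) : χ σ e = Equiv.Perm.sign σ := by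
  rw [χ, Finset.prod_eq_one, mul_one]
  intro p _
  split_ifs with hp
  · have hne : σ p.1 ≠ σ p.2 := fun h => absurd (σ.injective h) hp.1.ne
    rcases h _ _ hne with h | h <;> simp [h]
  · rfl

/-! ### Cartan calculus on the Čech–de Rham complex -/

section CechCartan

variable {E : Type*} [NormedAddCommGroup E] [NormedSpace ℝ E] [FiniteDimensional ℝ E]
  {X : Type*} [TopologicalSpace X] [ChartedSpace E X] [IsManifold 𝓘(ℝ, E) ∞ X]
  {κ : Type*} {𝒰 : κ → TopologicalSpace.Opens X}

variable (E) in
/-- Cartan calculus on the forms on an open set. -/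
def formsCartan (U : TopologicalSpace.Opens X) : CartanCalculus (VField E X) (Forms E U) where
  br := VField.bracket
  D := d U
  I := ι U
  D_D := LinearMap.ext d_d
  I_I v := LinearMap.ext (ι_ι_self v)
  lie_I v w := LinearMap.ext (lieD_ι v w)

lemma res_apply {U V : TopologicalSpace.Opens X} (h : V ≤ U) (η : Forms E U) (k : ℕ) :
    ((res h η k : DForm E V k) : X → E [⋀^Fin k]→L[ℝ] ℝ) = (V : Set X).indicator (η k).1 := rfl

lemma d_res {U V : TopologicalSpace.Opens X} (h : V ≤ U) (η : Forms E U) :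
    d V (res h η) = res h (d U η) := by
  funext k
  cases k with
  | zero =>
    refine Subtype.ext (funext fun x => ?_)
    simp [d_apply_zero, res_apply]
  | succ k =>
    refine Subtype.ext (funext fun x => ?_)
    rw [res_apply, d_apply_succ, d_apply_succ]
    by_cases hx : x ∈ V
    · rw [Set.indicator_of_mem (show x ∈ (V : Set X) from hx), extD_apply _ hx,
        extD_apply _ (h hx)]
      refine Filter.EventuallyEq.extDeriv_eq ?_
      filter_upwards [(isOpen_chartDom x V).mem_nhds (mem_chartDom hx)] with y hy
      have hy2 : (extChartAt 𝓘(ℝ, E) x).symm y ∈ (V : Set X) := hy.2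
      simp only [rep, res_apply]
      rw [Set.indicator_of_mem hy2]
    · rw [Set.indicator_of_notMem (show x ∉ (V : Set X) from hx)]
      exact Set.indicator_of_notMem (show x ∉ (V : Set X) from hx) _

lemma ι_res {U V : TopologicalSpace.Opens X} (h : V ≤ U) (v : VField E X) (η : Forms E U) :
    ι V v (res h η) = res h (ι U v η) := by
  funext k
  refine Subtype.ext (funext fun x => ?_)
  rw [res_apply, ι_apply, ι_apply, contractRaw, res_apply]
  by_cases hx : x ∈ (V : Set X)
  · rw [Set.indicator_of_mem hx, Set.indicator_of_mem hx, contractRaw]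
  · rw [Set.indicator_of_notMem hx, Set.indicator_of_notMem hx]; rfl

lemma Tot.map_apply (φ : ∀ U : TopologicalSpace.Opens X, Forms E U →ₗ[ℝ] Forms E U)
    (θ : Tot E 𝒰) (i : ℕ) (α : Fin (i + 1) → κ) : Tot.map φ θ i α = φ _ (θ i α) := rfl

lemma Tot.sgn_apply (m : ℕ) (θ : Tot E 𝒰) (i : ℕ) (α : Fin (i + 1) → κ) :
    Tot.sgn m θ i α = (-1 : ℝ) ^ (m * i) • θ i α := rfl

lemma δ_apply_zero (θ : Tot E 𝒰) (α : Fin 1 → κ) : δ θ 0 α = 0 := rfl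

lemma δ_apply_succ (θ : Tot E 𝒰) (i : ℕ) (α : Fin (i + 2) → κ) :
    δ θ (i + 1) α = ∑ k : Fin (i + 2),
      (-1 : ℝ) ^ (k : ℕ) • res (inter_le 𝒰 α k.succAbove) (θ i (α ∘ k.succAbove)) := rfl

lemma δ_map (φ : ∀ U : TopologicalSpace.Opens X, Forms E U →ₗ[ℝ] Forms E U)
    (hφ : ∀ {U V : TopologicalSpace.Opens X} (h : V ≤ U) (η : Forms E U),
      φ V (res h η) = res h (φ U η)) (θ : Tot E 𝒰) :
    δ (Tot.map φ θ) = Tot.map φ (δ θ) := by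
  funext i α
  cases i with
  | zero => rw [Tot.map_apply, δ_apply_zero, δ_apply_zero, map_zero]
  | succ i =>
    rw [Tot.map_apply, δ_apply_succ, δ_apply_succ, map_sum]
    refine Finset.sum_congr rfl fun k _ => ?_
    rw [map_smul, hφ]
    rfl

lemma sgn_map (m : ℕ) (φ : ∀ U : TopologicalSpace.Opens X, Forms E U →ₗ[ℝ] Forms E U)
    (θ : Tot E 𝒰) : Tot.sgn m (Tot.map φ θ) = Tot.map φ (Tot.sgn m θ) := by
  funext i α
  simp only [Tot.sgn_apply, Tot.map_apply, map_smul]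

lemma sgn_one_sgn_one (θ : Tot E 𝒰) : Tot.sgn 1 (Tot.sgn 1 θ) = θ := by
  funext i α
  rw [Tot.sgn_apply, Tot.sgn_apply, smul_smul, ← mul_pow]
  rcases neg_one_pow_eq_or ℝ i with h | h <;> simp

/-- `δ` raises the Čech degree by one, so it anticommutes with the sign `(-1)^i`. -/
lemma sgn_one_δ (θ : Tot E 𝒰) : Tot.sgn 1 (δ θ) + δ (Tot.sgn 1 θ) = 0 := by
  funext i α
  cases i with
  | zero =>
    rw [Pi.add_apply, Pi.add_apply, Tot.sgn_apply, δ_apply_zero, δ_apply_zero, smul_zero, add_zero]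
    rfl
  | succ i =>
    rw [Pi.add_apply, Pi.add_apply, Tot.sgn_apply, δ_apply_succ, δ_apply_succ, Finset.smul_sum,
      ← Finset.sum_add_distrib]
    refine Finset.sum_eq_zero fun k _ => ?_
    rw [Tot.sgn_apply, map_smul, one_mul, one_mul, pow_succ]
    module

/-- The value at a point of a component of a Čech cochain. -/
def Tot.val (θ : Tot E 𝒰) (k : ℕ) (x : X) (i : ℕ) (α : Fin (i + 1) → κ) : E [⋀^Fin k]→L[ℝ] ℝ :=
  (θ i α k).1 x

/-- Cochains are determined by their values at points of the intersections of the cover. -/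
lemma Tot.ext_val {θ ξ : Tot E 𝒰}
    (h : ∀ i α k, ∀ x ∈ inter 𝒰 α, θ.val k x i α = ξ.val k x i α) : θ = ξ := by
  funext i α k
  refine Subtype.ext (funext fun x => ?_)
  by_cases hx : x ∈ inter 𝒰 α
  · exact h i α k x hx
  · rw [(θ i α k).2.2 x hx, (ξ i α k).2.2 x hx]

lemma val_δ (θ : Tot E 𝒰) (k : ℕ) {x : X} {i : ℕ} {α : Fin (i + 2) → κ} (hx : x ∈ inter 𝒰 α) :
    (δ θ).val k x (i + 1) α = altSum (fun _ β => θ.val k x i β) α := by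
  rw [Tot.val, δ_apply_succ, altSum, Finset.sum_apply, Submodule.coe_sum, Finset.sum_apply]
  refine Finset.sum_congr rfl fun j _ => ?_
  rw [Pi.smul_apply, Submodule.coe_smul, Pi.smul_apply, res_apply,
    Set.indicator_of_mem (show x ∈ (inter 𝒰 α : Set X) from hx)]
  rfl

lemma mem_inter_removeNth {x : X} {i : ℕ} {α : Fin (i + 1) → κ} (hx : x ∈ inter 𝒰 α)
    (j : Fin (i + 1)) : x ∈ inter 𝒰 (j.removeNth α) := inter_le 𝒰 α j.succAbove hx

lemma δ_δ (θ : Tot E 𝒰) : δ (δ θ) = 0 := by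
  refine Tot.ext_val fun i α k x hx => ?_
  match i with
  | 0 => rfl
  | 1 =>
    rw [val_δ _ _ hx]
    exact altSum_eq_zero fun _ => rfl
  | i + 2 =>
    rw [val_δ _ _ hx]
    have h1 : altSum (fun _ β => (δ θ).val k x (i + 1) β) α =
        altSum (fun _ β => altSum (fun _ γ => θ.val k x i γ) β) α :=
      Finset.sum_congr rfl fun j _ =>
        congrArg _ (val_δ _ _ (mem_inter_removeNth hx j))
    rw [h1]
    -- the double alternating sum equals its own negative
    have h2 := altSum_altSum_swap (fun _ _ γ => θ.val k x i γ) α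
    have h3 := congrArg (fun z => (2⁻¹ : ℝ) • z) (eq_neg_iff_add_eq_zero.1 h2)
    simp only [smul_zero] at h3
    rw [← two_smul ℝ, smul_smul, inv_mul_cancel₀ two_ne_zero, one_smul] at h3
    exact h3

lemma map_d_map_d (θ : Tot E 𝒰) : Tot.map d (Tot.map d θ) = 0 := by
  funext i α
  exact d_d _

lemma dTot_apply (θ : Tot E 𝒰) : dTot θ = δ θ + Tot.sgn 1 (Tot.map d θ) := rfl

lemma dTot_dTot (θ : Tot E 𝒰) : dTot (dTot θ) = 0 := by
  have h1 : Tot.sgn 1 (Tot.map d (δ θ)) + δ (Tot.sgn 1 (Tot.map d θ)) = 0 := by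
    rw [← δ_map d d_res, sgn_one_δ]
  have h2 : Tot.sgn 1 (Tot.map d (Tot.sgn 1 (Tot.map d θ))) = 0 := by
    rw [← sgn_map 1 d (Tot.map d θ), map_d_map_d, map_zero, map_zero]
  rw [dTot_apply, dTot_apply, map_add, map_add, map_add, δ_δ, h2,
    add_zero, zero_add, add_comm, h1]

/-- The Cartan formula on the Čech–de Rham complex: the Čech part `δ` contributes nothing, since
`ι_v` is twisted by the sign `(-1)^i`. -/
lemma dTot_sgn_ι (v : VField E X) (θ : Tot E 𝒰) :
    dTot (Tot.sgn 1 (Tot.map (fun U => ι U v) θ)) +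
      Tot.sgn 1 (Tot.map (fun U => ι U v) (dTot θ)) = Tot.map (fun U => lieD U v) θ := by
  have h1 : Tot.sgn 1 (Tot.map (fun U => ι U v) (δ θ)) +
      δ (Tot.sgn 1 (Tot.map (fun U => ι U v) θ)) = 0 := by
    rw [← δ_map _ (fun h η => ι_res h v η), sgn_one_δ]
  rw [dTot_apply, dTot_apply, map_add, map_add, ← sgn_map 1 d (Tot.map _ θ), sgn_one_sgn_one,
    ← sgn_map 1 _ (Tot.map d θ), sgn_one_sgn_one]
  have h2 : Tot.map (fun U => lieD U v) θ =
    Tot.map d (Tot.map (fun U => ι U v) θ) + Tot.map (fun U => ι U v) (Tot.map d θ) := rfl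
  rw [h2, add_add_add_comm, add_comm (δ _), h1, zero_add]

variable (E 𝒰) in
/-- The interior product with a vector field on the Čech–de Rham complex, twisted by the sign
`(-1)^i` in Čech degree `i`, so that it anticommutes with `δ`. -/
def totι : VField E X →ₗ[ℝ] Module.End ℝ (Tot E 𝒰) where
  toFun v := Tot.sgn 1 ∘ₗ Tot.map (fun U => ι U v)
  map_add' v w := by
    refine LinearMap.ext fun θ => funext fun i => funext fun α => ?_
    have h : ι (inter 𝒰 α) (v + w) (θ i α) = ι _ v (θ i α) + ι _ w (θ i α) := by
      rw [map_add, LinearMap.add_apply]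
    exact (congrArg _ h).trans (smul_add ((-1 : ℝ) ^ (1 * i)) (ι _ v (θ i α)) (ι _ w (θ i α)))
  map_smul' r v := by
    refine LinearMap.ext fun θ => funext fun i => funext fun α => ?_
    have h : ι (inter 𝒰 α) (r • v) (θ i α) = r • ι _ v (θ i α) := by
      rw [map_smul, LinearMap.smul_apply]
    exact (congrArg _ h).trans (smul_comm ((-1 : ℝ) ^ (1 * i)) r (ι _ v (θ i α)))

variable (E 𝒰) in
/-- Cartan calculus on the Čech–de Rham complex. -/
def totCartan : CartanCalculus (VField E X) (Tot E 𝒰) where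
  br := VField.bracket
  D := dTot
  I := totι E 𝒰
  D_D := LinearMap.ext dTot_dTot
  I_I v := LinearMap.ext fun θ => by
    change Tot.sgn 1 (Tot.map _ (Tot.sgn 1 (Tot.map _ θ))) = 0
    rw [← sgn_map, sgn_one_sgn_one]
    funext i α
    exact ι_ι_self v _
  lie_I v w := LinearMap.ext fun θ => by
    have h (ξ : Tot E 𝒰) := dTot_sgn_ι v ξ
    change dTot (Tot.sgn 1 (Tot.map (fun U => ι U v) (Tot.sgn 1 (Tot.map (fun U => ι U w) θ)))) +
      Tot.sgn 1 (Tot.map (fun U => ι U v) (dTot (Tot.sgn 1 (Tot.map (fun U => ι U w) θ)))) -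
      Tot.sgn 1 (Tot.map (fun U => ι U w) (dTot (Tot.sgn 1 (Tot.map (fun U => ι U v) θ)) +
        Tot.sgn 1 (Tot.map (fun U => ι U v) (dTot θ)))) =
      Tot.sgn 1 (Tot.map (fun U => ι U (v.bracket w)) θ)
    rw [h, h, ← sgn_map]
    exact (map_sub (Tot.sgn 1) _ _).symm.trans
      (congrArg _ (funext fun i => funext fun α => lieD_ι v w (θ i α)))

lemma totCartan_I (v : VField E X) (θ : Tot E 𝒰) :
    (totCartan E 𝒰).I v θ = Tot.sgn 1 (Tot.map (fun U => ι U v) θ) := rfl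

lemma totCartan_L (v : VField E X) (θ : Tot E 𝒰) :
    (totCartan E 𝒰).L v θ = Tot.map (fun U => lieD U v) θ := dTot_sgn_ι v θ

lemma formsCartan_IM (U : TopologicalSpace.Opens X) {m : ℕ} (v : Fin m → VField E X)
    (η : Forms E U) : (formsCartan E U).IM m v η = ιMulti U m v η := by
  induction m generalizing η with
  | zero => rfl
  | succ m ih => exact ih (Fin.tail v) _

/-- The signs in the twisted interior products accumulate to the sign `(-1)^(m i)` of `Ā(m)`. -/
lemma totCartan_IM {m : ℕ} (v : Fin m → VField E X) (θ : Tot E 𝒰) :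
    (totCartan E 𝒰).IM m v θ = Tot.map (fun U => ιMulti U m v) (Tot.sgn m θ) := by
  induction m generalizing θ with
  | zero =>
    funext i α
    rw [CartanCalculus.IM_zero, Tot.map_apply, Tot.sgn_apply, zero_mul, pow_zero, one_smul]
    rfl
  | succ m ih =>
    rw [CartanCalculus.IM_succ, Module.End.mul_apply, ih, totCartan_I, sgn_map, sgn_map]
    have h : Tot.sgn m (Tot.sgn 1 θ) = Tot.sgn (m + 1) θ := by
      funext i α
      rw [Tot.sgn_apply, Tot.sgn_apply, Tot.sgn_apply, smul_smul, ← pow_add]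
      congr 2
      ring
    rw [h]
    rfl

section Res

lemma resTot_apply_zero (η : Forms E (⊤ : TopologicalSpace.Opens X)) (α : Fin 1 → κ) :
    (resTot η : Tot E 𝒰) 0 α = res le_top η := rfl

lemma resTot_apply_succ (η : Forms E (⊤ : TopologicalSpace.Opens X)) (i : ℕ)
    (α : Fin (i + 2) → κ) : (resTot η : Tot E 𝒰) (i + 1) α = 0 := rfl

lemma val_resTot_zero (η : Forms E (⊤ : TopologicalSpace.Opens X)) (k : ℕ) {x : X}
    {α : Fin 1 → κ} (hx : x ∈ inter 𝒰 α) : (resTot η : Tot E 𝒰).val k x 0 α = (η k).1 x := by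
  rw [Tot.val, resTot_apply_zero, res_apply]
  exact Set.indicator_of_mem (show x ∈ (inter 𝒰 α : Set X) from hx) _

lemma sgn_resTot (m : ℕ) (η : Forms E (⊤ : TopologicalSpace.Opens X)) :
    Tot.sgn m (resTot η : Tot E 𝒰) = resTot η := by
  funext i α
  cases i with
  | zero => simp [Tot.sgn_apply]
  | succ i => rw [Tot.sgn_apply, resTot_apply_succ, smul_zero]

lemma map_resTot (φ : ∀ U : TopologicalSpace.Opens X, Forms E U →ₗ[ℝ] Forms E U)
    (hφ : ∀ {U V : TopologicalSpace.Opens X} (h : V ≤ U) (η : Forms E U),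
      φ V (res h η) = res h (φ U η)) (η : Forms E (⊤ : TopologicalSpace.Opens X)) :
    Tot.map φ (resTot η : Tot E 𝒰) = resTot (φ ⊤ η) := by
  funext i α
  cases i with
  | zero => exact hφ le_top η
  | succ i => exact map_zero (φ _)

lemma δ_resTot (η : Forms E (⊤ : TopologicalSpace.Opens X)) : δ (resTot η : Tot E 𝒰) = 0 := by
  refine Tot.ext_val fun i α k x hx => ?_
  match i with
  | 0 => rfl
  | 1 =>
    rw [val_δ _ _ hx]
    have h (j : Fin 2) := val_resTot_zero (𝒰 := 𝒰) η k (mem_inter_removeNth hx j)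
    rw [altSum, Fin.sum_univ_two, h, h]
    simp
    rfl
  | i + 2 =>
    rw [val_δ _ _ hx]
    exact altSum_eq_zero fun _ => rfl

lemma dTot_resTot (η : Forms E (⊤ : TopologicalSpace.Opens X)) :
    dTot (resTot η : Tot E 𝒰) = resTot (d ⊤ η) := by
  rw [dTot_apply, δ_resTot, map_resTot d d_res, sgn_resTot, zero_add]

lemma IM_resTot {m : ℕ} (v : Fin m → VField E X) (η : Forms E (⊤ : TopologicalSpace.Opens X)) :
    (totCartan E 𝒰).IM m v (resTot η) = resTot ((formsCartan E ⊤).IM m v η) := by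
  induction m generalizing η with
  | zero => rfl
  | succ m ih =>
    rw [CartanCalculus.IM_succ, CartanCalculus.IM_succ, Module.End.mul_apply,
      Module.End.mul_apply, ← ih, totCartan_I, map_resTot _ (fun h η => ι_res h (v 0) η),
      sgn_resTot]
    rfl

/-- A form that vanishes on all members of a cover vanishes. -/
lemma resTot_injective (h : ∀ x, ∃ a, x ∈ 𝒰 a) {η : Forms E (⊤ : TopologicalSpace.Opens X)}
    (hη : (resTot η : Tot E 𝒰) = 0) : η = 0 := by
  funext k
  refine Subtype.ext (funext fun x => ?_)
  obtain ⟨a, ha⟩ := h x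
  have hx : x ∈ inter 𝒰 (fun _ : Fin 1 => a) := Set.mem_iInter.2 fun _ => ha
  rw [← val_resTot_zero η k hx, hη]
  rfl

end Res

section Degrees

lemma d_mem_formsDeg {U : TopologicalSpace.Opens X} {p : ℤ} {η : Forms E U}
    (h : η ∈ formsDeg E U p) : d U η ∈ formsDeg E U (p + 1) := by
  intro k hk
  cases k with
  | zero => rfl
  | succ k =>
    have h0 := h k (by push_cast at hk; omega)
    refine Subtype.ext ?_
    rw [d_apply_succ, h0]
    have h := extD_smul (U := U) 0 (0 : X → E [⋀^Fin k]→L[ℝ] ℝ)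
    simpa using h

lemma ι_mem_formsDeg {U : TopologicalSpace.Opens X} {p : ℤ} {η : Forms E U} (v : VField E X)
    (h : η ∈ formsDeg E U p) : ι U v η ∈ formsDeg E U (p - 1) := by
  intro k hk
  have h0 := h (k + 1) (by push_cast; omega)
  refine Subtype.ext (funext fun x => ?_)
  rw [ι_apply, h0]
  simp [contractRaw]

lemma sgn_mem_totDeg {p : ℤ} {θ : Tot E 𝒰} (m : ℕ) (h : θ ∈ totDeg E 𝒰 p) :
    Tot.sgn m θ ∈ totDeg E 𝒰 p := by
  intro i α k hk
  rw [Tot.sgn_apply, Pi.smul_apply, h i α k hk, smul_zero]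

lemma map_mem_totDeg {p q : ℤ} {θ : Tot E 𝒰}
    {φ : ∀ U : TopologicalSpace.Opens X, Forms E U →ₗ[ℝ] Forms E U}
    (hφ : ∀ (U : TopologicalSpace.Opens X) (r : ℤ), ∀ η ∈ formsDeg E U r,
      φ U η ∈ formsDeg E U (r + q))
    (h : θ ∈ totDeg E 𝒰 p) : Tot.map φ θ ∈ totDeg E 𝒰 (p + q) := by
  intro i α k hk
  exact hφ _ (p - i) (θ i α) (fun l hl => h i α l (by omega)) k (by omega)

lemma δ_mem_totDeg {p : ℤ} {θ : Tot E 𝒰} (h : θ ∈ totDeg E 𝒰 p) : δ θ ∈ totDeg E 𝒰 (p + 1) := by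
  intro i α k hk
  cases i with
  | zero => rfl
  | succ i =>
    rw [δ_apply_succ, Finset.sum_apply]
    refine Finset.sum_eq_zero fun j _ => ?_
    refine Subtype.ext ?_
    rw [Pi.smul_apply, Submodule.coe_smul, res_apply, h i _ k (by push_cast at hk; omega)]
    simp

lemma dTot_mem_totDeg {p : ℤ} {θ : Tot E 𝒰} (h : θ ∈ totDeg E 𝒰 p) :
    dTot θ ∈ totDeg E 𝒰 (p + 1) :=
  Submodule.add_mem _ (δ_mem_totDeg h)
    (sgn_mem_totDeg 1 (map_mem_totDeg (fun _ _ _ => d_mem_formsDeg) h))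

lemma totCartan_I_mem {p : ℤ} {θ : Tot E 𝒰} (v : VField E X) (h : θ ∈ totDeg E 𝒰 p) :
    (totCartan E 𝒰).I v θ ∈ totDeg E 𝒰 (p - 1) :=
  sgn_mem_totDeg 1 (map_mem_totDeg (fun _ _ _ => ι_mem_formsDeg v) h)

lemma resTot_mem_totDeg {p : ℤ} {η : Forms E (⊤ : TopologicalSpace.Opens X)}
    (h : η ∈ formsDeg E ⊤ p) : (resTot η : Tot E 𝒰) ∈ totDeg E 𝒰 p := by
  intro i α k hk
  cases i with
  | zero =>
    refine Subtype.ext ?_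
    rw [resTot_apply_zero, res_apply, h k (by simpa using hk)]
    simp
  | succ i => rfl

end Degrees

end CechCartan

/-! ### Exactness of the Čech complex of forms -/

section CechResolution

variable {E : Type*} [NormedAddCommGroup E] [NormedSpace ℝ E] [FiniteDimensional ℝ E]
  {X : Type*} [TopologicalSpace X] [ChartedSpace E X] [IsManifold 𝓘(ℝ, E) ∞ X]
  {κ : Type*} {𝒰 : κ → TopologicalSpace.Opens X}

/-- Being a smooth form is a local property. -/
lemma mem_DForm_of_local {U : TopologicalSpace.Opens X} {k : ℕ} {η : X → E [⋀^Fin k]→L[ℝ] ℝ}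
    (h0 : ∀ x ∉ U, η x = 0)
    (h : ∀ x ∈ U, ∃ V : TopologicalSpace.Opens X, x ∈ V ∧ ∃ ζ ∈ DForm E V k, ∀ y ∈ V, η y = ζ y) :
    η ∈ DForm E U k := by
  refine ⟨fun c y hy => ?_, h0⟩
  obtain ⟨V, hxV, ζ, hζ, he⟩ := h _ hy.2
  have hyV : y ∈ chartDom c V := ⟨hy.1, hxV⟩
  refine ContDiffAt.contDiffWithinAt ?_
  refine ((hζ.1 c).contDiffAt ((isOpen_chartDom c V).mem_nhds hyV)).congr_of_eventuallyEq ?_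
  filter_upwards [(isOpen_chartDom c V).mem_nhds hyV] with z hz
  rw [rep, rep, he _ hz.2]

variable (ρ : SmoothPartitionOfUnity κ 𝓘(ℝ, E) X univ)

/-- Forms on the pieces `U ∩ U_β` glue to a form on `U` by means of a subordinate partition of
unity. -/
lemma finsum_smul_mem (hρ : ρ.IsSubordinate fun a => (𝒰 a : Set X))
    {U : TopologicalSpace.Opens X} {W : κ → TopologicalSpace.Opens X} (hW : ∀ b, W b ≤ U)
    (hU : ∀ b, ∀ x ∈ U, x ∈ 𝒰 b → x ∈ W b) {k : ℕ} {η : κ → X → E [⋀^Fin k]→L[ℝ] ℝ}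
    (hη : ∀ b, η b ∈ DForm E (W b) k) : (fun x => ∑ᶠ b, ρ b x • η b x) ∈ DForm E U k := by
  have hterm (b : κ) : (fun x => ρ b x • η b x) ∈ DForm E U k := by
    refine mem_DForm_of_local (fun x hx => ?_) fun x hx => ?_
    · rw [(hη b).2 x fun h => hx (hW b h), smul_zero]
    · by_cases hxb : x ∈ tsupport (ρ b)
      · exact ⟨W b, hU b x hx (hρ b hxb), _, fn_smul_mem (ρ b).contMDiff.contMDiffOn (hη b),
          fun _ _ => rfl⟩
      · refine ⟨⟨(tsupport (ρ b))ᶜ, (isClosed_tsupport _).isOpen_compl⟩, hxb, 0,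
          Submodule.zero_mem _, fun y hy => ?_⟩
        change ρ b y • η b y = 0
        rw [image_eq_zero_of_notMem_tsupport hy, zero_smul]
  refine mem_DForm_of_local (fun x hx => ?_) fun x hx => ?_
  · rw [← finsum_zero (α := κ)]
    exact finsum_congr fun b => (hterm b).2 x hx
  · obtain ⟨V, hV, hVo, hxV⟩ := eventually_nhds_iff.1 (ρ.eventually_finsupport_subset x)
    refine ⟨U ⊓ ⟨V, hVo⟩, ⟨hx, hxV⟩,
      _, indicator_mem inf_le_left (Submodule.sum_mem (t := ρ.fintsupport x) _ fun b _ => hterm b),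
      fun y hy => ?_⟩
    rw [Set.indicator_of_mem (show y ∈ ((U ⊓ ⟨V, hVo⟩ : TopologicalSpace.Opens X) : Set X) from hy),
      Finset.sum_apply]
    refine finsum_eq_sum_of_support_subset _ fun b hb => ?_
    refine hV y hy.2 ((ρ.mem_finsupport y).2 fun h => hb ?_)
    change ρ b y • η b y = 0
    rw [show ρ b y = 0 from h, zero_smul]

lemma mem_inter_cons {x : X} {b : κ} {i : ℕ} {α : Fin i → κ} :
    x ∈ inter 𝒰 (Fin.cons b α : Fin (i + 1) → κ) ↔ x ∈ 𝒰 b ∧ x ∈ inter 𝒰 α := by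
  constructor
  · intro h
    exact ⟨Set.mem_iInter.1 h 0, Set.mem_iInter.2 fun j => Set.mem_iInter.1 h j.succ⟩
  · rintro ⟨h1, h2⟩
    exact Set.mem_iInter.2 (Fin.cases h1 fun j => Set.mem_iInter.1 h2 j)

/-- The contracting homotopy of the Čech complex given by a subordinate partition of unity:
`(Kθ)_α = ∑_β ρ_β θ_{βα}`. -/
def cechHomotopy (hρ : ρ.IsSubordinate fun a => (𝒰 a : Set X)) (θ : Tot E 𝒰) : Tot E 𝒰 :=
  fun i α k => ⟨fun x => ∑ᶠ b, ρ b x • θ.val k x (i + 1) (Fin.cons b α),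
    finsum_smul_mem ρ hρ (W := fun b => inter 𝒰 (Fin.cons b α : Fin (i + 2) → κ))
      (fun _ _ hx => (mem_inter_cons.1 hx).2) (fun _ _ hx hb => mem_inter_cons.2 ⟨hb, hx⟩)
      fun b => (θ (i + 1) (Fin.cons b α) k).2⟩

/-- The average `∑_β ρ_β θ_β` of a Čech cochain of Čech degree zero, a global form. -/
def cechAverage (hρ : ρ.IsSubordinate fun a => (𝒰 a : Set X)) (θ : Tot E 𝒰) :
    Forms E (⊤ : TopologicalSpace.Opens X) :=
  fun k => ⟨fun x => ∑ᶠ b, ρ b x • θ.val k x 0 (fun _ => b),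
    finsum_smul_mem ρ hρ (W := fun b => inter 𝒰 (fun _ : Fin 1 => b))
      (fun _ => le_top) (fun _ _ _ hb => Set.mem_iInter.2 fun _ => hb)
      fun b => (θ 0 (fun _ => b) k).2⟩

variable {ρ} (hρ : ρ.IsSubordinate fun a => (𝒰 a : Set X))

lemma val_cechHomotopy (θ : Tot E 𝒰) (k : ℕ) (x : X) (i : ℕ) (α : Fin (i + 1) → κ) :
    (cechHomotopy ρ hρ θ).val k x i α =
      ∑ b ∈ ρ.finsupport x, ρ b x • θ.val k x (i + 1) (Fin.cons b α) :=
  (ρ.sum_finsupport_smul_eq_finsum (x₀ := x)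
    fun b x => θ.val k x (i + 1) (Fin.cons b α)).symm

lemma cechAverage_apply (θ : Tot E 𝒰) (k : ℕ) (x : X) :
    (cechAverage ρ hρ θ k).1 x = ∑ b ∈ ρ.finsupport x, ρ b x • θ.val k x 0 (fun _ => b) :=
  (ρ.sum_finsupport_smul_eq_finsum (x₀ := x) fun b x => θ.val k x 0 (fun _ => b)).symm

lemma mem_of_mem_finsupport (hρ : ρ.IsSubordinate fun a => (𝒰 a : Set X)) {x : X} {b : κ}
    (hb : b ∈ ρ.finsupport x) : x ∈ 𝒰 b :=
  hρ b (subset_tsupport _ ((ρ.mem_finsupport x).1 hb))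

lemma sum_finsupport_smul (x : X) {N : Type*} [AddCommGroup N] [Module ℝ N] (a : N) :
    ∑ b ∈ ρ.finsupport x, ρ b x • a = a := by
  rw [← Finset.sum_smul, ρ.sum_finsupport x (mem_univ x), one_smul]

/-- The rows of the Čech–de Rham complex are exact: `δ K + K δ = id`, up to the average in Čech
degree zero. -/
lemma δ_cechHomotopy (θ : Tot E 𝒰) :
    δ (cechHomotopy ρ hρ θ) + cechHomotopy ρ hρ (δ θ) + resTot (cechAverage ρ hρ θ) = θ := by
  refine Tot.ext_val fun i α k x hx => ?_
  change (δ (cechHomotopy ρ hρ θ)).val k x i α + (cechHomotopy ρ hρ (δ θ)).val k x i α +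
    (resTot (cechAverage ρ hρ θ) : Tot E 𝒰).val k x i α = θ.val k x i α
  rw [val_cechHomotopy]
  have h1 : ∑ b ∈ ρ.finsupport x, ρ b x • (δ θ).val k x (i + 1) (Fin.cons b α) =
      θ.val k x i α - ∑ b ∈ ρ.finsupport x,
        ρ b x • altSum (fun _ γ => θ.val k x i (Fin.cons b γ)) α := by
    rw [eq_sub_iff_add_eq, ← Finset.sum_add_distrib]
    refine Eq.trans (Finset.sum_congr rfl fun b hb => ?_) (sum_finsupport_smul (ρ := ρ) x _)
    rw [val_δ _ _ (mem_inter_cons.2 ⟨mem_of_mem_finsupport hρ hb, hx⟩), ← smul_add]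
    congr 1
    cases i with
    | zero =>
      rw [CartanCalculus.altSum_cons (m := 0)]
      exact sub_add_cancel _ _
    | succ i =>
      rw [CartanCalculus.altSum_cons]
      exact sub_add_cancel _ _
  rw [h1]
  cases i with
  | zero =>
    have h2 : (δ (cechHomotopy ρ hρ θ)).val k x 0 α = 0 := rfl
    rw [h2, val_resTot_zero _ _ hx, cechAverage_apply, zero_add, sub_add_eq_add_sub,
      sub_eq_iff_eq_add]
    congr 1
    refine Finset.sum_congr rfl fun b _ => ?_
    rw [altSum_one]
    congr 2
    funext j
    rw [Fin.fin_one_eq_zero j]; rfl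
  | succ i =>
    have h2 : (resTot (cechAverage ρ hρ θ) : Tot E 𝒰).val k x (i + 1) α = 0 := rfl
    have h3 : altSum (fun _ γ => (cechHomotopy ρ hρ θ).val k x i γ) α =
      ∑ b ∈ ρ.finsupport x, ρ b x • altSum (fun _ γ => θ.val k x (i + 1) (Fin.cons b γ)) α := by
      simp only [altSum, val_cechHomotopy, Finset.smul_sum]
      rw [Finset.sum_comm]
      refine Finset.sum_congr rfl fun b _ => Finset.sum_congr rfl fun j _ => ?_
      rw [smul_comm]
    rw [h2, val_δ _ _ hx, h3]
    abel

lemma cechHomotopy_mem {p : ℤ} {θ : Tot E 𝒰} (h : θ ∈ totDeg E 𝒰 p) :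
    cechHomotopy ρ hρ θ ∈ totDeg E 𝒰 (p - 1) := by
  intro i α k hk
  refine Subtype.ext (funext fun x => ?_)
  change (cechHomotopy ρ hρ θ).val k x i α = 0
  rw [val_cechHomotopy]
  refine Finset.sum_eq_zero fun b _ => ?_
  rw [Tot.val, h _ _ k (by push_cast; omega)]
  exact smul_zero _

lemma cechAverage_mem {p : ℤ} {θ : Tot E 𝒰} (h : θ ∈ totDeg E 𝒰 p) :
    cechAverage ρ hρ θ ∈ formsDeg E ⊤ p := by
  intro k hk
  refine Subtype.ext (funext fun x => ?_)
  rw [cechAverage_apply]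
  refine Finset.sum_eq_zero fun b _ => ?_
  rw [Tot.val, h _ _ k (by simpa using hk)]
  exact smul_zero _

lemma add_neg_one_smul_eq {M : Type*} [AddCommGroup M] [Module ℝ M] {θ a b r s : M}
    (h : a + b + r = θ) : θ + (-1 : ℝ) • (a + s + r) = b + (-1 : ℝ) • s := by
  rw [← h]
  module

lemma eq_add_of_add_neg_one_smul_eq {M : Type*} [AddCommGroup M] [Module ℝ M] {θ a r z e : M}
    (h : θ + (-1 : ℝ) • (a + r) = z + e) : θ = r + z + (a + e) := by
  have h1 : θ = (θ + (-1 : ℝ) • (a + r)) + (a + r) := by module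
  rw [h1, h]
  module

/-- The inductive form of `exists_eq_resTot_add_dTot`, for cochains of Čech degree less than `b`:
subtracting `d_Tot K θ` and the average of `θ` removes the part of the highest Čech degree. -/
lemma exists_eq_resTot_add_dTot_aux (hρ : ρ.IsSubordinate fun a => (𝒰 a : Set X)) (b : ℕ)
    {p : ℤ} {θ : Tot E 𝒰} (hθ : θ ∈ totDeg E 𝒰 p)
    (hb : ∀ i, b ≤ i → θ i = 0) {η : Forms E (⊤ : TopologicalSpace.Opens X)}
    (hη : dTot θ = resTot η) :
    ∃ ζ ∈ formsDeg E ⊤ p, ∃ ξ ∈ totDeg E 𝒰 (p - 1), θ = resTot ζ + dTot ξ := by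
  induction b generalizing θ η with
  | zero =>
    refine ⟨0, Submodule.zero_mem _, 0, Submodule.zero_mem _, ?_⟩
    rw [map_zero, map_zero, add_zero]
    exact funext fun i => hb i (Nat.zero_le i)
  | succ b ih =>
    have hKmem := cechHomotopy_mem hρ hθ
    have hεmem := cechAverage_mem hρ hθ
    have h := δ_cechHomotopy hρ θ
    have hKi (i : ℕ) (hi : θ (i + 1) = 0) : cechHomotopy ρ hρ θ i = 0 := by
      funext α k
      refine Subtype.ext (funext fun x => ?_)
      change (cechHomotopy ρ hρ θ).val k x i α = 0
      rw [val_cechHomotopy]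
      refine Finset.sum_eq_zero fun c _ => ?_
      rw [Tot.val, hi]
      exact smul_zero _
    generalize cechHomotopy ρ hρ θ = K at hKmem h hKi
    generalize cechAverage ρ hρ θ = ε at hεmem h
    have hKd : dTot K ∈ totDeg E 𝒰 p := by
      have := dTot_mem_totDeg hKmem
      rwa [sub_add_cancel] at this
    have hε : (resTot ε : Tot E 𝒰) ∈ totDeg E 𝒰 p := resTot_mem_totDeg hεmem
    have hmem : θ + (-1 : ℝ) • (dTot K + resTot ε) ∈ totDeg E 𝒰 p :=
      Submodule.add_mem _ hθ (Submodule.smul_mem _ _ (Submodule.add_mem _ hKd hε))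
    have hD : dTot (θ + (-1 : ℝ) • (dTot K + resTot ε)) = resTot (η + (-1 : ℝ) • d ⊤ ε) := by
      rw [map_add, map_smul, map_add, dTot_dTot, dTot_resTot, hη, zero_add, map_add, map_smul]
    have heq : θ + (-1 : ℝ) • (dTot K + resTot ε) =
        cechHomotopy ρ hρ (δ θ) + (-1 : ℝ) • Tot.sgn 1 (Tot.map d K) := by
      rw [dTot_apply]
      exact add_neg_one_smul_eq (M := Tot E 𝒰) h
    have hzero : ∀ i, b ≤ i → (θ + (-1 : ℝ) • (dTot K + resTot ε) : Tot E 𝒰) i = 0 := by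
      intro i hi
      have h1 : cechHomotopy ρ hρ (δ θ) i = 0 := by
        funext α k
        refine Subtype.ext (funext fun x => ?_)
        change (cechHomotopy ρ hρ (δ θ)).val k x i α = 0
        rw [val_cechHomotopy]
        refine Finset.sum_eq_zero fun c _ => ?_
        -- `d_Tot θ` lives in Čech degree zero, and so does not see `δ θ` in higher Čech degree
        have h2 : (δ θ) (i + 1) = 0 := by
          have h3 := congrFun hη (i + 1)
          rw [dTot_apply] at h3
          have h4 : (Tot.sgn 1 (Tot.map d θ)) (i + 1) = 0 := by
            funext α
            rw [Tot.sgn_apply, Tot.map_apply, hb (i + 1) (by omega)]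
            exact (congrArg _ (map_zero (d _))).trans (smul_zero _)
          have h5 : (δ θ) (i + 1) + (Tot.sgn 1 (Tot.map d θ)) (i + 1) = 0 := h3
          rwa [h4, add_zero] at h5
        rw [Tot.val, h2]
        exact smul_zero _
      have h6 : K i = 0 := hKi i (hb (i + 1) (by omega))
      have h7 : (Tot.sgn 1 (Tot.map d K)) i = 0 := by
        funext α
        rw [Tot.sgn_apply, Tot.map_apply, h6]
        exact (congrArg _ (map_zero (d _))).trans (smul_zero _)
      rw [heq]
      rw [Pi.add_apply, Pi.smul_apply, h1, h7, smul_zero, add_zero]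
    obtain ⟨ζ, hζ, ξ, hξ, h⟩ := ih hmem hzero hD
    refine ⟨ε + ζ, Submodule.add_mem _ hεmem hζ, K + ξ,
      Submodule.add_mem _ hKmem hξ, ?_⟩
    rw [map_add, map_add]
    exact eq_add_of_add_neg_one_smul_eq (M := Tot E 𝒰) h

end CechResolution

section

variable {E : Type*} [NormedAddCommGroup E] [NormedSpace ℝ E] [FiniteDimensional ℝ E]
  {X : Type*} [TopologicalSpace X] [T2Space X] [SigmaCompactSpace X] [ChartedSpace E X]
  [IsManifold 𝓘(ℝ, E) ∞ X] {κ : Type*} {𝒰 : κ → TopologicalSpace.Opens X}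

/-- The restriction `Ω^•(X) → Tot(𝒰, Ω)` is a quasi-isomorphism: a total cochain whose
differential is the restriction of a global form is itself the restriction of a global form, up
to an exact cochain. -/
lemma exists_eq_resTot_add_dTot (h𝒰 : ∀ x, ∃ a, x ∈ 𝒰 a) {p : ℤ} {θ : Tot E 𝒰}
    (hθ : θ ∈ totDeg E 𝒰 p) {η : Forms E (⊤ : TopologicalSpace.Opens X)}
    (hη : dTot θ = resTot η) :
    ∃ ζ ∈ formsDeg E ⊤ p, ∃ ξ ∈ totDeg E 𝒰 (p - 1), θ = resTot ζ + dTot ξ := by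
  obtain ⟨ρ, hρ⟩ := SmoothPartitionOfUnity.exists_isSubordinate 𝓘(ℝ, E) isClosed_univ
    (fun a => (𝒰 a : Set X)) (fun a => (𝒰 a).2) fun x _ => Set.mem_iUnion.2 (h𝒰 x)
  refine exists_eq_resTot_add_dTot_aux hρ (p + 1).toNat hθ (fun i hi => ?_) hη
  funext α k
  exact hθ i α k (by omega)

end

/-! ### Graded Cartan calculi and their dg Lie algebras -/

section GradedSkew

variable {V V' : Type*} [AddCommGroup V] [Module ℝ V] [AddCommGroup V'] [Module ℝ V']

/-- An alternating map that vanishes as soon as two of its arguments have nonzero degree is graded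
skew-symmetric: the Koszul signs are then trivial. -/
lemma isGradedSkew_of_alternating {𝒱 : ℤ → Submodule ℝ V} {𝒱' : ℤ → Submodule ℝ V'} {k : ℕ} {r : ℤ}
    (Φ : V [⋀^Fin k]→ₗ[ℝ] V')
    (hzero : ∀ (e : Fin k → ℤ) (x : Fin k → V), (∀ a, x a ∈ 𝒱 (e a)) →
      ∀ a b, a ≠ b → e a ≠ 0 → e b ≠ 0 → Φ x = 0)
    (hmem : ∀ (e : Fin k → ℤ) (x : Fin k → V), (∀ a, x a ∈ 𝒱 (e a)) → Φ x ∈ 𝒱' (∑ a, e a + r)) :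
    IsGradedSkew 𝒱 𝒱' k r Φ where
  mem := hmem
  map_add e x _ a y _ := by rw [Φ.map_update_add, Function.update_eq_self]
  map_smul e x _ a c := by rw [Φ.map_update_smul, Function.update_eq_self]
  skew e x hx σ := by
    rw [Φ.map_perm]
    by_cases h : ∀ a b, a ≠ b → e a = 0 ∨ e b = 0
    · rw [χ_eq_sign σ h]
    · push Not at h
      obtain ⟨a, b, hab, ha, hb⟩ := h
      rw [hzero e x hx a b hab ha hb, smul_zero, smul_zero]

end GradedSkew

/-- A Cartan calculus with a bracket that is a Lie bracket, and a grading of the forms for which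
`D` has degree `1` and `I v` has degree `-1`. -/
structure GradedCalculus (V M : Type*) [AddCommGroup V] [Module ℝ V] [AddCommGroup M]
    [Module ℝ M] extends CartanCalculus V M where
  /-- the forms of a given degree -/
  deg : ℤ → Submodule ℝ M
  D_mem : ∀ {p η}, η ∈ deg p → D η ∈ deg (p + 1)
  I_mem : ∀ {p η} v, η ∈ deg p → I v η ∈ deg (p - 1)
  br_add : ∀ u v w, br u (v + w) = br u v + br u w
  br_smul : ∀ (c : ℝ) u v, br u (c • v) = c • br u v
  br_swap : ∀ u v, br u v = - br v u
  br_leibniz : ∀ u v w, br u (br v w) = br (br u v) w + br v (br u w)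

namespace GradedCalculus

variable {V M : Type*} [AddCommGroup V] [Module ℝ V] [AddCommGroup M] [Module ℝ M]
  (C : GradedCalculus V M)

lemma br_zero (u : V) : C.br u 0 = 0 := by
  have := C.br_smul 0 u 0
  rwa [zero_smul, zero_smul] at this

lemma zero_br (u : V) : C.br 0 u = 0 := by rw [C.br_swap, br_zero, neg_zero]

lemma L_mem {p : ℤ} {η : M} (v : V) (h : η ∈ C.deg p) : C.L v η ∈ C.deg p := by
  have h1 := C.D_mem (C.I_mem v h)
  have h2 := C.I_mem v (C.D_mem h)
  rw [sub_add_cancel] at h1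
  rw [add_sub_cancel_right] at h2
  exact Submodule.add_mem _ h1 h2

lemma IM_mem {p : ℤ} {η : M} {m : ℕ} (v : Fin m → V) (h : η ∈ C.deg p) :
    C.IM m v η ∈ C.deg (p - m) := by
  induction m generalizing η p with
  | zero =>
    rw [CartanCalculus.IM_zero, Nat.cast_zero, sub_zero]
    exact h
  | succ m ih =>
    have := ih (Fin.tail v) (C.I_mem (v 0) h)
    rw [sub_sub, add_comm 1 (m : ℤ)] at this
    exact_mod_cast this

/-- The graded vector space with the pairs `(v, θ)` such that `Λ v = D θ` in degree zero, and
forms in positive degrees. -/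
def hamDeg (n : ℤ) (Λ : V →ₗ[ℝ] M) (i : ℤ) : Submodule ℝ (V × M) where
  carrier := {x | x.2 ∈ C.deg (n - 1 - i) ∧ (i = 0 → Λ x.1 = C.D x.2) ∧ (i ≠ 0 → x.1 = 0) ∧
    (i < 0 → x.2 = 0)}
  zero_mem' := ⟨Submodule.zero_mem _, by simp, by simp, by simp⟩
  add_mem' := by
    rintro x y ⟨h1, h2, h3, h4⟩ ⟨k1, k2, k3, k4⟩
    refine ⟨Submodule.add_mem _ h1 k1, fun h => ?_, fun h => ?_, fun h => ?_⟩
    · simp [h2 h, k2 h]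
    · simp [h3 h, k3 h]
    · simp [h4 h, k4 h]
  smul_mem' := by
    rintro r x ⟨h1, h2, h3, h4⟩
    refine ⟨Submodule.smul_mem _ r h1, fun h => ?_, fun h => ?_, fun h => ?_⟩
    · simp [h2 h]
    · simp [h3 h]
    · simp [h4 h]

variable {C} {n : ℤ} {Λ : V →ₗ[ℝ] M}

lemma mem_hamDeg {i : ℤ} {x : V × M} : x ∈ C.hamDeg n Λ i ↔
    x.2 ∈ C.deg (n - 1 - i) ∧ (i = 0 → Λ x.1 = C.D x.2) ∧ (i ≠ 0 → x.1 = 0) ∧ (i < 0 → x.2 = 0) :=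
  Iff.rfl

lemma fst_eq_zero {i : ℤ} {x : V × M} (hx : x ∈ C.hamDeg n Λ i) (hi : i ≠ 0) : x.1 = 0 :=
  hx.2.2.1 hi

lemma eq_zero_of_neg {i : ℤ} {x : V × M} (hx : x ∈ C.hamDeg n Λ i) (hi : i < 0) : x = 0 :=
  Prod.ext (hx.2.2.1 hi.ne) (hx.2.2.2 hi)

variable (C Λ) in
/-- The differential `(v, θ) ↦ D θ - Λ v`, which vanishes in degree zero. -/
def hamDiff (x : V × M) : V × M := (0, C.D x.2 - Λ x.1)

variable (C) in
/-- The bracket `⟦(v, θ), (w, ξ)⟧ = ([v, w], 𝓛_v ξ - 𝓛_w θ)`. -/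
def hamBracket (x y : V × M) : V × M := (C.br x.1 y.1, C.L x.1 y.2 - C.L y.1 x.2)

lemma hamDiff_eq_zero {x : V × M} (hx : x ∈ C.hamDeg n Λ 0) : C.hamDiff Λ x = 0 :=
  Prod.ext rfl (by simp [hamDiff, hx.2.1 rfl])

lemma hamDiff_of_ne {i : ℤ} {x : V × M} (hx : x ∈ C.hamDeg n Λ i) (hi : i ≠ 0) :
    C.hamDiff Λ x = (0, C.D x.2) := by
  rw [hamDiff, fst_eq_zero hx hi, map_zero, sub_zero]

lemma hamBracket_eq_zero {x y : V × M} (hx : x.1 = 0) (hy : y.1 = 0) : C.hamBracket x y = 0 := by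
  rw [hamBracket, hx, hy, C.zero_br, C.L_zero]
  simp

lemma D_D_apply (η : M) : C.D (C.D η) = 0 := congrArg (fun T => T η) C.D_D

lemma D_L_apply (v : V) (η : M) : C.D (C.L v η) = C.L v (C.D η) :=
  congrArg (fun T => T η) (C.D_L v)

lemma L_L_apply (v w : V) (η : M) :
    C.L v (C.L w η) = C.L w (C.L v η) + C.L (C.br v w) η :=
  congrArg (fun T => T η) (C.L_L v w)

lemma hamDiff_mem {i : ℤ} {x : V × M} (hx : x ∈ C.hamDeg n Λ i) :
    C.hamDiff Λ x ∈ C.hamDeg n Λ (i - 1) := by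
  by_cases hi : i = 0
  · subst hi
    rw [hamDiff_eq_zero hx]
    exact Submodule.zero_mem _
  · rw [hamDiff_of_ne hx hi]
    refine ⟨?_, fun _ => ?_, fun _ => rfl, fun h => ?_⟩
    · have := C.D_mem hx.1
      rwa [show n - 1 - i + 1 = n - 1 - (i - 1) by ring] at this
    · rw [map_zero]
      exact (D_D_apply x.2).symm
    · change C.D x.2 = 0
      rw [hx.2.2.2 (by omega), map_zero]

lemma hamDiff_hamDiff {i : ℤ} {x : V × M} (hx : x ∈ C.hamDeg n Λ i) :
    C.hamDiff Λ (C.hamDiff Λ x) = 0 := by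
  by_cases hi : i = 0
  · subst hi
    rw [hamDiff_eq_zero hx]
    simp [hamDiff]
  · rw [hamDiff_of_ne hx hi]
    simp [hamDiff, D_D_apply]

/-- The graded vector space `hamDeg` is a dg Lie algebra if `Λ` intertwines the bracket with the
Lie derivatives as `v ↦ 𝓛_v A` does. -/
theorem isDGLie_hamDeg (hΛ : ∀ v w, Λ (C.br v w) = C.L v (Λ w) - C.L w (Λ v)) :
    IsDGLie (C.hamDeg n Λ) (C.hamDiff Λ) C.hamBracket where
  diff_mem i x hx := hamDiff_mem hx
  diff_add i x _ y _ := by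
    refine Prod.ext (add_zero _).symm ?_
    simp only [hamDiff, Prod.fst_add, Prod.snd_add, map_add]
    abel
  diff_smul i x _ c := by
    refine Prod.ext (smul_zero _).symm ?_
    simp only [hamDiff, Prod.smul_fst, Prod.smul_snd, map_smul, smul_sub]
  diff_diff i x hx := hamDiff_hamDiff hx
  br_mem i j x hx y hy := by
    by_cases hi : i = 0
    · by_cases hj : j = 0
      · subst hi hj
        refine ⟨?_, fun _ => ?_, fun h => absurd rfl h, fun h => absurd h (by simp)⟩
        · exact Submodule.sub_mem _ (C.L_mem _ hy.1) (C.L_mem _ hx.1)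
        · rw [hamBracket, hΛ, hx.2.1 rfl, hy.2.1 rfl, map_sub, D_L_apply, D_L_apply]
      · subst hi
        rw [hamBracket, fst_eq_zero hy hj, C.br_zero, C.L_zero, LinearMap.zero_apply, sub_zero,
          zero_add]
        refine ⟨C.L_mem _ hy.1, fun h => absurd h hj, fun _ => rfl, fun h => ?_⟩
        change C.L x.1 y.2 = 0
        rw [hy.2.2.2 h, map_zero]
    · by_cases hj : j = 0
      · subst hj
        rw [hamBracket, fst_eq_zero hx hi, C.zero_br, C.L_zero, LinearMap.zero_apply, zero_sub,
          add_zero]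
        refine ⟨Submodule.neg_mem _ (C.L_mem _ hx.1), fun h => absurd h hi, fun _ => rfl,
          fun h => ?_⟩
        change - C.L y.1 x.2 = 0
        rw [hx.2.2.2 h, map_zero, neg_zero]
      · rw [hamBracket_eq_zero (fst_eq_zero hx hi) (fst_eq_zero hy hj)]
        exact Submodule.zero_mem _
  br_add i j x _ y hy z hz := by
    have h : C.L (y.1 + z.1) x.2 = C.L y.1 x.2 + C.L z.1 x.2 := by
      simp [CartanCalculus.L, mul_add, add_mul]
      abel
    refine Prod.ext (C.br_add _ _ _) ?_
    simp only [hamBracket, Prod.fst_add, Prod.snd_add, map_add, h]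
    abel
  br_smul i j x _ y hy c := by
    have h : C.L (c • y.1) x.2 = c • C.L y.1 x.2 := by
      simp [CartanCalculus.L]
    refine Prod.ext (C.br_smul _ _ _) ?_
    simp only [hamBracket, Prod.smul_fst, Prod.smul_snd, map_smul, h, smul_sub]
  br_skew i j x hx y hy := by
    by_cases hij : i * j = 0
    · rw [hij, Int.negOnePow_zero, one_smul]
      exact Prod.ext (C.br_swap _ _) (neg_sub _ _).symm
    · rw [hamBracket_eq_zero (fst_eq_zero hx (left_ne_zero_of_mul hij))
          (fst_eq_zero hy (right_ne_zero_of_mul hij)),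
        hamBracket_eq_zero (fst_eq_zero hy (right_ne_zero_of_mul hij))
          (fst_eq_zero hx (left_ne_zero_of_mul hij)), smul_zero, neg_zero]
  jacobi i j k x hx y hy z hz := by
    by_cases hij : i * j = 0
    · rw [hij, Int.negOnePow_zero, one_smul]
      refine Prod.ext (C.br_leibniz _ _ _) ?_
      simp only [hamBracket, Prod.snd_add, map_sub]
      rw [L_L_apply x.1 y.1 z.2, L_L_apply x.1 z.1 y.2, L_L_apply y.1 z.1 x.2]
      abel
    · have hx1 := fst_eq_zero hx (left_ne_zero_of_mul hij)
      have hy1 := fst_eq_zero hy (right_ne_zero_of_mul hij)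
      have h1 : (C.hamBracket y z).1 = 0 := by rw [hamBracket, hy1, C.zero_br]
      have h2 : (C.hamBracket x z).1 = 0 := by rw [hamBracket, hx1, C.zero_br]
      rw [hamBracket_eq_zero hx1 h1, hamBracket_eq_zero hy1 h2, hamBracket_eq_zero hx1 hy1,
        smul_zero, add_zero]
      simp [hamBracket, C.zero_br, C.L_zero]
      rfl
  leibniz i j x hx y hy := by
    have h0 : C.hamBracket 0 y = 0 := by simp [hamBracket, C.zero_br, C.L_zero]
    have h0' : C.hamBracket x 0 = 0 := by simp [hamBracket, C.br_zero, C.L_zero]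
    by_cases hi : i = 0
    · subst hi
      rw [hamDiff_eq_zero hx, h0, zero_add, Int.negOnePow_zero, one_smul]
      by_cases hj : j = 0
      · subst hj
        rw [hamDiff_eq_zero hy, h0', hamDiff, hamBracket, hΛ, hx.2.1 rfl, hy.2.1 rfl, map_sub,
          D_L_apply, D_L_apply, sub_self]
        rfl
      · rw [hamDiff_of_ne hy hj]
        simp [hamDiff, hamBracket, fst_eq_zero hy hj, C.br_zero, C.L_zero, D_L_apply]
    · have hx1 := fst_eq_zero hx hi
      rw [hamDiff_of_ne hx hi]
      by_cases hj : j = 0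
      · subst hj
        rw [hamDiff_eq_zero hy, h0', smul_zero, add_zero]
        simp [hamDiff, hamBracket, hx1, C.zero_br, C.L_zero, D_L_apply]
      · have hy1 := fst_eq_zero hy hj
        rw [hamBracket_eq_zero hx1 hy1, hamDiff_of_ne hy hj, hamBracket_eq_zero rfl hy1,
          hamBracket_eq_zero hx1 rfl, smul_zero, add_zero]
        simp [hamDiff]

/-- The operator `v ↦ D I_v A + I_v W`, which plays the role of `v ↦ 𝓛_v A`, is compatible with
brackets if `W` is closed and agrees with `D A` after two contractions. -/
lemma lie_of_contract_eq {A W : M} (hW : C.D W = 0)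
    (hA : ∀ v w, C.I w (C.I v (C.D A)) = C.I w (C.I v W))
    (hΛ : ∀ v, Λ v = C.D (C.I v A) + C.I v W) (v w : V) :
    Λ (C.br v w) = C.L v (Λ w) - C.L w (Λ v) := by
  -- `Λ v = 𝓛_v A - I_v B` for the form `B = D A - W`, whose double contractions vanish
  set B := C.D A - W with hB
  have hI (v w : V) : C.I w (C.I v B) = 0 := by
    rw [hB, map_sub, map_sub, hA, sub_self]
  have hDB : C.D B = 0 := by rw [hB, map_sub, D_D_apply, hW, sub_self]
  have hΛ' (v : V) : Λ v = C.L v A - C.I v B := by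
    rw [hΛ, hB, map_sub, CartanCalculus.L, LinearMap.add_apply, Module.End.mul_apply,
      Module.End.mul_apply]
    abel
  have hLI (v w : V) : C.L v (C.I w B) = C.I v (C.D (C.I w B)) := by
    rw [CartanCalculus.L, LinearMap.add_apply, Module.End.mul_apply, hI, map_zero, zero_add,
      Module.End.mul_apply]
  have hIL (v w : V) : C.L w (C.I v B) = C.I v (C.D (C.I w B)) + C.I (C.br w v) B := by
    have h := congrArg (fun T => T B) (C.L_I w v)
    simp only [Module.End.mul_apply, LinearMap.add_apply] at h
    rw [h, CartanCalculus.L, LinearMap.add_apply, Module.End.mul_apply, Module.End.mul_apply, hDB,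
      map_zero, add_zero]
  have hsw : C.I (C.br w v) B = - C.I (C.br v w) B := by
    rw [C.br_swap w v, map_neg, LinearMap.neg_apply]
  rw [hΛ', hΛ', hΛ', map_sub (C.L v), map_sub (C.L w), L_L_apply v w A, hLI v w, hIL v w, hsw]
  abel

end GradedCalculus

/-! ### The brackets of Hamiltonian pairs -/

/-- A map on tuples of pairs `(v, θ)` is degenerate on forms if it vanishes when two of the vector
components vanish, and its value has no vector component when one of them vanishes. -/
structure VanishesOnForms {V M N : Type*} [Zero V] [Zero N] {k : ℕ}
    (φ : (Fin k → V × M) → V × N) : Prop where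
  two : ∀ x i j, i ≠ j → (x i).1 = 0 → (x j).1 = 0 → φ x = 0
  one : ∀ x i, (x i).1 = 0 → (φ x).1 = 0

section Nested

variable {V M N : Type*} [AddCommGroup V] [Module ℝ V] [AddCommGroup M] [Module ℝ M]
  [AddCommGroup N] [Module ℝ N]

/-- Nested operations vanish when two of the vector components vanish. -/
lemma nested_eq_zero {k m : ℕ} (hk : k ≤ m) {φ : (Fin k → V × M) → V × M}
    {ψ : (V × M) [⋀^Fin (m - k + 1)]→ₗ[ℝ] (V × N)} (hφ : VanishesOnForms φ)
    (hψ : VanishesOnForms ψ) {y : Fin m → V × M} {i j : Fin m} (hij : i ≠ j)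
    (hi : (y i).1 = 0) (hj : (y j).1 = 0) :
    ψ (Fin.cons (φ (firstArgs hk y)) (lastArgs k y)) = 0 := by
  have hlast (i : Fin m) (h : k ≤ (i : ℕ)) (hi : (y i).1 = 0) :
      ((Fin.cons (φ (firstArgs hk y)) (lastArgs k y) : Fin (m - k + 1) → V × M)
        (Fin.succ ⟨i - k, by omega⟩)).1 = 0 := by
    rw [Fin.cons_succ, lastArgs, ← hi]
    congr 2
    exact Fin.ext (by simp; omega)
  have mixed (i j : Fin m) (hik : (i : ℕ) < k) (hjk : k ≤ (j : ℕ)) (hi : (y i).1 = 0)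
      (hj : (y j).1 = 0) : ψ (Fin.cons (φ (firstArgs hk y)) (lastArgs k y)) = 0 := by
    refine hψ.two _ 0 _ (Fin.succ_ne_zero _).symm ?_ (hlast j hjk hj)
    rw [Fin.cons_zero]
    exact hφ.one _ ⟨i, hik⟩ hi
  rcases lt_or_ge (i : ℕ) k with hik | hik <;> rcases lt_or_ge (j : ℕ) k with hjk | hjk
  · refine ψ.map_coord_zero 0 ?_
    rw [Fin.cons_zero]
    exact hφ.two _ ⟨i, hik⟩ ⟨j, hjk⟩ (fun h => hij (Fin.ext (Fin.ext_iff.1 h :))) hi hj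
  · exact mixed i j hik hjk hi hj
  · exact mixed j i hjk hik hj hi
  · refine hψ.two _ _ _ (fun h => hij (Fin.ext ?_)) (hlast i hik hi) (hlast j hjk hj)
    have := Fin.ext_iff.1 h
    simp at this
    omega

end Nested

namespace GradedCalculus

variable {V M : Type*} [AddCommGroup V] [Module ℝ V] [AddCommGroup M] [Module ℝ M]
  (C : GradedCalculus V M)

/-- The bracket of vector fields as an alternating map. -/
def brAlt : V [⋀^Fin 2]→ₗ[ℝ] V :=
  { toFun := fun v => C.br (v 0) (v 1)
    map_update_add' := fun {inst} v i a b => by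
      rw [Subsingleton.elim inst (instDecidableEqFin 2)]
      have h (u v w : V) : C.br (u + v) w = C.br u w + C.br v w := by
        rw [C.br_swap, C.br_add, C.br_swap w u, C.br_swap w v]
        abel
      fin_cases i
      · simp [h]
      · simp [C.br_add]
    map_update_smul' := fun {inst} v i c a => by
      rw [Subsingleton.elim inst (instDecidableEqFin 2)]
      have h (u w : V) : C.br (c • u) w = c • C.br u w := by
        rw [C.br_swap, C.br_smul, C.br_swap w u, smul_neg, neg_neg]
      fin_cases i
      · simp [h]
      · simp [C.br_smul]
    map_eq_zero_of_eq' := fun v i j h hij => by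
      have h1 : v 0 = v 1 := by
        fin_cases i <;> fin_cases j <;> first | exact h | exact h.symm | exact absurd rfl hij
      have h2 := C.br_swap (v 0) (v 0)
      change C.br (v 0) (v 1) = 0
      rw [← h1]
      have h3 : (2 : ℝ) • C.br (v 0) (v 0) = 0 := by
        rw [two_smul]
        exact add_eq_zero_iff_eq_neg.2 h2
      exact (smul_eq_zero.1 h3).resolve_left two_ne_zero }

/-- The vector component of the `k`-th bracket. -/
def brPart : (k : ℕ) → V [⋀^Fin k]→ₗ[ℝ] V
  | 2 => C.brAlt
  | _ => 0

lemma brPart_two (v : Fin 2 → V) : C.brPart 2 v = C.br (v 0) (v 1) := rfl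

lemma brPart_of_ne {k : ℕ} (hk : k ≠ 2) : C.brPart k = 0 := by
  match k, hk with
  | 0, _ => rfl
  | 1, _ => rfl
  | k + 3, _ => rfl

/-- The de Rham differential as the form component of the first bracket. -/
def diffPart : (k : ℕ) → (V × M) [⋀^Fin k]→ₗ[ℝ] M
  | 1 => AlternatingMap.ofSubsingleton ℝ (V × M) M (0 : Fin 1) (C.D ∘ₗ LinearMap.snd ℝ V M)
  | _ => 0

lemma diffPart_one (x : Fin 1 → V × M) : C.diffPart 1 x = C.D (x 0).2 := rfl

lemma diffPart_of_ne {k : ℕ} (hk : k ≠ 1) : C.diffPart k = 0 := by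
  match k, hk with
  | 0, _ => rfl
  | k + 2, _ => rfl

lemma diffPart_succ (p : ℕ) (x : Fin (p + 1) → V × M) :
    C.diffPart (p + 1) x = if p = 0 then C.D (x 0).2 else 0 := by
  cases p with
  | zero => rfl
  | succ p => rfl

/-- The brackets of the `L_∞`-algebra of local observables of a closed form `ϖ`, as alternating
maps. The first bracket is `(v, θ) ↦ D θ + I_v ϖ`, which is the differential on forms and vanishes
on Hamiltonian pairs; so no bracket depends on the degrees of its arguments. -/
def lBracket (ϖ : M) (k : ℕ) : (V × M) [⋀^Fin k]→ₗ[ℝ] (V × M) :=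
  ((C.brPart k).compLinearMap (LinearMap.fst ℝ V M)).prod
    (ς k • ((LinearMap.applyₗ ϖ).compAlternatingMap (C.IM k)).compLinearMap (LinearMap.fst ℝ V M) +
      C.diffPart k)

variable (ϖ : M)

lemma lBracket_fst {k : ℕ} (x : Fin k → V × M) :
    (C.lBracket ϖ k x).1 = C.brPart k (Prod.fst ∘ x) := rfl

lemma lBracket_snd {k : ℕ} (x : Fin k → V × M) :
    (C.lBracket ϖ k x).2 = ς k • C.IM k (Prod.fst ∘ x) ϖ + C.diffPart k x := rfl

lemma lBracket_eq_zero {k : ℕ} (hk : k ≠ 1) {x : Fin k → V × M} (i : Fin k) (h : (x i).1 = 0) :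
    C.lBracket ϖ k x = 0 := by
  refine Prod.ext ?_ ?_
  · exact (C.brPart k).map_coord_zero i h
  · rw [lBracket_snd, C.IM_eq_zero i h, C.diffPart_of_ne hk]
    simp

lemma vanishesOnForms_lBracket (k : ℕ) : VanishesOnForms (C.lBracket ϖ k) where
  two x i j hij hi _ := by
    refine C.lBracket_eq_zero ϖ ?_ i hi
    rintro rfl
    exact hij (Subsingleton.elim _ _)
  one x i hi := (C.brPart k).map_coord_zero i hi

lemma lBracket_one (x : Fin 1 → V × M) :
    C.lBracket ϖ 1 x = (0, C.D (x 0).2 + C.I (x 0).1 ϖ) := by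
  refine Prod.ext rfl ?_
  rw [lBracket_snd, diffPart_one, ς_one, one_smul, add_comm]
  rfl

lemma lBracket_one_eq_hamDiff (x : Fin 1 → V × M) {Λ : V →ₗ[ℝ] M}
    (hΛ : ∀ v, Λ v = - C.I v ϖ) : C.lBracket ϖ 1 x = C.hamDiff Λ (x 0) := by
  rw [lBracket_one, hamDiff, hΛ, sub_neg_eq_add]

variable {C ϖ} {n : ℤ} {Λ : V →ₗ[ℝ] M}

/-- Hamiltonian vector fields preserve `ϖ`. -/
lemma L_of_mem (hϖ : C.D ϖ = 0) (hΛ : ∀ v, Λ v = - C.I v ϖ) {i : ℤ} {x : V × M}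
    (hx : x ∈ C.hamDeg n Λ i) : C.L x.1 ϖ = 0 := by
  by_cases hi : i = 0
  · have h := hx.2.1 hi
    rw [hΛ] at h
    rw [CartanCalculus.L, LinearMap.add_apply, Module.End.mul_apply, Module.End.mul_apply, hϖ,
      map_zero, add_zero, ← neg_neg (C.I x.1 ϖ), h, map_neg, D_D_apply, neg_zero]
  · rw [fst_eq_zero hx hi, C.L_zero, LinearMap.zero_apply]

/-- The bracket of two Hamiltonian vector fields is Hamiltonian, with Hamiltonian form
`ι_{v_0 ∧ v_1} ϖ`. -/
lemma D_IM_two (hϖ : C.D ϖ = 0) (v : Fin 2 → V) (hL : ∀ i, C.L (v i) ϖ = 0) :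
    C.D (C.IM 2 v ϖ) = - C.I (C.br (v 0) (v 1)) ϖ := by
  have h := C.D_IM_eq_altSum ϖ v hϖ hL
  have h1 (a b : V) (z : Fin 0 → V) : C.IM 1 (Fin.cons (C.br a b) z) ϖ = C.I (C.br a b) ϖ := rfl
  have h2 : C.I (C.br (v 1) (v 0)) ϖ = - C.I (C.br (v 0) (v 1)) ϖ := by
    rw [C.br_swap, map_neg, LinearMap.neg_apply]
  simp only [h1] at h
  rw [h]
  simp [altSum, Fin.removeNth, h2]
  module

/-- The brackets preserve Hamiltonian pairs. The only nontrivial degree conditions are those of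
`l_1`, and of `l_2` in degree zero, where they say that the bracket of Hamiltonian vector fields is
Hamiltonian. -/
theorem isGradedSkew_lBracket (hϖ : C.D ϖ = 0) (hdeg : ϖ ∈ C.deg (n + 1))
    (hΛ : ∀ v, Λ v = - C.I v ϖ) {k : ℕ} (hk : 1 ≤ k) :
    IsGradedSkew (C.hamDeg n Λ) (C.hamDeg n Λ) k (k - 2) (C.lBracket ϖ k) := by
  refine isGradedSkew_of_alternating _ (fun e x hx a b hab ha hb =>
    (C.vanishesOnForms_lBracket ϖ k).two x a b hab (fst_eq_zero (hx a) ha)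
      (fst_eq_zero (hx b) hb)) fun e x hx => ?_
  by_cases hk1 : k = 1
  · subst hk1
    rw [C.lBracket_one_eq_hamDiff ϖ x hΛ, Fin.sum_univ_one]
    have := hamDiff_mem (hx 0)
    rwa [show e 0 - 1 = e 0 + (((1 : ℕ) : ℤ) - 2) by simp; ring] at this
  by_cases he : ∀ a, e a = 0
  · have hx0 (a) : x a ∈ C.hamDeg n Λ 0 := he a ▸ hx a
    rw [Finset.sum_eq_zero fun a _ => he a, zero_add]
    refine ⟨?_, fun h => ?_, fun h => ?_, fun h => absurd h (by omega)⟩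
    · rw [lBracket_snd, C.diffPart_of_ne hk1, AlternatingMap.zero_apply, add_zero]
      have := C.IM_mem (Prod.fst ∘ x) hdeg
      rw [show n + 1 - (k : ℤ) = n - 1 - (k - 2) by ring] at this
      exact Submodule.smul_mem _ _ this
    · obtain rfl : k = 2 := by omega
      rw [lBracket_snd, lBracket_fst, brPart_two, hΛ, C.diffPart_of_ne hk1, ς_two,
        AlternatingMap.zero_apply, add_zero, one_smul,
        D_IM_two hϖ (Prod.fst ∘ x) fun i => L_of_mem hϖ hΛ (hx i)]
    · rw [lBracket_fst, C.brPart_of_ne (by rintro rfl; simp at h)]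
      rfl
  · push Not at he
    obtain ⟨a, ha⟩ := he
    rw [C.lBracket_eq_zero ϖ hk1 a (fst_eq_zero (hx a) ha)]
    exact Submodule.zero_mem _

end GradedCalculus

/-! ### The higher Jacobi identities -/

namespace GradedCalculus

variable {V M : Type*} [AddCommGroup V] [Module ℝ V] [AddCommGroup M] [Module ℝ M]
  {C : GradedCalculus V M} {ϖ : M} {n : ℤ} {Λ : V →ₗ[ℝ] M}

/-- The Jacobi identity of the bracket of vector fields as an alternating sum. -/
lemma altSum_br_br (x : Fin 3 → V) :
    altSum (fun a y => altSum (fun b z => C.br (C.br a b) (z 0)) y) x = 0 := by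
  have h1 := C.br_leibniz (x 0) (x 1) (x 2)
  have h2 := C.br_swap (x 0) (C.br (x 1) (x 2))
  have h3 := C.br_swap (x 1) (C.br (x 0) (x 2))
  have h (a b c : V) : C.br (C.br b a) c = - C.br (C.br a b) c := by
    rw [C.br_swap, C.br_swap b a, C.br_swap (C.br a b), ← neg_one_smul ℝ (C.br a b), C.br_smul]
    module
  have e (a b c d : V) : altSum (fun b z => C.br (C.br a b) (z 0)) ![b, c] =
      C.br (C.br a b) c - C.br (C.br a c) b := by
    simp [altSum, Fin.sum_univ_two, Fin.removeNth]
    module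
  have r0 : Fin.removeNth 0 x = ![x 1, x 2] := by ext i; fin_cases i <;> rfl
  have r1 : Fin.removeNth 1 x = ![x 0, x 2] := by ext i; fin_cases i <;> rfl
  have r2 : Fin.removeNth 2 x = ![x 0, x 1] := by ext i; fin_cases i <;> rfl
  rw [altSum, Fin.sum_univ_three, r0, r1, r2, e _ _ _ (x 0), e _ _ _ (x 0), e _ _ _ (x 0),
    h (x 0) (x 1), h (x 0) (x 2), h (x 1) (x 2)]
  rw [h2, h3] at h1
  simp
  linear_combination (norm := module) (-2 : ℝ) • h1

lemma lastArgs_two {α : Type*} {m : ℕ} (y : Fin (m + 2) → α) :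
    lastArgs 2 y = Fin.tail (Fin.tail y) := by
  funext b
  rw [lastArgs, Fin.tail, Fin.tail]
  congr 1
  exact Fin.ext (by simp; omega)

lemma mem_Sh_self {m : ℕ} {σ : Equiv.Perm (Fin m)} : σ ∈ Sh m m ↔ σ = 1 := by
  rw [mem_Sh]
  constructor
  · rintro ⟨h, -⟩
    exact perm_eq_of_strictMonoOn (S := Set.univ) (fun a _ b _ hab => h a.2 b.2 hab)
      (fun a _ b _ hab => hab) (by simp)
  · rintro rfl
    exact ⟨fun a _ b _ hab => hab, fun a _ b _ hab => hab⟩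

lemma tail_tail_comp_swap {α : Type*} {m : ℕ} (y : Fin (m + 2) → α) :
    Fin.tail (Fin.tail (y ∘ Equiv.swap 0 1)) = Fin.tail (Fin.tail y) := by
  funext b
  simp only [Fin.tail, Function.comp]
  rw [Equiv.swap_apply_of_ne_of_ne (Fin.succ_ne_zero _)]
  exact fun h => Fin.succ_ne_zero b (Fin.succ_injective _ h)

/-- Only the bracket of two entries has a vector component: the signed sum over unshuffles of a
nested expression that involves only this component reduces to the sum over pairs. -/
lemma sum_Sh_lBracket {N : Type*} [AddCommGroup N] [Module ℝ N]
    (φ : ∀ k, (V × M) [⋀^Fin k]→ₗ[ℝ] N) {m : ℕ} (x : Fin (m + 2) → V × M) :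
    ∑ i : Fin (m + 2), ∑ σ ∈ Sh (i + 1) (m + 2),
      (Equiv.Perm.sign σ * (-1) ^ ((i + 1) * (m + 2 - (i + 1)))) •
      φ (m + 2 - (i + 1) + 1) (Fin.cons ((C.lBracket ϖ (i + 1) (firstArgs i.isLt (x ∘ σ))).1, 0)
          (lastArgs (i + 1) (x ∘ σ))) =
      (2⁻¹ : ℝ) • altSum (fun a y => altSum (fun b z =>
        φ (m + 1) (Fin.cons (C.br a.1 b.1, 0) z)) y) x := by
  rw [Finset.sum_eq_single (1 : Fin (m + 2))]
  · have h1 : ∀ σ ∈ Sh 2 (m + 2), ((Equiv.Perm.sign σ * (-1) ^ (2 * (m + 2 - 2))) •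
        φ (m + 1) (Fin.cons ((C.lBracket ϖ 2 (firstArgs (by omega) (x ∘ σ))).1, 0)
        (lastArgs 2 (x ∘ σ)))) = Equiv.Perm.sign σ •
        (fun y : Fin (m + 2) → V × M => φ (m + 1) (Fin.cons (C.br (y 0).1 (y 1).1, 0)
          (Fin.tail (Fin.tail y)))) (x ∘ σ) := by
      intro σ _
      rw [pow_mul, neg_one_sq, one_pow, mul_one, lastArgs_two]
      rfl
    refine (Finset.sum_congr rfl h1).trans (sum_sign_Sh_two (fun y : Fin (m + 2) → V × M =>
      φ (m + 1) (Fin.cons (C.br (y 0).1 (y 1).1, 0) (Fin.tail (Fin.tail y)))) (fun y => ?_) _)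
    rw [tail_tail_comp_swap]
    have h2 : ((C.br (y 1).1 (y 0).1, 0) : V × M) = (-1 : ℝ) • (C.br (y 0).1 (y 1).1, 0) := by
      rw [neg_one_smul, C.br_swap]
      simp
    simp only [Function.comp, Equiv.swap_apply_left, Equiv.swap_apply_right, h2]
    exact ((φ (m + 1)).toMultilinearMap.cons_smul _ _ _).trans (neg_one_smul _ _)
  · intro i _ hi
    refine Finset.sum_eq_zero fun σ _ => ?_
    rw [(φ _).map_coord_zero 0, smul_zero]
    rw [Fin.cons_zero, lBracket_fst, C.brPart_of_ne (fun h => hi (Fin.ext (by simp; omega)))]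
    rfl
  · simp

lemma fst_comp_cons {p : ℕ} (a : V × M) (z : Fin p → V × M) :
    Prod.fst ∘ (Fin.cons (a.1, (0 : M)) z : Fin (p + 1) → V × M) =
      Prod.fst ∘ (Fin.cons a z : Fin (p + 1) → V × M) := by
  funext i
  refine Fin.cases rfl (fun i => rfl) i

/-- The case of `sum_Sh_lBracket` in which the other entries enter by their vector components
only. -/
lemma sum_Sh_lBracket_fst {N : Type*} [AddCommGroup N] [Module ℝ N] (φ : ∀ k, V [⋀^Fin k]→ₗ[ℝ] N)
    {m : ℕ} (x : Fin (m + 2) → V × M) :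
    ∑ i : Fin (m + 2), ∑ σ ∈ Sh (i + 1) (m + 2),
      (Equiv.Perm.sign σ * (-1) ^ ((i + 1) * (m + 2 - (i + 1)))) •
      φ (m + 2 - (i + 1) + 1) (Prod.fst ∘
        (Fin.cons (C.lBracket ϖ (i + 1) (firstArgs i.isLt (x ∘ σ)))
          (lastArgs (i + 1) (x ∘ σ)) : Fin (m + 2 - (i + 1) + 1) → V × M)) =
      (2⁻¹ : ℝ) • altSum (fun a y => altSum (fun b z =>
        φ (m + 1) (Fin.cons (C.br a b) z)) y) (Prod.fst ∘ x) := by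
  have h := sum_Sh_lBracket (C := C) (ϖ := ϖ)
    (fun k => (φ k).compLinearMap (LinearMap.fst ℝ V M)) x
  have h1 {p : ℕ} (y : Fin p → V × M) : (φ p).compLinearMap (LinearMap.fst ℝ V M) y =
    φ p (Prod.fst ∘ y) := rfl
  simp only [h1, fst_comp_cons] at h
  rw [h]
  congr 1
  refine Finset.sum_congr rfl fun i _ => congrArg _ (Finset.sum_congr rfl fun j _ => congrArg _
    (congrArg _ (funext fun a => ?_)))
  exact Fin.cases rfl (fun i => rfl) a

/-- The generalized Jacobi identity with signs instead of Koszul signs. -/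
lemma jacobi_sign {m : ℕ} (x : Fin (m + 2) → V × M) (hϖ : C.D ϖ = 0)
    (hL : ∀ a, C.L (x a).1 ϖ = 0) :
    ∑ i : Fin (m + 2), ∑ σ ∈ Sh (i + 1) (m + 2),
      (Equiv.Perm.sign σ * (-1) ^ ((i + 1) * (m + 2 - (i + 1)))) •
      C.lBracket ϖ (m + 2 - (i + 1) + 1)
        (Fin.cons (C.lBracket ϖ (i + 1) (firstArgs i.isLt (x ∘ σ)))
          (lastArgs (i + 1) (x ∘ σ))) = 0 := by
  refine Prod.ext ?_ ?_
  · simp only [Prod.fst_sum, Prod.smul_fst, lBracket_fst]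
    refine (sum_Sh_lBracket_fst C.brPart x).trans ?_
    by_cases hm : m = 1
    · subst hm
      exact (congrArg _ (altSum_br_br _)).trans (smul_zero _)
    · rw [C.brPart_of_ne (by omega)]
      simp [altSum]
  · simp only [Prod.snd_sum, Prod.smul_snd, lBracket_snd, smul_add, Finset.sum_add_distrib]
    -- the bracket of vector fields contracted into `ϖ` cancels the differential of the last bracket
    have h1 := sum_Sh_lBracket_fst (C := C) (ϖ := ϖ)
      (fun k => ς k • (LinearMap.applyₗ ϖ).compAlternatingMap (C.IM k)) x
    have h2 : ∑ i : Fin (m + 2), ∑ σ ∈ Sh (i + 1) (m + 2),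
        (Equiv.Perm.sign σ * (-1) ^ ((i + 1) * (m + 2 - (i + 1)))) •
        C.diffPart (m + 2 - (i + 1) + 1)
        (Fin.cons (C.lBracket ϖ (i + 1) (firstArgs i.isLt (x ∘ σ)))
          (lastArgs (i + 1) (x ∘ σ))) = C.D (ς (m + 2) • C.IM (m + 2) (Prod.fst ∘ x) ϖ) := by
      rw [Finset.sum_eq_single (Fin.last (m + 1)), Finset.sum_eq_single 1]
      · rw [diffPart_succ, if_pos (by simp), Fin.cons_zero, lBracket_snd,
          C.diffPart_of_ne (by simp)]
        simp
        rfl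
      · intro σ hσ h
        exact absurd (mem_Sh_self.1 hσ) h
      · intro h
        exact absurd (mem_Sh_self.2 rfl) h
      · intro i _ hi
        refine Finset.sum_eq_zero fun σ _ => ?_
        have : (i : ℕ) ≠ m + 1 := fun h => hi (Fin.ext h)
        rw [diffPart_succ, if_neg (by omega), smul_zero]
      · simp
    refine (congrArg₂ (· + ·) h1 h2).trans ?_
    rw [map_smul, C.D_IM_eq_altSum ϖ (Prod.fst ∘ x) hϖ hL, ς_succ (m + 1)]
    simp only [AlternatingMap.smul_apply, LinearMap.compAlternatingMap_apply,
      LinearMap.applyₗ_apply_apply, altSum_smul]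
    rcases neg_one_pow_eq_or ℝ m with h3 | h3 <;> simp only [pow_succ, h3] <;> simp <;>
      rw [smul_comm] <;> exact add_neg_cancel _

/-- The local observables of a closed form constitute an `L_∞`-algebra. The Koszul signs only matter
when two arguments have positive degree, and then every summand of the Jacobi identity vanishes. -/
theorem isLInfty_hamDeg (hϖ : C.D ϖ = 0) (hdeg : ϖ ∈ C.deg (n + 1))
    (hΛ : ∀ v, Λ v = - C.I v ϖ) : IsLInfty (C.hamDeg n Λ) (fun k => C.lBracket ϖ k) where
  skew k hk := isGradedSkew_lBracket hϖ hdeg hΛ hk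
  jacobi m hm e x hx := by
    match m, hm with
    | 1, _ =>
      rw [Fin.sum_univ_one]
      refine Finset.sum_eq_zero fun σ _ => ?_
      have h := (C.lBracket_one_eq_hamDiff ϖ (Fin.cons (C.lBracket ϖ 1 (firstArgs le_rfl (x ∘ σ)))
        (lastArgs 1 (x ∘ σ))) hΛ).trans (congrArg _ (C.lBracket_one_eq_hamDiff ϖ _ hΛ))
      have h2 := hamDiff_hamDiff (hx (σ 0))
      exact (congrArg _ (h.trans h2)).trans (smul_zero _)
    | m + 2, _ =>
      rw [← jacobi_sign x hϖ fun a => L_of_mem hϖ hΛ (hx a)]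
      refine Finset.sum_congr rfl fun i _ => Finset.sum_congr rfl fun σ _ => ?_
      by_cases h : ∀ a b, a ≠ b → e a = 0 ∨ e b = 0
      · rw [χ_eq_sign σ h]
      · push Not at h
        obtain ⟨a, b, hab, ha, hb⟩ := h
        rw [nested_eq_zero i.isLt (C.vanishesOnForms_lBracket ϖ _)
          (C.vanishesOnForms_lBracket ϖ _) (σ.symm.injective.ne hab)
          (by simpa using fst_eq_zero (hx a) ha) (by simpa using fst_eq_zero (hx b) hb),
          smul_zero, smul_zero]

end GradedCalculus

/-! ### Components of the morphism -/

section Signs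

/-- The sign in the composite of the `(p + 1)`-st component of the morphism with the `k`-th
bracket. -/
lemma ς_mul_ς (k p : ℕ) : ς k * ς (p + 1) * (-1) ^ (k * p) = ς (k + p) * (-1) ^ p := by
  induction p with
  | zero => simp [ς_one]
  | succ p ih =>
    have h1 : (-1 : ℝ) ^ k * (-1) ^ k = 1 := by rw [← mul_pow]; simp
    have h2 : (-1 : ℝ) ^ p * (-1) ^ p = 1 := by rw [← mul_pow]; simp
    rw [ς_succ (p + 1), ← add_assoc, ς_succ (k + p), Nat.mul_succ, pow_add (-1 : ℝ) (k * p) k]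
    calc ς k * ((-1) ^ (p + 1 + 1) * ς (p + 1)) * ((-1) ^ (k * p) * (-1) ^ k)
        = (ς k * ς (p + 1) * (-1) ^ (k * p)) * (-1) ^ p * (-1) ^ k := by ring
      _ = ς (k + p) * ((-1) ^ p * (-1) ^ p) * (-1) ^ k := by rw [ih]; ring
      _ = (-1) ^ (k + p + 1) * ς (k + p) * (-1) ^ (p + 1) := by ring

lemma sum_choose_neg_one_pow (m : ℕ) :
    ∑ i : Fin (m + 1), ((m + 1).choose (i + 1) : ℝ) * (-1) ^ (m + 1 - (i + 1)) = (-1) ^ m := by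
  have h := add_pow (1 : ℝ) (-1) (m + 1)
  rw [add_neg_cancel, zero_pow (Nat.succ_ne_zero m), Finset.sum_range_succ'] at h
  rw [Fin.sum_univ_eq_sum_range fun i => ((m + 1).choose (i + 1) : ℝ) * (-1) ^ (m + 1 - (i + 1))]
  simp only [one_pow, one_mul, Nat.sub_zero, Nat.choose_zero_right, Nat.cast_one, mul_one] at h
  rw [pow_succ] at h
  simp only [mul_comm ((-1 : ℝ) ^ _)] at h
  linear_combination -h

end Signs

namespace CartanCalculus

variable {V M : Type*} [AddCommGroup V] [Module ℝ V] [AddCommGroup M] [Module ℝ M]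
  (C : CartanCalculus V M)

lemma IM_split {k p m : ℕ} (h : k + p = m) (v : Fin m → V) :
    C.IM p (fun b => v ⟨k + b, by omega⟩) * C.IM k (fun a => v ⟨a, by omega⟩) = C.IM m v := by
  induction k generalizing m with
  | zero =>
    obtain rfl : p = m := by omega
    rw [IM_zero, mul_one]
    congr 1
    funext b
    congr 1
    exact Fin.ext (by simp)
  | succ k ih =>
    obtain ⟨m, rfl⟩ : ∃ m', m = m' + 1 := ⟨k + p, by omega⟩
    rw [IM_succ, IM_succ, ← ih (by omega) (Fin.tail v), mul_assoc]
    congr 2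
    funext b
    rw [Fin.tail]
    congr 1
    exact Fin.ext (by simp; omega)

lemma IM_lastArgs_firstArgs {k m : ℕ} (h : k ≤ m) (v : Fin m → V) :
    C.IM (m - k) (lastArgs k v) * C.IM k (firstArgs h v) = C.IM m v :=
  C.IM_split (by omega) v

end CartanCalculus

/-- A morphism of graded Cartan calculi over the same vector fields. -/
structure GradedCalculus.Hom {V M M' : Type*} [AddCommGroup V] [Module ℝ V] [AddCommGroup M]
    [Module ℝ M] [AddCommGroup M'] [Module ℝ M'] (C : GradedCalculus V M)
    (C' : GradedCalculus V M') where
  /-- the map on forms -/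
  toLin : M →ₗ[ℝ] M'
  br_eq : ∀ u v, C'.br u v = C.br u v
  map_D : ∀ η, toLin (C.D η) = C'.D (toLin η)
  map_I : ∀ v η, toLin (C.I v η) = C'.I v (toLin η)
  map_mem : ∀ {p η}, η ∈ C.deg p → toLin η ∈ C'.deg p

namespace GradedCalculus.Hom

variable {V M M' : Type*} [AddCommGroup V] [Module ℝ V] [AddCommGroup M] [Module ℝ M]
  [AddCommGroup M'] [Module ℝ M'] {C : GradedCalculus V M} {C' : GradedCalculus V M'}
  (r : C.Hom C')

lemma map_IM {m : ℕ} (v : Fin m → V) (η : M) :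
    r.toLin (C.IM m v η) = C'.IM m v (r.toLin η) := by
  induction m generalizing η with
  | zero => rfl
  | succ m ih =>
    rw [CartanCalculus.IM_succ, CartanCalculus.IM_succ, Module.End.mul_apply, Module.End.mul_apply,
      ih, r.map_I]

/-- The map `(v, θ) ↦ (v, r θ)`. -/
def onPairs : V × M →ₗ[ℝ] V × M' := LinearMap.prodMap LinearMap.id r.toLin

lemma fst_comp_onPairs {m : ℕ} (x : Fin m → V × M) :
    Prod.fst ∘ (fun a => r.onPairs (x a)) = Prod.fst ∘ x := rfl

variable (V M) in
/-- The vector component of `f_m`. -/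
def _root_.Plectic.GradedCalculus.vecPart : (m : ℕ) → (V × M) [⋀^Fin m]→ₗ[ℝ] V
  | 1 => AlternatingMap.ofSubsingleton ℝ (V × M) V (0 : Fin 1) (LinearMap.fst ℝ V M)
  | _ => 0

lemma vecPart_one (x : Fin 1 → V × M) : vecPart V M 1 x = (x 0).1 := rfl

lemma vecPart_of_ne {m : ℕ} (hm : m ≠ 1) : vecPart V M m = 0 := by
  match m, hm with
  | 0, _ => rfl
  | m + 2, _ => rfl

lemma vecPart_eq {m : ℕ} (hm : m = 1) (x : Fin m → V × M) :
    vecPart V M m x = (x ⟨0, by omega⟩).1 := by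
  subst hm
  rfl

variable (A : M')

/-- The components of the `L_∞`-morphism as alternating maps:
`f_m(v_i + θ_i) = ς(m) (S_m(r θ) + I_{v_1 ∧ ⋯ ∧ v_m} A)`, and in addition the vector field `v_1` if
`m = 1`. -/
def qMorph (m : ℕ) : (V × M) [⋀^Fin m]→ₗ[ℝ] (V × M') :=
  (vecPart V M m).prod ((C'.morph A m).compLinearMap r.onPairs)

lemma qMorph_fst {m : ℕ} (x : Fin m → V × M) : (r.qMorph A m x).1 = vecPart V M m x := rfl

lemma qMorph_snd {m : ℕ} (x : Fin m → V × M) :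
    (r.qMorph A m x).2 = C'.morph A m fun a => r.onPairs (x a) := rfl

lemma vanishesOnForms_qMorph (m : ℕ) : VanishesOnForms (r.qMorph A m) where
  two x i j hij hi hj := by
    refine Prod.ext ?_ (C'.morph_eq_zero A hij hi hj)
    rw [qMorph_fst, vecPart_of_ne]
    · rfl
    · rintro rfl
      exact hij (Subsingleton.elim _ _)
  one x i hi := by
    rw [qMorph_fst]
    by_cases hm : m = 1
    · subst hm
      rw [vecPart_one, ← Subsingleton.elim i 0, hi]
    · rw [vecPart_of_ne hm]
      rfl

/-- In the first argument, the vector and the form component contribute separately; the form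
component does so through a single term of `S_m`. -/
lemma qMorph_snd_cons {p : ℕ} (a : V × M) (z : Fin p → V × M) :
    (r.qMorph A (p + 1) (Fin.cons a z)).2 =
      (C'.morph A (p + 1)).compLinearMap r.onPairs (Fin.cons (a.1, 0) z) +
      -(ς (p + 1) • C'.IM p (Prod.fst ∘ z) (r.toLin a.2)) := by
  have h1 : a = (a.1, 0) + (0, a.2) := by simp
  have h2 := ((C'.morph A (p + 1)).compLinearMap r.onPairs).toMultilinearMap.cons_add z
    (a.1, 0) (0, a.2)
  rw [← h1] at h2
  refine h2.trans (congrArg₂ (· + ·) rfl ?_)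
  rw [← fst_comp_onPairs r z, ← C'.morph_cons_zero A]
  change C'.morph A (p + 1) _ = _
  congr 1
  funext i
  refine Fin.cases ?_ (fun i => rfl) i
  exact Prod.ext rfl rfl

end GradedCalculus.Hom

/-! ### The sums in the morphism equation -/

namespace GradedCalculus.Hom

variable {V M M' : Type*} [AddCommGroup V] [Module ℝ V] [AddCommGroup M] [Module ℝ M]
  [AddCommGroup M'] [Module ℝ M'] {C : GradedCalculus V M} {C' : GradedCalculus V M'}
  (r : C.Hom C') (A : M') (ϖ : M)

/-- The contributions of the brackets `ς(k) ι ⋯ ι ϖ` to the morphism equation: all unshuffles give the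
same term, so that these add up to an alternating sum of binomial coefficients. -/
lemma sum_Sh_IM {m : ℕ} (x : Fin (m + 2) → V × M) (W : M') :
    ∑ i : Fin (m + 2), ∑ σ ∈ Sh (i + 1) (m + 2),
      (Equiv.Perm.sign σ * (-1) ^ ((i + 1) * (m + 2 - (i + 1)))) •
      -(ς (m + 2 - (i + 1) + 1) • C'.IM (m + 2 - (i + 1))
        (Prod.fst ∘ lastArgs (i + 1) (x ∘ σ))
        (ς (i + 1) • C'.IM (i + 1) (Prod.fst ∘ firstArgs i.isLt (x ∘ σ)) W)) =
      (-((-1) ^ (m + 1) * ς (m + 2))) • C'.IM (m + 2) (Prod.fst ∘ x) W := by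
  have h (i : Fin (m + 2)) : ∀ σ ∈ Sh (i + 1) (m + 2),
      (Equiv.Perm.sign σ * (-1) ^ ((i + 1) * (m + 2 - (i + 1)))) •
      -(ς (m + 2 - (i + 1) + 1) • C'.IM (m + 2 - (i + 1))
        (Prod.fst ∘ lastArgs (i + 1) (x ∘ σ))
        (ς (i + 1) • C'.IM (i + 1) (Prod.fst ∘ firstArgs i.isLt (x ∘ σ)) W)) =
      (-(ς (m + 2) * (-1) ^ (m + 2 - (i + 1)))) • C'.IM (m + 2) (Prod.fst ∘ x) W := by
    intro σ _
    have h1 : C'.IM (m + 2 - (i + 1)) (Prod.fst ∘ lastArgs (i + 1) (x ∘ σ))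
        (C'.IM (i + 1) (Prod.fst ∘ firstArgs i.isLt (x ∘ σ)) W) =
        Equiv.Perm.sign σ • C'.IM (m + 2) (Prod.fst ∘ x) W := by
      have h2 := congrArg (fun T => T W)
        (C'.IM_lastArgs_firstArgs (show (i : ℕ) + 1 ≤ m + 2 from i.isLt) ((Prod.fst ∘ x) ∘ σ))
      rw [AlternatingMap.map_perm] at h2
      exact h2
    have h3 := ς_mul_ς (i + 1) (m + 2 - (i + 1))
    rw [show (i : ℕ) + 1 + (m + 2 - (i + 1)) = m + 2 by omega] at h3
    rw [map_smul, h1, mul_smul, neg_one_units_pow_smul, ← h3]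
    rcases Int.units_eq_one_or (Equiv.Perm.sign σ) with hs | hs <;> rw [hs] <;>
      simp only [one_smul, Units.neg_smul] <;> module
  simp only [Finset.sum_congr rfl (h _), Finset.sum_const, card_Sh (Fin.isLt _)]
  rw [Finset.sum_congr rfl fun i _ => (Nat.cast_smul_eq_nsmul ℝ _ _).symm]
  simp only [smul_smul]
  rw [← Finset.sum_smul, ← sum_choose_neg_one_pow (m + 1), Finset.sum_mul, ← Finset.sum_neg_distrib]
  congr 1
  refine Finset.sum_congr rfl fun i _ => ?_
  ring

/-- The contributions of the first bracket to the morphism equation. -/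
lemma sum_Sh_diffPart {m : ℕ} (x : Fin (m + 2) → V × M) :
    ∑ i : Fin (m + 2), ∑ σ ∈ Sh (i + 1) (m + 2),
      (Equiv.Perm.sign σ * (-1) ^ ((i + 1) * (m + 2 - (i + 1)))) •
      -(ς (m + 2 - (i + 1) + 1) • C'.IM (m + 2 - (i + 1))
        (Prod.fst ∘ lastArgs (i + 1) (x ∘ σ))
        (r.toLin (C.diffPart (i + 1) (firstArgs i.isLt (x ∘ σ))))) =
      (-((-1) ^ (m + 1) * ς (m + 2))) • altSum (fun a y => C'.IM (m + 1) (Prod.fst ∘ y)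
        (C'.D a.2)) (fun a => r.onPairs (x a)) := by
  rw [Finset.sum_eq_single (0 : Fin (m + 2))]
  · have h1 : ∀ σ ∈ Sh 1 (m + 2), (Equiv.Perm.sign σ * (-1) ^ (1 * (m + 2 - 1))) •
        -(ς (m + 2) • C'.IM (m + 1) (Prod.fst ∘ lastArgs 1 (x ∘ σ))
          (r.toLin (C.diffPart 1 (firstArgs (by omega) (x ∘ σ))))) =
        (-((-1 : ℝ) ^ (m + 1) * ς (m + 2))) • Equiv.Perm.sign σ •
        (fun y : Fin (m + 2) → V × M => C'.IM (m + 1) (Prod.fst ∘ Fin.tail y)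
          (C'.D (r.toLin (y 0).2))) (x ∘ σ) := by
      intro σ _
      have h2 : lastArgs 1 (x ∘ σ) = Fin.tail (x ∘ σ) := by
        funext b
        rw [lastArgs, Fin.tail]
        congr 1
        exact Fin.ext (by simp; omega)
      rw [h2, diffPart_one, r.map_D, mul_smul, neg_one_units_pow_smul, one_mul]
      dsimp only
      rw [smul_comm (-((-1 : ℝ) ^ (m + 1) * ς (m + 2)))]
      congr 1
      change (-1 : ℝ) ^ (m + 1) • -(ς (m + 2) • C'.IM (m + 1) (Prod.fst ∘ Fin.tail (x ∘ σ))
        (C'.D (r.toLin ((x ∘ σ) 0).2))) = _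
      module
    refine (Finset.sum_congr rfl h1).trans ?_
    rw [← Finset.smul_sum, sum_sign_Sh_one (m := m + 1) (fun y : Fin (m + 2) → V × M =>
      C'.IM (m + 1) (Prod.fst ∘ Fin.tail y) (C'.D (r.toLin (y 0).2)))]
    rfl
  · intro i _ hi
    have : (i : ℕ) ≠ 0 := fun h => hi (Fin.ext h)
    refine Finset.sum_eq_zero fun σ _ => ?_
    rw [C.diffPart_of_ne (by omega), AlternatingMap.zero_apply, map_zero, map_zero, smul_zero,
      neg_zero, smul_zero]
  · simp

/-- The contributions of the brackets of the target to the morphism equation. Only `f_1` has a vector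
component, so that only the first and the last summand contribute. -/
lemma sum_Sh_hamBracket {m : ℕ} (x : Fin (m + 2) → V × M) :
    ∑ i : Fin (m + 1), ∑ τ ∈ (Sh (i + 1) (m + 2)).filter
        (fun τ => τ ⟨0, by omega⟩ < τ ⟨i + 1, by omega⟩),
      (Equiv.Perm.sign τ * (-1) ^ (i : ℕ)) •
      (C'.hamBracket (r.qMorph A (i + 1) (firstArgs (by omega) (x ∘ τ)))
        (r.qMorph A (m + 2 - (i + 1)) (lastArgs (i + 1) (x ∘ τ)))).2 =
      altSum (fun a y => C'.L a.1 (C'.morph A (m + 1) y)) (fun a => r.onPairs (x a)) := by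
  have hU : ∑ i : Fin (m + 1), ∑ τ ∈ (Sh (i + 1) (m + 2)).filter
        (fun τ => τ ⟨0, by omega⟩ < τ ⟨i + 1, by omega⟩),
      (Equiv.Perm.sign τ * (-1) ^ (i : ℕ)) •
      C'.L (r.qMorph A (i + 1) (firstArgs (by omega) (x ∘ τ))).1
        (r.qMorph A (m + 2 - (i + 1)) (lastArgs (i + 1) (x ∘ τ))).2 =
      C'.L (x 0).1 (C'.morph A (m + 1) (fun a => r.onPairs (Fin.tail x a))) := by
    rw [Finset.sum_eq_single (0 : Fin (m + 1))]
    · have h1 : (Sh ((0 : Fin (m + 1)) + 1 : ℕ) (m + 2)).filter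
          (fun τ => τ ⟨0, by omega⟩ < τ ⟨(0 : Fin (m + 1)) + 1, by simp⟩) = {1} := filter_Sh_one
      rw [h1, Finset.sum_singleton, qMorph_snd]
      have h2 : lastArgs 1 x = Fin.tail x := by
        funext b
        rw [lastArgs, Fin.tail]
        congr 1
        exact Fin.ext (by simp; omega)
      rw [← h2]
      simp
      rfl
    · intro i _ hi
      have : (i : ℕ) ≠ 0 := fun h => hi (Fin.ext h)
      refine Finset.sum_eq_zero fun σ _ => ?_
      rw [qMorph_fst, vecPart_of_ne (by omega), AlternatingMap.zero_apply, C'.L_zero,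
        LinearMap.zero_apply, smul_zero]
    · simp
  have hV : ∑ i : Fin (m + 1), ∑ τ ∈ (Sh (i + 1) (m + 2)).filter
        (fun τ => τ ⟨0, by omega⟩ < τ ⟨i + 1, by omega⟩),
      (Equiv.Perm.sign τ * (-1) ^ (i : ℕ)) •
      C'.L (r.qMorph A (m + 2 - (i + 1)) (lastArgs (i + 1) (x ∘ τ))).1
        (r.qMorph A (i + 1) (firstArgs (by omega) (x ∘ τ))).2 =
      C'.L (x 0).1 (C'.morph A (m + 1) (fun a => r.onPairs (Fin.tail x a))) -
      altSum (fun a y => C'.L a.1 (C'.morph A (m + 1) y)) (fun a => r.onPairs (x a)) := by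
    rw [Finset.sum_eq_single (Fin.last m)]
    · set G : (Fin (m + 2) → V × M) → M' := fun y => C'.L (y (Fin.last (m + 1))).1
        (C'.morph A (m + 1) fun a => r.onPairs (Fin.init y a)) with hG
      have h1 : ∀ τ ∈ (Sh (m + 1) (m + 2)).filter (fun τ => τ 0 < τ (Fin.last (m + 1))),
          (Equiv.Perm.sign τ * (-1) ^ m) •
          C'.L (r.qMorph A (m + 2 - (m + 1)) (lastArgs (m + 1) (x ∘ τ))).1
          (r.qMorph A (m + 1) (firstArgs (by omega) (x ∘ τ))).2 =
          (-1 : ℝ) ^ m • Equiv.Perm.sign τ • G (x ∘ τ) := by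
        intro τ _
        rw [qMorph_fst, vecPart_eq (by omega), qMorph_snd, mul_smul, neg_one_units_pow_smul,
          smul_comm]
        rfl
      refine (Finset.sum_congr rfl h1).trans ?_
      rw [← Finset.smul_sum, sum_sign_Sh_last]
      have h2 (a : V × M) (y : Fin (m + 1) → V × M) : G (Fin.snoc y a) =
          C'.L a.1 (C'.morph A (m + 1) fun b => r.onPairs (y b)) := by
        rw [hG]
        simp only [Fin.snoc_last, Fin.init_snoc]
      simp only [h2]
      have h3 : altSum (fun a y => C'.L a.1 (C'.morph A (m + 1) y)) (fun a => r.onPairs (x a)) =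
        altSum (fun a y => C'.L a.1 (C'.morph A (m + 1) fun b => r.onPairs (y b))) x := rfl
      rw [h3]
      rcases neg_one_pow_eq_or ℝ m with h | h <;> simp only [pow_succ, h] <;> module
    · intro i _ hi
      have : (i : ℕ) ≠ m := fun h => hi (Fin.ext h)
      refine Finset.sum_eq_zero fun σ _ => ?_
      rw [qMorph_fst, vecPart_of_ne (by omega), AlternatingMap.zero_apply, C'.L_zero,
        LinearMap.zero_apply, smul_zero]
    · simp
  simp only [hamBracket, smul_sub, Finset.sum_sub_distrib]
  rw [hU, hV]
  abel

end GradedCalculus.Hom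

/-! ### The morphism equation -/

/-- Brackets of two operations vanish when two of the vector components vanish. -/
lemma GradedCalculus.hamBracket_first_last_eq_zero {V M M' : Type*} [AddCommGroup V] [Module ℝ V]
    [AddCommGroup M'] [Module ℝ M'] (C' : GradedCalculus V M') {k m : ℕ} (hk : k ≤ m)
    {φ : (Fin k → V × M) → V × M'} {ψ : (Fin (m - k) → V × M) → V × M'}
    (hφ : VanishesOnForms φ) (hψ : VanishesOnForms ψ) {y : Fin m → V × M} {i j : Fin m}
    (hij : i ≠ j) (hi : (y i).1 = 0) (hj : (y j).1 = 0) :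
    C'.hamBracket (φ (firstArgs hk y)) (ψ (lastArgs k y)) = 0 := by
  have hlast (i : Fin m) (h : k ≤ (i : ℕ)) (hi : (y i).1 = 0) :
      (lastArgs k y ⟨i - k, by omega⟩).1 = 0 := by
    rw [lastArgs, ← hi]
    congr 2
    exact Fin.ext (by simp; omega)
  rcases lt_or_ge (i : ℕ) k with hik | hik <;> rcases lt_or_ge (j : ℕ) k with hjk | hjk
  · rw [hφ.two _ ⟨i, hik⟩ ⟨j, hjk⟩ (fun h => hij (Fin.ext (Fin.ext_iff.1 h :))) hi hj]
    simp [GradedCalculus.hamBracket, C'.zero_br, C'.L_zero]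
  · exact GradedCalculus.hamBracket_eq_zero (hφ.one _ ⟨i, hik⟩ hi) (hψ.one _ _ (hlast j hjk hj))
  · exact GradedCalculus.hamBracket_eq_zero (hφ.one _ ⟨j, hjk⟩ hj) (hψ.one _ _ (hlast i hik hi))
  · rw [hψ.two _ ⟨i - k, by omega⟩ ⟨j - k, by omega⟩
      (fun h => hij (Fin.ext (by simp at h; omega))) (hlast i hik hi) (hlast j hjk hj)]
    simp [GradedCalculus.hamBracket, C'.br_zero, C'.L_zero]

namespace GradedCalculus.Hom

variable {V M M' : Type*} [AddCommGroup V] [Module ℝ V] [AddCommGroup M] [Module ℝ M]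
  [AddCommGroup M'] [Module ℝ M'] {C : GradedCalculus V M} {C' : GradedCalculus V M'}
  (r : C.Hom C') {A : M'} {ϖ : M} {n : ℤ} {Λ : V →ₗ[ℝ] M} {Λ' : V →ₗ[ℝ] M'}

lemma neg_one_pow_succ_smul {N : Type*} [AddCommGroup N] (u : ℤˣ) (k : ℕ) (y : N) :
    (u * (-1) ^ (k + 1)) • y = -((u * (-1) ^ k) • y) := by
  rw [pow_succ, ← mul_assoc, mul_neg_one, Units.neg_smul]

/-- The vector component of the morphism equation only involves the bracket of vector fields. -/
lemma morphism_sign_fst {m : ℕ} (x : Fin (m + 2) → V × M) :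
    ∑ i : Fin (m + 2), ∑ σ ∈ Sh (i + 1) (m + 2),
      (Equiv.Perm.sign σ * (-1) ^ ((i + 1) * (m + 2 - (i + 1)) + 1)) •
      (r.qMorph A (m + 2 - (i + 1) + 1)
        (Fin.cons (C.lBracket ϖ (i + 1) (firstArgs i.isLt (x ∘ σ)))
          (lastArgs (i + 1) (x ∘ σ)))).1 +
    ∑ i : Fin (m + 1), ∑ τ ∈ (Sh (i + 1) (m + 2)).filter
        (fun τ => τ ⟨0, by omega⟩ < τ ⟨i + 1, by omega⟩),
      (Equiv.Perm.sign τ * (-1) ^ (i : ℕ)) •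
      (C'.hamBracket (r.qMorph A (i + 1) (firstArgs (by omega) (x ∘ τ)))
        (r.qMorph A (m + 2 - (i + 1)) (lastArgs (i + 1) (x ∘ τ)))).1 = 0 := by
  have h1 : ∑ i : Fin (m + 2), ∑ σ ∈ Sh (i + 1) (m + 2),
      (Equiv.Perm.sign σ * (-1) ^ ((i + 1) * (m + 2 - (i + 1)) + 1)) •
      (r.qMorph A (m + 2 - (i + 1) + 1)
        (Fin.cons (C.lBracket ϖ (i + 1) (firstArgs i.isLt (x ∘ σ)))
          (lastArgs (i + 1) (x ∘ σ)))).1 = - C.brPart (m + 2) (Prod.fst ∘ x) := by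
    rw [Finset.sum_eq_single (Fin.last (m + 1)), Finset.sum_eq_single 1]
    · rw [qMorph_fst, vecPart_eq (by simp)]
      change _ • (C.lBracket ϖ (m + 2) x).1 = _
      rw [lBracket_fst]
      simp
    · intro σ hσ h
      exact absurd (mem_Sh_self.1 hσ) h
    · intro h
      exact absurd (mem_Sh_self.2 rfl) h
    · intro i _ hi
      have : (i : ℕ) ≠ m + 1 := fun h => hi (Fin.ext h)
      refine Finset.sum_eq_zero fun σ _ => ?_
      rw [qMorph_fst, vecPart_of_ne (by omega), AlternatingMap.zero_apply, smul_zero]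
    · simp
  have h2 : ∑ i : Fin (m + 1), ∑ τ ∈ (Sh (i + 1) (m + 2)).filter
        (fun τ => τ ⟨0, by omega⟩ < τ ⟨i + 1, by omega⟩),
      (Equiv.Perm.sign τ * (-1) ^ (i : ℕ)) •
      (C'.hamBracket (r.qMorph A (i + 1) (firstArgs (by omega) (x ∘ τ)))
        (r.qMorph A (m + 2 - (i + 1)) (lastArgs (i + 1) (x ∘ τ)))).1 =
      C.brPart (m + 2) (Prod.fst ∘ x) := by
    rw [Finset.sum_eq_single (0 : Fin (m + 1))]
    · have h1 : (Sh ((0 : Fin (m + 1)) + 1 : ℕ) (m + 2)).filter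
          (fun τ => τ ⟨0, by omega⟩ < τ ⟨(0 : Fin (m + 1)) + 1, by simp⟩) = {1} := filter_Sh_one
      rw [h1, Finset.sum_singleton, hamBracket, qMorph_fst, qMorph_fst, r.br_eq]
      by_cases hm : m = 0
      · subst hm
        rw [brPart_two]
        simp
        rfl
      · rw [vecPart_of_ne (m := m + 2 - ((0 : Fin (m + 1)) + 1 : ℕ)) (by simp; omega),
          AlternatingMap.zero_apply, C.br_zero, C.brPart_of_ne (by omega)]
        simp
    · intro i _ hi
      have : (i : ℕ) ≠ 0 := fun h => hi (Fin.ext h)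
      refine Finset.sum_eq_zero fun σ _ => ?_
      rw [hamBracket, qMorph_fst, vecPart_of_ne (by omega), AlternatingMap.zero_apply, C'.zero_br,
        smul_zero]
    · simp
  rw [h1, h2, neg_add_cancel]

/-- The morphism equation with signs instead of Koszul signs. -/
lemma morphism_sign {m : ℕ} (x : Fin (m + 2) → V × M)
    (hA : ∀ v w, C'.I w (C'.I v (C'.D A)) = C'.I w (C'.I v (r.toLin ϖ))) :
    C'.hamDiff Λ' (r.qMorph A (m + 2) x) +
    ∑ i : Fin (m + 2), ∑ σ ∈ Sh (i + 1) (m + 2),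
      (Equiv.Perm.sign σ * (-1) ^ ((i + 1) * (m + 2 - (i + 1)) + 1)) •
      r.qMorph A (m + 2 - (i + 1) + 1)
        (Fin.cons (C.lBracket ϖ (i + 1) (firstArgs i.isLt (x ∘ σ)))
          (lastArgs (i + 1) (x ∘ σ))) +
    ∑ i : Fin (m + 1), ∑ τ ∈ (Sh (i + 1) (m + 2)).filter
        (fun τ => τ ⟨0, by omega⟩ < τ ⟨i + 1, by omega⟩),
      (Equiv.Perm.sign τ * (-1) ^ (i : ℕ)) •
      C'.hamBracket (r.qMorph A (i + 1) (firstArgs (by omega) (x ∘ τ)))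
        (r.qMorph A (m + 2 - (i + 1)) (lastArgs (i + 1) (x ∘ τ))) = 0 := by
  refine Prod.ext ?_ ?_
  · simp only [Prod.fst_add, Prod.fst_sum, Prod.smul_fst]
    rw [add_assoc, r.morphism_sign_fst x]
    simp [hamDiff]
  · simp only [Prod.snd_add, Prod.snd_sum, Prod.smul_snd]
    rw [sum_Sh_hamBracket]
    have hW : C'.IM (m + 2) (Prod.fst ∘ x) (C'.D A) =
        C'.IM (m + 2) (Prod.fst ∘ x) (r.toLin ϖ) := by
      rw [CartanCalculus.IM_succ, CartanCalculus.IM_succ]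
      simp only [Module.End.mul_apply]
      rw [show Fin.tail (Prod.fst ∘ x) 0 = (x 1).1 from rfl, hA]
    have hmain := C'.morph_identity A (r.toLin ϖ) (fun a => r.onPairs (x a)) hW
    have h0 : (C'.hamDiff Λ' (r.qMorph A (m + 2) x)).2 =
        C'.D (C'.morph A (m + 2) fun a => r.onPairs (x a)) := by
      rw [hamDiff, qMorph_fst, vecPart_of_ne (by omega), AlternatingMap.zero_apply, map_zero,
        sub_zero]
      rfl
    have hP := sum_Sh_lBracket (C := C) (ϖ := ϖ)
      (fun k => (C'.morph A k).compLinearMap r.onPairs) x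
    have hQ := sum_Sh_IM (C' := C') x (r.toLin ϖ)
    have hR := r.sum_Sh_diffPart x
    have hS : ∑ i : Fin (m + 2), ∑ σ ∈ Sh (i + 1) (m + 2),
      (Equiv.Perm.sign σ * (-1) ^ ((i + 1) * (m + 2 - (i + 1)) + 1)) •
      (r.qMorph A (m + 2 - (i + 1) + 1)
        (Fin.cons (C.lBracket ϖ (i + 1) (firstArgs i.isLt (x ∘ σ)))
          (lastArgs (i + 1) (x ∘ σ)))).2 =
      -((2⁻¹ : ℝ) • altSum (fun a y => altSum (fun b z => (C'.morph A (m + 1)).compLinearMap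
          r.onPairs (Fin.cons (C.br a.1 b.1, 0) z)) y) x +
        ((-((-1) ^ (m + 1) * ς (m + 2))) • C'.IM (m + 2) (Prod.fst ∘ x) (r.toLin ϖ) +
        (-((-1) ^ (m + 1) * ς (m + 2))) • altSum (fun a y => C'.IM (m + 1) (Prod.fst ∘ y)
        (C'.D a.2)) (fun a => r.onPairs (x a)))) := by
      rw [← hP, ← hQ, ← hR, ← Finset.sum_add_distrib, ← Finset.sum_add_distrib,
        ← Finset.sum_neg_distrib]
      refine Finset.sum_congr rfl fun i _ => ?_
      rw [← Finset.sum_add_distrib, ← Finset.sum_add_distrib, ← Finset.sum_neg_distrib]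
      refine Finset.sum_congr rfl fun σ _ => ?_
      rw [neg_one_pow_succ_smul, ← smul_add, ← smul_add, qMorph_snd_cons, lBracket_snd, map_add,
        map_smul, r.map_IM, map_add]
      exact congrArg _ (congrArg _ (congrArg₂ (· + ·) rfl
        ((congrArg _ (smul_add _ _ _)).trans (neg_add _ _))))
    have hbr : altSum (fun a y => altSum (fun b z =>
          C'.morph A (m + 1) (Fin.cons (C'.br a.1 b.1, 0) z)) y) (fun a => r.onPairs (x a)) =
        altSum (fun a y => altSum (fun b z => (C'.morph A (m + 1)).compLinearMap
          r.onPairs (Fin.cons (C.br a.1 b.1, 0) z)) y) x := by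
      refine Finset.sum_congr rfl fun i _ => congrArg _ (Finset.sum_congr rfl fun j _ =>
        congrArg _ ?_)
      change _ = C'.morph A (m + 1) _
      dsimp only
      rw [r.br_eq]
      congr 1
      funext a
      refine Fin.cases ?_ (fun a => rfl) a
      exact Prod.ext rfl (map_zero r.toLin).symm
    rw [h0, hS, ← hbr]
    refine Eq.trans ?_ hmain
    rw [fst_comp_onPairs]
    rcases neg_one_pow_eq_or ℝ m with h | h <;> simp only [pow_succ, h] <;> module

lemma qMorph_one (x : Fin 1 → V × M) :
    r.qMorph A 1 x = ((x 0).1, -r.toLin (x 0).2 + C'.I (x 0).1 A) :=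
  Prod.ext rfl (C'.morph_one A _)

/-- The maps `qMorph` respect the gradings. In degree zero this is the equation
`Λ' v = D I_v A + I_v ϖ`. -/
theorem isGradedSkew_qMorph (hdeg : A ∈ C'.deg n) (hΛ : ∀ v, Λ v = - C.I v ϖ)
    (hΛ' : ∀ v, Λ' v = C'.D (C'.I v A) + C'.I v (r.toLin ϖ)) {m : ℕ} (hm : 1 ≤ m) :
    IsGradedSkew (C.hamDeg n Λ) (C'.hamDeg n Λ') m (m - 1) (r.qMorph A m) := by
  refine isGradedSkew_of_alternating _ (fun e x hx a b hab ha hb =>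
    (r.vanishesOnForms_qMorph A m).two x a b hab (fst_eq_zero (hx a) ha)
      (fst_eq_zero (hx b) hb)) fun e x hx => ?_
  by_cases hneg : ∃ a, e a < 0
  · obtain ⟨a, ha⟩ := hneg
    rw [(r.qMorph A m).map_coord_zero a (eq_zero_of_neg (hx a) ha)]
    exact Submodule.zero_mem _
  push Not at hneg
  have hsum : 0 ≤ ∑ a, e a := Finset.sum_nonneg fun a _ => hneg a
  refine ⟨?_, fun h => ?_, fun h => ?_, fun h => by omega⟩
  · obtain ⟨m, rfl⟩ : ∃ m', m = m' + 1 := ⟨m - 1, by omega⟩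
    rw [qMorph_snd, CartanCalculus.morph_succ]
    refine Submodule.smul_mem _ _ (Submodule.add_mem _ (Submodule.neg_mem _
      (Submodule.sum_mem _ fun i _ => Submodule.smul_mem _ _ ?_)) ?_)
    · by_cases h : ∀ j, e (i.succAbove j) = 0
      · have h1 : ∑ a, e a = e i := by
          rw [Fin.sum_univ_succAbove _ i, Finset.sum_eq_zero fun j _ => h j, add_zero]
        have h2 := C'.IM_mem (Prod.fst ∘ i.removeNth fun a => r.onPairs (x a))
          (r.map_mem (hx i).1)
        rwa [show n - 1 - e i - (m : ℤ) = n - 1 - (∑ a, e a + ((m + 1 : ℕ) - 1)) by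
          rw [h1]; push_cast; ring] at h2
      · push Not at h
        obtain ⟨j, hj⟩ := h
        dsimp only
        rw [C'.IM_eq_zero (v := Prod.fst ∘ i.removeNth fun a => r.onPairs (x a)) j
          (show (x (i.succAbove j)).1 = 0 from fst_eq_zero (hx (i.succAbove j)) hj),
          LinearMap.zero_apply]
        exact Submodule.zero_mem _
    · by_cases h : ∀ j, e j = 0
      · have h2 := C'.IM_mem (Prod.fst ∘ fun a => r.onPairs (x a)) hdeg
        rwa [show n - ((m + 1 : ℕ) : ℤ) = n - 1 - (∑ a, e a + ((m + 1 : ℕ) - 1)) by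
          rw [Finset.sum_eq_zero fun j _ => h j]; push_cast; ring] at h2
      · push Not at h
        obtain ⟨j, hj⟩ := h
        rw [C'.IM_eq_zero j (fst_eq_zero (hx _) hj), LinearMap.zero_apply]
        exact Submodule.zero_mem _
  · obtain rfl : m = 1 := by omega
    have he : e 0 = 0 := by
      rw [Fin.sum_univ_one] at h
      simpa using h
    have h1 := (hx 0).2.1 he
    rw [qMorph_one, hΛ', map_add, map_neg, ← r.map_D, ← h1, hΛ, map_neg, neg_neg, r.map_I, add_comm]
  · by_cases hm1 : m = 1
    · subst hm1
      rw [qMorph_one]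
      rw [Fin.sum_univ_one] at h
      change (x 0).1 = 0
      exact fst_eq_zero (hx 0) (by simpa using h)
    · rw [qMorph_fst, vecPart_of_ne hm1]
      rfl

/-- The maps `qMorph` constitute an `L_∞`-morphism. As for the Jacobi identity, the Koszul signs and
the signs that depend on degrees are trivial unless all summands vanish. -/
theorem isLInftyMorphism_qMorph (hdeg : A ∈ C'.deg n) (hΛ : ∀ v, Λ v = - C.I v ϖ)
    (hA : ∀ v w, C'.I w (C'.I v (C'.D A)) = C'.I w (C'.I v (r.toLin ϖ)))
    (hΛ' : ∀ v, Λ' v = C'.D (C'.I v A) + C'.I v (r.toLin ϖ)) :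
    IsLInftyMorphism (C.hamDeg n Λ) (fun k => C.lBracket ϖ k) (C'.hamDeg n Λ') (C'.hamDiff Λ')
      C'.hamBracket (fun m => r.qMorph A m) where
  skew m hm := r.isGradedSkew_qMorph hdeg hΛ hΛ' hm
  eq m hm e x hx := by
    match m, hm with
    | 1, _ =>
      have h0 : (fun m => r.qMorph A m) 1 x = r.qMorph A 1 x := rfl
      rw [Fin.sum_univ_one]
      have h1 : Sh ((0 : Fin 1) + 1 : ℕ) 1 = {1} := by
        ext σ
        rw [Finset.mem_singleton]
        exact mem_Sh_self
      have h2 : r.qMorph A 1 (Fin.cons (C.lBracket ϖ 1 x) (lastArgs 1 x)) =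
          C'.hamDiff Λ' (r.qMorph A 1 x) := by
        rw [qMorph_one, qMorph_one, Fin.cons_zero, lBracket_one, hamDiff, hΛ', map_zero,
          LinearMap.zero_apply, add_zero, map_add, map_add, map_neg, r.map_D, r.map_I]
        refine Prod.ext rfl ?_
        dsimp only
        abel
      rw [h1, Finset.sum_singleton]
      have h3 : (χ 1 e * (-1) ^ ((((0 : Fin 1) : ℕ) + 1) * (1 - (((0 : Fin 1) : ℕ) + 1)) + 1)) •
          r.qMorph A 1 (Fin.cons (C.lBracket ϖ 1 x) (lastArgs 1 x)) =
          - C'.hamDiff Λ' (r.qMorph A 1 x) := by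
        rw [h2, χ_eq_sign 1 fun a b h => absurd (Subsingleton.elim a b) h]
        simp
      refine (congrArg₂ (· + ·) (congrArg₂ (· + ·) rfl h3) Finset.sum_empty).trans ?_
      rw [add_neg_cancel, add_zero]
    | m + 2, _ =>
      rw [← r.morphism_sign (Λ' := Λ') x hA]
      have hvan := r.vanishesOnForms_qMorph A
      refine congrArg₂ (· + ·) (congrArg₂ (· + ·) rfl (Finset.sum_congr rfl fun i _ =>
        Finset.sum_congr rfl fun σ _ => ?_)) (Finset.sum_congr rfl fun i _ =>
        Finset.sum_congr rfl fun τ _ => ?_)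
      · by_cases h : ∀ a b, a ≠ b → e a = 0 ∨ e b = 0
        · rw [χ_eq_sign σ h]
        · push Not at h
          obtain ⟨a, b, hab, ha, hb⟩ := h
          rw [nested_eq_zero i.isLt (C.vanishesOnForms_lBracket ϖ _) (hvan _)
            (σ.symm.injective.ne hab) (by simpa using fst_eq_zero (hx a) ha)
            (by simpa using fst_eq_zero (hx b) hb), smul_zero, smul_zero]
      · by_cases h : ∀ a b, a ≠ b → e a = 0 ∨ e b = 0
        · rw [χ_eq_sign τ h]
          by_cases h0 : (r.qMorph A (i + 1) (firstArgs (by omega) (x ∘ τ))).1 = 0 ∧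
              (r.qMorph A (m + 2 - (i + 1)) (lastArgs (i + 1) (x ∘ τ))).1 = 0
          · exact (congrArg _ (hamBracket_eq_zero h0.1 h0.2)).trans
              ((smul_zero _).trans ((congrArg _ (hamBracket_eq_zero h0.1 h0.2)).trans
                (smul_zero _)).symm)
          -- one of the two values has a vector component, so `t = 1`, or `s = 1` and the degree
          -- of the first entry is zero
          refine congrArg (· • _) ?_
          rw [mul_assoc]
          conv_rhs => rw [← mul_one ((-1 : ℤˣ) ^ (i : ℕ))]
          refine congrArg (_ * ·) (congrArg (_ * ·) ?_)
          rw [← Int.negOnePow_zero]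
          congr 1
          by_cases ht : m + 2 - ((i : ℕ) + 1) = 1
          · have : ((m + 2 : ℕ) : ℤ) - (i + 1) - 1 = 0 := by have := i.isLt; omega
            rw [this, zero_mul]
          · have ht1 : (r.qMorph A (m + 2 - (i + 1)) (lastArgs (i + 1) (x ∘ τ))).1 = 0 := by
              rw [qMorph_fst, vecPart_of_ne ht]
              rfl
            have hs1 : (r.qMorph A (i + 1) (firstArgs (by omega) (x ∘ τ))).1 ≠ 0 :=
              fun h => h0 ⟨h, ht1⟩
            have hi : (i : ℕ) = 0 := by
              by_contra hi
              refine hs1 ?_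
              rw [qMorph_fst, vecPart_of_ne fun h => hi (by omega)]
              rfl
            obtain ⟨i, hi'⟩ := i
            obtain rfl : i = 0 := hi
            have hv : (x (τ 0)).1 ≠ 0 := hs1
            have he : e (τ 0) = 0 := by
              by_contra hne
              exact hv (fst_eq_zero (hx _) hne)
            refine mul_eq_zero_of_right _ (Finset.sum_eq_zero fun p _ => ?_)
            rw [← he]
            have hp : (p : ℕ) = 0 := Nat.lt_one_iff.1 p.isLt
            exact congrArg (fun a => e (τ a)) (Fin.ext hp)
        · push Not at h
          obtain ⟨a, b, hab, ha, hb⟩ := h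
          have h0 := C'.hamBracket_first_last_eq_zero (show (i : ℕ) + 1 ≤ m + 2 by omega)
            (hvan (i + 1)) (hvan (m + 2 - (i + 1))) (y := x ∘ τ) (τ.symm.injective.ne hab)
            (by simpa using fst_eq_zero (hx a) ha) (by simpa using fst_eq_zero (hx b) hb)
          exact (congrArg _ h0).trans ((smul_zero _).trans ((congrArg _ h0).trans
            (smul_zero _)).symm)

end GradedCalculus.Hom

/-! ### The linear part of the morphism, and restriction to homogeneous elements -/

namespace GradedCalculus.Hom

variable {V M M' : Type*} [AddCommGroup V] [Module ℝ V] [AddCommGroup M] [Module ℝ M]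
  [AddCommGroup M'] [Module ℝ M'] {C : GradedCalculus V M} {C' : GradedCalculus V M'}
  (r : C.Hom C') {A : M'} {ϖ : M} {n : ℤ} {Λ : V →ₗ[ℝ] M} {Λ' : V →ₗ[ℝ] M'}

/-- The linear part of the `L_∞`-morphism is a quasi-isomorphism if the forms of `C'` resolve
those of `C`: every element of `C'` whose differential comes from `C` is, up to a boundary,
itself in the image of `C`. -/
theorem isQuasiIso_linear_part (hinj : ∀ η, r.toLin η = 0 → η = 0)
    (hres : ∀ p, ∀ θ ∈ C'.deg p, ∀ η, C'.D θ = r.toLin η →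
      ∃ ζ ∈ C.deg p, ∃ ξ ∈ C'.deg (p - 1), θ = r.toLin ζ + C'.D ξ)
    (hdeg : A ∈ C'.deg n) (hΛ : ∀ v, Λ v = - C.I v ϖ)
    (hΛ' : ∀ v, Λ' v = C'.D (C'.I v A) + C'.I v (r.toLin ϖ)) :
    IsQuasiIso (C.hamDeg n Λ) (C.hamDiff Λ) (C'.hamDeg n Λ') (C'.hamDiff Λ')
      (fun x => (x.1, -r.toLin x.2 + C'.I x.1 A)) := by
  have hinj' {η ζ : M} (h : r.toLin η = r.toLin ζ) : η = ζ :=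
    sub_eq_zero.1 (hinj _ (by rw [map_sub, h, sub_self]))
  have hD {θ : M'} {ζ : M} {ξ : M'} (h : θ = r.toLin ζ + C'.D ξ) : C'.D θ = r.toLin (C.D ζ) := by
    rw [h, map_add, C'.D_D_apply, add_zero, r.map_D]
  refine ⟨fun i x hx _ ⟨y, hy, hyx⟩ => ?_, fun i y hy hDy => ?_⟩
  · rcases lt_or_ge i 0 with hi | hi
    · exact ⟨0, Submodule.zero_mem _, by rw [eq_zero_of_neg hx hi]; simp [hamDiff]⟩
    have hi1 : i + 1 ≠ 0 := by omega
    have hv : x.1 = 0 := (congrArg Prod.fst hyx).symm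
    have h2 : C'.D y.2 = r.toLin (-x.2) := by
      have := congrArg Prod.snd hyx
      dsimp only [hamDiff] at this
      rwa [fst_eq_zero hy hi1, hv, map_zero, map_zero, LinearMap.zero_apply, sub_zero, add_zero,
        ← map_neg] at this
    obtain ⟨ζ, hζ, ξ, -, h⟩ := hres _ _ hy.1 _ h2
    refine ⟨(0, -ζ), ⟨Submodule.neg_mem _ hζ, fun h => absurd h hi1, fun _ => rfl,
      fun h => absurd h (by omega)⟩, Prod.ext hv.symm ?_⟩
    have h3 : C.D ζ = -x.2 := hinj' ((hD h).symm.trans h2)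
    rw [hamDiff, map_zero, sub_zero, map_neg, h3, neg_neg]
  · rcases lt_or_ge i 0 with hi | hi
    · exact ⟨0, Submodule.zero_mem _, by simp [hamDiff], 0, Submodule.zero_mem _, by
        rw [eq_zero_of_neg hy hi]; simp [hamDiff]⟩
    -- correcting `y` by the contribution of `A` makes its differential the image of `I_v ϖ`
    have hy2 : C'.D (y.2 - C'.I y.1 A) = r.toLin (C.I y.1 ϖ) := by
      have : C'.D y.2 = Λ' y.1 := (sub_eq_zero.1 (congrArg Prod.snd hDy))
      rw [map_sub, this, hΛ', add_sub_cancel_left, r.map_I]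
    have hmem : y.2 - C'.I y.1 A ∈ C'.deg (n - 1 - i) := by
      refine Submodule.sub_mem _ hy.1 ?_
      by_cases hi0 : i = 0
      · rw [hi0, sub_zero]
        exact C'.I_mem _ hdeg
      · rw [fst_eq_zero hy hi0, map_zero]
        exact Submodule.zero_mem _
    obtain ⟨ζ, hζ, ξ, hξ, h⟩ := hres _ _ hmem _ hy2
    have h3 : Λ y.1 = C.D (-ζ) := by
      rw [hΛ, map_neg, hinj' ((hD h).symm.trans hy2)]
    refine ⟨(y.1, -ζ), ⟨Submodule.neg_mem _ hζ, fun _ => h3, hy.2.2.1,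
      fun h => absurd h (by omega)⟩, ?_, (0, ξ), ⟨?_, fun h => absurd h (by omega),
      fun _ => rfl, fun h => absurd h (by omega)⟩, ?_⟩
    · exact Prod.ext rfl (sub_eq_zero.2 h3.symm)
    · rwa [sub_sub] at hξ
    · refine Prod.ext (sub_self _).symm ?_
      dsimp only [hamDiff, Prod.snd_sub]
      rw [map_zero, sub_zero, map_neg, neg_neg, ← sub_sub, sub_right_comm, h, add_sub_cancel_left]

end GradedCalculus.Hom

section Transfer

variable {V V' : Type*} [AddCommGroup V] [Module ℝ V] [AddCommGroup V'] [Module ℝ V']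
  {𝒱 : ℤ → Submodule ℝ V} {𝒱' : ℤ → Submodule ℝ V'}

lemma IsGradedSkew.congr {k : ℕ} {r : ℤ} {φ ψ : (Fin k → V) → V'}
    (h : IsGradedSkew 𝒱 𝒱' k r φ)
    (hψ : ∀ (e : Fin k → ℤ) (x : Fin k → V), (∀ a, x a ∈ 𝒱 (e a)) → ψ x = φ x) :
    IsGradedSkew 𝒱 𝒱' k r ψ := by
  have hup {e : Fin k → ℤ} {x : Fin k → V} (hx : ∀ a, x a ∈ 𝒱 (e a)) {a : Fin k} {y : V}
      (hy : y ∈ 𝒱 (e a)) (b : Fin k) : Function.update x a y b ∈ 𝒱 (e b) := by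
    rcases eq_or_ne b a with rfl | hb
    · rwa [Function.update_self]
    · rw [Function.update_of_ne hb]
      exact hx b
  refine ⟨fun e x hx => ?_, fun e x hx a y hy => ?_, fun e x hx a c => ?_, fun e x hx σ => ?_⟩
  · rw [hψ e x hx]
    exact h.mem e x hx
  · rw [hψ e _ (hup hx (Submodule.add_mem _ (hx a) hy)), hψ e x hx, hψ e _ (hup hx hy)]
    exact h.map_add e x hx a y hy
  · rw [hψ e _ (hup hx (Submodule.smul_mem _ c (hx a))), hψ e x hx]
    exact h.map_smul e x hx a c
  · rw [hψ (e ∘ σ) (x ∘ σ) fun a => hx (σ a), hψ e x hx]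
    exact h.skew e x hx σ

/-- Feeding the value of a homogeneous operation back in gives homogeneous arguments. -/
lemma IsGradedSkew.cons_mem {k m : ℕ} {r : ℤ} {φ : (Fin k → V) → V}
    (h : IsGradedSkew 𝒱 𝒱 k r φ) (hk : k ≤ m) {e : Fin m → ℤ} {x : Fin m → V}
    (hx : ∀ a, x a ∈ 𝒱 (e a)) (a : Fin (m - k + 1)) :
    (Fin.cons (φ (firstArgs hk x)) (lastArgs k x) : Fin (m - k + 1) → V) a ∈
      𝒱 ((Fin.cons (∑ b, firstArgs hk e b + r) (lastArgs k e) : Fin (m - k + 1) → ℤ) a) := by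
  refine Fin.cases ?_ (fun a => ?_) a
  · exact h.mem (firstArgs hk e) _ fun b => hx _
  · exact hx _

/-- The axioms of an `L_∞`-algebra only involve the values of the brackets on homogeneous
elements. -/
lemma IsLInfty.congr {l l' : (k : ℕ) → (Fin k → V) → V} (h : IsLInfty 𝒱 l)
    (hl : ∀ k, 1 ≤ k → ∀ (e : Fin k → ℤ) (x : Fin k → V), (∀ a, x a ∈ 𝒱 (e a)) → l' k x = l k x) :
    IsLInfty 𝒱 l' := by
  refine ⟨fun k hk => (h.skew k hk).congr (hl k hk), fun m hm e x hx => ?_⟩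
  rw [← h.jacobi m hm e x hx]
  refine Finset.sum_congr rfl fun i _ => Finset.sum_congr rfl fun σ _ => ?_
  have hxσ (a) : (x ∘ σ) a ∈ 𝒱 ((e ∘ σ) a) := hx (σ a)
  rw [hl (i + 1) (by omega) (firstArgs i.isLt (e ∘ σ)) (firstArgs i.isLt (x ∘ σ)) fun a => hxσ _,
    hl _ (by omega) _ _ ((h.skew (i + 1) (by omega)).cons_mem i.isLt hxσ)]

lemma IsDGLie.congr {D D' : V → V} {br br' : V → V → V} (h : IsDGLie 𝒱 D br)
    (hD : ∀ i, ∀ x ∈ 𝒱 i, D' x = D x) (hbr : ∀ x y, br' x y = br x y) : IsDGLie 𝒱 D' br' := by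
  obtain rfl : br' = br := funext fun x => funext (hbr x)
  refine ⟨fun i x hx => ?_, fun i x hx y hy => ?_, fun i x hx c => ?_, fun i x hx => ?_, h.br_mem,
    h.br_add, h.br_smul, h.br_skew, h.jacobi, fun i j x hx y hy => ?_⟩
  · rw [hD i x hx]
    exact h.diff_mem i x hx
  · rw [hD i _ (Submodule.add_mem _ hx hy), hD i x hx, hD i y hy]
    exact h.diff_add i x hx y hy
  · rw [hD i _ (Submodule.smul_mem _ c hx), hD i x hx]
    exact h.diff_smul i x hx c
  · rw [hD i x hx, hD _ _ (h.diff_mem i x hx)]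
    exact h.diff_diff i x hx
  · rw [hD _ _ (h.br_mem i j x hx y hy), hD i x hx, hD j y hy]
    exact h.leibniz i j x hx y hy

/-- The axioms of an `L_∞`-morphism only involve the values of all operations on homogeneous
elements. -/
lemma IsLInftyMorphism.congr {l l' : (k : ℕ) → (Fin k → V) → V} {D D' : V' → V'}
    {br br' : V' → V' → V'} {f f' : (m : ℕ) → (Fin m → V) → V'}
    (hL : IsLInfty 𝒱 l) (h : IsLInftyMorphism 𝒱 l 𝒱' D br f)
    (hl : ∀ k, 1 ≤ k → ∀ (e : Fin k → ℤ) (x : Fin k → V), (∀ a, x a ∈ 𝒱 (e a)) → l' k x = l k x)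
    (hD : ∀ i, ∀ x ∈ 𝒱' i, D' x = D x) (hbr : ∀ x y, br' x y = br x y)
    (hf : ∀ m, 1 ≤ m → ∀ (e : Fin m → ℤ) (x : Fin m → V), (∀ a, x a ∈ 𝒱 (e a)) → f' m x = f m x) :
    IsLInftyMorphism 𝒱 l' 𝒱' D' br' f' := by
  obtain rfl : br' = br := funext fun x => funext (hbr x)
  refine ⟨fun m hm => (h.skew m hm).congr (hf m hm), fun m hm e x hx => ?_⟩
  rw [← h.eq m hm e x hx, hf m hm e x hx, hD _ _ ((h.skew m hm).mem e x hx)]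
  refine congrArg₂ (· + ·) (congrArg₂ (· + ·) rfl (Finset.sum_congr rfl fun i _ =>
    Finset.sum_congr rfl fun σ _ => ?_)) (Finset.sum_congr rfl fun i _ =>
    Finset.sum_congr rfl fun τ _ => ?_)
  · have hxσ (a) : (x ∘ σ) a ∈ 𝒱 ((e ∘ σ) a) := hx (σ a)
    rw [hl (i + 1) (by omega) (firstArgs i.isLt (e ∘ σ)) (firstArgs i.isLt (x ∘ σ)) fun a => hxσ _,
      hf _ (by omega) _ _ ((hL.skew (i + 1) (by omega)).cons_mem i.isLt hxσ)]
  · have hxτ (a) : (x ∘ τ) a ∈ 𝒱 ((e ∘ τ) a) := hx (τ a)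
    have := i.isLt
    rw [hf (i + 1) (by omega) (firstArgs (by omega) (e ∘ τ))
        (firstArgs (by omega) (x ∘ τ)) fun a => hxτ _,
      hf (m - (i + 1)) (by omega) (lastArgs (i + 1) (e ∘ τ))
        (lastArgs (i + 1) (x ∘ τ)) fun a => hxτ _]

lemma IsQuasiIso.congr {D₁ D₁' : V → V} {D₂ D₂' : V' → V'} {φ φ' : V → V'}
    (h : IsQuasiIso 𝒱 D₁ 𝒱' D₂ φ) (h1 : ∀ i, ∀ x ∈ 𝒱 i, D₁' x = D₁ x)
    (h2 : ∀ i, ∀ x ∈ 𝒱' i, D₂' x = D₂ x) (hφ : ∀ x, φ' x = φ x) :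
    IsQuasiIso 𝒱 D₁' 𝒱' D₂' φ' := by
  obtain rfl : φ' = φ := funext hφ
  refine ⟨fun i x hx hDx ⟨y, hy, hyx⟩ => ?_, fun i y hy hDy => ?_⟩
  · obtain ⟨z, hz, hzx⟩ := h.1 i x hx (h1 i x hx ▸ hDx) ⟨y, hy, h2 _ y hy ▸ hyx⟩
    exact ⟨z, hz, (h1 _ z hz).trans hzx⟩
  · obtain ⟨x, hx, hDx, z, hz, hzx⟩ := h.2 i y hy (h2 i y hy ▸ hDy)
    exact ⟨x, hx, (h1 _ x hx).trans hDx, z, hz, (h2 _ z hz).trans hzx⟩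

end Transfer

/-! ### Forms and cochains as graded Cartan calculi -/

namespace GradedCalculus

variable {V M M' : Type*} [AddCommGroup V] [Module ℝ V] [AddCommGroup M] [Module ℝ M]
  [AddCommGroup M'] [Module ℝ M'] (C : GradedCalculus V M)

/-- The map `v ↦ -I_v ϖ`; the degree zero part of `hamDeg` for it consists of the Hamiltonian
pairs of `ϖ`. -/
def negContract (ϖ : M) : V →ₗ[ℝ] M := -(C.I.flip ϖ)

lemma negContract_apply (ϖ : M) (v : V) : C.negContract ϖ v = - C.I v ϖ := rfl

variable {C}

lemma negContract_eq_iff {ϖ θ : M} {v : V} :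
    C.negContract ϖ v = C.D θ ↔ C.I v ϖ + C.D θ = 0 := by
  rw [negContract_apply, neg_eq_iff_add_eq_zero]

lemma lBracket_two (ϖ : M) (x : Fin 2 → V × M) :
    C.lBracket ϖ 2 x = (C.br (x 0).1 (x 1).1, C.IM 2 (fun a => (x a).1) ϖ) := by
  refine Prod.ext rfl ?_
  rw [lBracket_snd, ς_two, one_smul]
  exact add_zero _

lemma lBracket_add_three (ϖ : M) (k : ℕ) (x : Fin (k + 3) → V × M) :
    C.lBracket ϖ (k + 3) x = (0, ς (k + 3) • C.IM (k + 3) (fun a => (x a).1) ϖ) := by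
  refine Prod.ext rfl ?_
  rw [lBracket_snd]
  exact add_zero _

end GradedCalculus

open GradedCalculus

section Concrete

variable {E : Type*} [NormedAddCommGroup E] [NormedSpace ℝ E] [FiniteDimensional ℝ E]
  {X : Type*} [TopologicalSpace X] [ChartedSpace E X] [IsManifold 𝓘(ℝ, E) ∞ X]
  {κ : Type*} {𝒰 : κ → TopologicalSpace.Opens X}

variable (E X) in
/-- The graded Cartan calculus on the de Rham complex of `X`. -/
def formsGraded : GradedCalculus (VField E X) (Forms E (⊤ : TopologicalSpace.Opens X)) where
  toCartanCalculus := formsCartan E ⊤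
  deg := formsDeg E ⊤
  D_mem := d_mem_formsDeg
  I_mem := ι_mem_formsDeg
  br_add := VField.bracket_add
  br_smul c u v := VField.bracket_smul u v c
  br_swap := VField.bracket_swap
  br_leibniz := VField.bracket_leibniz

variable (E 𝒰) in
/-- The graded Cartan calculus on the Čech–de Rham complex. -/
def totGraded : GradedCalculus (VField E X) (Tot E 𝒰) where
  toCartanCalculus := totCartan E 𝒰
  deg := totDeg E 𝒰
  D_mem := dTot_mem_totDeg
  I_mem := totCartan_I_mem
  br_add := VField.bracket_add
  br_smul c u v := VField.bracket_smul u v c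
  br_swap := VField.bracket_swap
  br_leibniz := VField.bracket_leibniz

variable (E 𝒰) in
/-- The restriction to the members of the cover, as a morphism of Cartan calculi. -/
def resHom : (formsGraded E X).Hom (totGraded E 𝒰) where
  toLin := resTot
  br_eq _ _ := rfl
  map_D η := (dTot_resTot η).symm
  map_I v η := (IM_resTot (fun _ : Fin 1 => v) η).symm
  map_mem := resTot_mem_totDeg

lemma obsDeg_eq_hamDeg (n : ℕ) (ϖ : Forms E (⊤ : TopologicalSpace.Opens X)) :
    obsDeg n ϖ = (formsGraded E X).hamDeg n ((formsGraded E X).negContract ϖ) := by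
  funext i
  refine Submodule.ext fun x => ?_
  rw [obsDeg, mem_hamDeg]
  rcases lt_trichotomy i 0 with hi | rfl | hi
  · rw [if_neg hi.ne, if_neg hi.not_gt, Submodule.mem_bot]
    refine ⟨?_, fun h => Prod.ext (h.2.2.1 hi.ne) (h.2.2.2 hi)⟩
    rintro rfl
    exact ⟨Submodule.zero_mem _, fun h => absurd h hi.ne, fun _ => rfl, fun _ => rfl⟩
  · rw [if_pos rfl, sub_zero]
    refine ⟨fun h => ⟨h.1, fun _ => negContract_eq_iff.2 h.2, fun h => absurd rfl h,
      fun h => absurd h (lt_irrefl _)⟩, fun h => ⟨h.1, negContract_eq_iff.1 (h.2.1 rfl)⟩⟩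
  · rw [if_neg hi.ne', if_pos hi, Submodule.mem_prod, Submodule.mem_bot]
    exact ⟨fun h => ⟨h.2, fun h => absurd h hi.ne', fun _ => h.1, fun h => absurd h hi.not_gt⟩,
      fun h => ⟨h.2.2.1 hi.ne', h.1⟩⟩

lemma quantDeg_eq_hamDeg {n : ℕ} (A : DeligneCochain E 𝒰 n) :
    quantDeg A = (totGraded E 𝒰).hamDeg n A.lie := by
  funext i
  refine Submodule.ext fun x => ?_
  rw [quantDeg, mem_hamDeg]
  rcases lt_trichotomy i 0 with hi | rfl | hi
  · rw [if_neg hi.ne, if_neg hi.not_gt, Submodule.mem_bot]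
    refine ⟨?_, fun h => Prod.ext (h.2.2.1 hi.ne) (h.2.2.2 hi)⟩
    rintro rfl
    exact ⟨Submodule.zero_mem _, fun h => absurd h hi.ne, fun _ => rfl, fun _ => rfl⟩
  · rw [if_pos rfl, sub_zero]
    exact ⟨fun h => ⟨h.1, fun _ => h.2, fun h => absurd rfl h, fun h => absurd h (lt_irrefl _)⟩,
      fun h => ⟨h.1, h.2.1 rfl⟩⟩
  · rw [if_neg hi.ne', if_pos hi, Submodule.mem_prod, Submodule.mem_bot]
    exact ⟨fun h => ⟨h.2, fun h => absurd h hi.ne', fun _ => h.1, fun h => absurd h hi.not_gt⟩,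
      fun h => ⟨h.2.2.1 hi.ne', h.1⟩⟩

lemma quantBracket_eq_hamBracket (x y : QuantAmb E 𝒰) :
    quantBracket x y = (totGraded E 𝒰).hamBracket x y := by
  refine Prod.ext rfl ?_
  change _ - _ = (totCartan E 𝒰).L x.1 y.2 - (totCartan E 𝒰).L y.1 x.2
  rw [totCartan_L, totCartan_L]

section Cocycle

variable {n : ℕ} {A : DeligneCochain E 𝒰 n} {ϖ : Forms E (⊤ : TopologicalSpace.Opens X)}

/-- `𝓛_v Ā = d_Tot (ι_v Ā(1)) + res (ι_v ϖ)`: the contraction of the prequantization condition. -/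
lemma lie_eq_of_isPrequantization (hA : A.IsPrequantization ϖ) (v : VField E X) :
    A.lie v = (totGraded E 𝒰).D ((totGraded E 𝒰).I v A.form) +
      (totGraded E 𝒰).I v ((resHom E 𝒰).toLin ϖ) := by
  change Tot.map d (Tot.map (fun U => ι U v) A.form) + Tot.map (fun U => ι U v) A.dDel =
    dTot (Tot.sgn 1 (Tot.map (fun U => ι U v) A.form)) +
      Tot.sgn 1 (Tot.map (fun U => ι U v) (resTot ϖ))
  have h1 : Tot.sgn 1 (Tot.map (fun U => ι U v) (δ A.form)) +
      δ (Tot.sgn 1 (Tot.map (fun U => ι U v) A.form)) = 0 := by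
    rw [← δ_map _ (fun h η => ι_res h v η), sgn_one_δ]
  rw [← hA.1, dTot_apply, map_add, map_add, ← sgn_map 1 d (Tot.map _ A.form), sgn_one_sgn_one,
    ← sgn_map 1 _ A.dDel, sgn_one_sgn_one]
  have h2 {M : Type _} [AddCommGroup M] {a b p q : M} (h : q + p = 0) :
      a + b = p + a + (q + b) := by
    rw [add_add_add_comm, add_comm p q, h, zero_add]
  exact h2 (M := Tot E 𝒰) h1

/-- `d_Tot` of the form components of `Ā` differs from `ϖ` by the `1`-forms `dlog A^0`, which are
killed by two contractions. -/
lemma contract_contract_dTot_form (hA : A.IsPrequantization ϖ) (v w : VField E X) :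
    (totGraded E 𝒰).I w ((totGraded E 𝒰).I v ((totGraded E 𝒰).D A.form)) =
      (totGraded E 𝒰).I w ((totGraded E 𝒰).I v ((resHom E 𝒰).toLin ϖ)) := by
  change Tot.sgn 1 (Tot.map (fun U => ι U w) (Tot.sgn 1 (Tot.map (fun U => ι U v) (dTot A.form)))) =
    Tot.sgn 1 (Tot.map (fun U => ι U w) (Tot.sgn 1 (Tot.map (fun U => ι U v) (resTot ϖ))))
  rw [← sgn_map, ← sgn_map, sgn_one_sgn_one, sgn_one_sgn_one]
  funext i α k
  have h : (dTot A.form) i α (k + 2) = (resTot ϖ : Tot E 𝒰) i α (k + 2) := by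
    rw [← hA.1, dTot_apply]
    change _ + (-1 : ℝ) ^ (1 * i) • (Tot.map d A.form) i α (k + 2) =
      _ + (-1 : ℝ) ^ (1 * i) • ((Tot.map d A.form) i α (k + 2) + 0)
    rw [add_zero]
  refine Subtype.ext (funext fun x => ?_)
  rw [Tot.map_apply, Tot.map_apply, Tot.map_apply, Tot.map_apply, ι_apply, ι_apply]
  simp only [contractRaw, ι_apply]
  rw [h]

end Cocycle

/-- In positive degree the truncation in the definition of the first bracket has no effect. -/
lemma truncate_eq {n : ℕ} {η : Forms E (⊤ : TopologicalSpace.Opens X)} {i : ℤ} (hi : 0 < i)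
    (hη : η ∈ formsDeg E ⊤ ((n : ℤ) - 1 - i)) :
    (fun k => if k + 1 < n then η k else 0) = η := by
  funext k
  split_ifs with h
  · rfl
  · exact (hη k (by omega)).symm

/-- In degree zero the truncation in the definition of the first bracket removes everything. -/
lemma truncate_eq_zero {n : ℕ} {η : Forms E (⊤ : TopologicalSpace.Opens X)}
    (hη : η ∈ formsDeg E ⊤ ((n : ℤ) - 1)) :
    (fun k => if k + 1 < n then η k else 0) = 0 := by
  funext k
  split_ifs with h
  · exact hη k (by omega)
  · rfl

/-- The brackets of local observables agree with those of the Cartan calculus on homogeneous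
elements. -/
lemma obsBracket_eq_lBracket {n : ℕ} {ϖ : Forms E (⊤ : TopologicalSpace.Opens X)} {k : ℕ}
    (hk : 1 ≤ k) {e : Fin k → ℤ} {x : Fin k → ObsAmb E X} (hx : ∀ a, x a ∈ obsDeg n ϖ (e a)) :
    obsBracket n ϖ k x = (formsGraded E X).lBracket ϖ k x := by
  match k, hk with
  | 1, _ =>
    have hx0 := hx 0
    rw [lBracket_one]
    refine Prod.ext rfl ?_
    change d ⊤ _ = d ⊤ (x 0).2 + ι ⊤ (x 0).1 ϖ
    rw [obsDeg] at hx0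
    rcases lt_trichotomy (e 0) 0 with hi | hi | hi
    · rw [if_neg hi.ne, if_neg hi.not_gt, Submodule.mem_bot] at hx0
      rw [hx0]
      have h0 : (fun k => if k + 1 < n then (0 : ObsAmb E X).2 k else 0) =
          (0 : Forms E (⊤ : TopologicalSpace.Opens X)) := funext fun k => ite_self _
      rw [h0]
      simp
    · rw [if_pos hi] at hx0
      rw [truncate_eq_zero hx0.1, map_zero, add_comm, hx0.2]
    · rw [if_neg hi.ne', if_pos hi] at hx0
      rw [truncate_eq hi hx0.2, show (x 0).1 = 0 from hx0.1, map_zero, LinearMap.zero_apply,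
        add_zero]
  | 2, _ =>
    rw [lBracket_two]
    exact Prod.ext rfl (formsCartan_IM ⊤ _ ϖ).symm
  | k + 3, _ =>
    rw [lBracket_add_three]
    exact Prod.ext rfl (congrArg (ς (k + 3) • ·) (formsCartan_IM ⊤ _ ϖ).symm)

/-- The differential of `dgLie_Qu(X, Ā)` agrees with that of the Cartan calculus on homogeneous
elements; in degree zero both vanish. -/
lemma quantDiff_eq_hamDiff {n : ℕ} {A : DeligneCochain E 𝒰 n} {i : ℤ} {x : QuantAmb E 𝒰}
    (hx : x ∈ quantDeg A i) : quantDiff n x = (totGraded E 𝒰).hamDiff A.lie x := by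
  have hx' := hx
  rw [quantDeg_eq_hamDeg] at hx'
  refine Prod.ext rfl ?_
  rcases lt_trichotomy i 0 with hi | rfl | hi
  · rw [eq_zero_of_neg hx' hi]
    have h0 : (fun i α k => if i + k + 1 < n then (0 : QuantAmb E 𝒰).2 i α k else 0) =
        (0 : Tot E 𝒰) := funext fun i => funext fun α => funext fun k => ite_self _
    change dTot _ = dTot 0 - A.lie 0
    rw [h0, map_zero, map_zero]
    exact (sub_zero (0 : Tot E 𝒰)).symm
  · have h0 : (fun i α k => if i + k + 1 < n then x.2 i α k else 0) = (0 : Tot E 𝒰) := by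
      funext i α k
      split_ifs with h
      · exact hx'.1 i α k (by omega)
      · rfl
    rw [hamDiff_eq_zero hx']
    change dTot _ = 0
    rw [h0, map_zero]
  · have h0 : (fun i α k => if i + k + 1 < n then x.2 i α k else 0) = x.2 := by
      funext i α k
      split_ifs with h
      · rfl
      · exact (hx'.1 i α k (by omega)).symm
    rw [hamDiff_of_ne hx' hi.ne']
    change dTot _ = dTot x.2
    rw [h0]

/-- The components of the `L_∞`-morphism in terms of the sums `S_m`. -/
lemma qMorph_snd_eq {n m : ℕ} (A : DeligneCochain E 𝒰 n) (hm : 1 ≤ m) (x : Fin m → ObsAmb E X) :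
    ((resHom E 𝒰).qMorph A.form m x).2 = ς m • (resTot (S m x) +
      Tot.map (fun U => ιMulti U m fun a => (x a).1) (A.twist m)) := by
  obtain ⟨m, rfl⟩ : ∃ m', m = m' + 1 := ⟨m - 1, by omega⟩
  rw [Hom.qMorph_snd, CartanCalculus.morph_succ]
  refine congrArg (ς (m + 1) • ·) (congrArg₂ (· + ·) ?_ (totCartan_IM _ _))
  rw [S, map_sum, altSum]
  refine (Finset.sum_neg_distrib (G := Tot E 𝒰) _).symm.trans (Finset.sum_congr rfl fun i _ => ?_)
  rw [map_smul, pow_succ, mul_neg_one]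
  refine Eq.trans ?_ (neg_smul (M := Tot E 𝒰) _ _).symm
  refine congrArg (fun z : Tot E 𝒰 => -((-1 : ℝ) ^ (i : ℕ) • z)) ?_
  exact (IM_resTot _ _).trans (congrArg _ (formsCartan_IM ⊤ _ _))

lemma eq_zero_of_mem_totDeg_neg {p : ℤ} (hp : p < 0) {θ : Tot E 𝒰} (h : θ ∈ totDeg E 𝒰 p) :
    θ = 0 :=
  funext fun i => funext fun α => funext fun k => h i α k (by omega)

/-- Beyond arity `n` the components of the `L_∞`-morphism vanish for degree reasons. -/
lemma qMorph_eq_zero {n m : ℕ} (hn : 1 ≤ n) {A : DeligneCochain E 𝒰 n}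
    {ϖ : Forms E (⊤ : TopologicalSpace.Opens X)} (hA : A.IsPrequantization ϖ) (hm : n < m)
    {e : Fin m → ℤ} {x : Fin m → ObsAmb E X} (hx : ∀ a, x a ∈ obsDeg n ϖ (e a)) :
    (resHom E 𝒰).qMorph A.form m x = 0 := by
  rw [obsDeg_eq_hamDeg] at hx
  by_cases he : ∃ a, e a < 0
  · obtain ⟨a, ha⟩ := he
    exact AlternatingMap.map_coord_zero _ a (eq_zero_of_neg (hx a) ha)
  push Not at he
  have h := ((resHom E 𝒰).isGradedSkew_qMorph A.form_deg (negContract_apply _ ϖ)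
    (lie_eq_of_isPrequantization hA) (by omega)).mem e x hx
  have hs : 0 ≤ ∑ a, e a := Finset.sum_nonneg fun a _ => he a
  refine Prod.ext (fst_eq_zero h (by omega)) (eq_zero_of_mem_totDeg_neg ?_ h.1)
  omega

end Concrete

/-! ### Local observables and infinitesimal quantomorphisms -/

section Results

variable {E : Type*} [NormedAddCommGroup E] [NormedSpace ℝ E] [FiniteDimensional ℝ E]
  {X : Type*} [TopologicalSpace X] [ChartedSpace E X] [IsManifold 𝓘(ℝ, E) ∞ X]
  {κ : Type*} {𝒰 : κ → TopologicalSpace.Opens X} {n : ℕ}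
  {ϖ : Forms E (⊤ : TopologicalSpace.Opens X)} {A : DeligneCochain E 𝒰 n}

lemma isLInfty_lBracket_obsDeg (hϖ : IsPrePlectic n ϖ) :
    IsLInfty (obsDeg n ϖ) fun k => (formsGraded E X).lBracket ϖ k := by
  rw [obsDeg_eq_hamDeg]
  exact isLInfty_hamDeg hϖ.2 hϖ.1 (negContract_apply _ ϖ)

theorem isLInfty_obsBracket (hϖ : IsPrePlectic n ϖ) : IsLInfty (obsDeg n ϖ) (obsBracket n ϖ) :=
  (isLInfty_lBracket_obsDeg hϖ).congr fun _ hk _ _ hx => obsBracket_eq_lBracket hk hx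

theorem isDGLie_quantBracket (hϖ : IsPrePlectic n ϖ) (hA : A.IsPrequantization ϖ) :
    IsDGLie (quantDeg A) (quantDiff n) quantBracket := by
  have hdϖ : (totGraded E 𝒰).D ((resHom E 𝒰).toLin ϖ) = 0 := by
    rw [← (resHom E 𝒰).map_D]
    exact (congrArg resTot hϖ.2).trans (map_zero _)
  have h : IsDGLie (quantDeg A) ((totGraded E 𝒰).hamDiff A.lie) (totGraded E 𝒰).hamBracket := by
    rw [quantDeg_eq_hamDeg]
    exact isDGLie_hamDeg (lie_of_contract_eq hdϖ (contract_contract_dTot_form hA)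
      (lie_eq_of_isPrequantization hA))
  exact h.congr (fun _ _ => quantDiff_eq_hamDiff) quantBracket_eq_hamBracket

/-- The components `f_m` of the `L_∞`-morphism, cut off beyond arity `n`. -/
def quantMorph (A : DeligneCochain E 𝒰 n) (m : ℕ) (x : Fin m → ObsAmb E X) : QuantAmb E 𝒰 :=
  if n < m then 0 else (resHom E 𝒰).qMorph A.form m x

lemma quantMorph_one (hn : 1 ≤ n) (x : Fin 1 → ObsAmb E X) : quantMorph A 1 x =
    ((x 0).1, - resTot (x 0).2 + Tot.map (fun U => ι U (x 0).1) (A.twist 1)) := by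
  rw [quantMorph, if_neg hn.not_gt, Hom.qMorph_one]
  exact Prod.ext rfl (congrArg (- resTot (x 0).2 + ·) (sgn_map 1 _ A.form))

lemma quantMorph_of_le {m : ℕ} (hm : 2 ≤ m) (hmn : m ≤ n) (x : Fin m → ObsAmb E X) :
    quantMorph A m x = (0, ς m • (resTot (S m x) +
      Tot.map (fun U => ιMulti U m fun a => (x a).1) (A.twist m))) := by
  rw [quantMorph, if_neg hmn.not_gt]
  refine Prod.ext ?_ (qMorph_snd_eq A (by omega) x)
  rw [Hom.qMorph_fst, Hom.vecPart_of_ne (by omega)]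
  rfl

lemma quantMorph_eq_qMorph (hn : 1 ≤ n) (hA : A.IsPrequantization ϖ) {m : ℕ}
    {e : Fin m → ℤ} {x : Fin m → ObsAmb E X} (hx : ∀ a, x a ∈ obsDeg n ϖ (e a)) :
    quantMorph A m x = (resHom E 𝒰).qMorph A.form m x := by
  rw [quantMorph]
  split_ifs with hm
  · exact (qMorph_eq_zero hn hA hm hx).symm
  · rfl

theorem isLInftyMorphism_quantMorph (hn : 1 ≤ n) (hϖ : IsPrePlectic n ϖ)
    (hA : A.IsPrequantization ϖ) :
    IsLInftyMorphism (obsDeg n ϖ) (obsBracket n ϖ) (quantDeg A) (quantDiff n) quantBracket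
      (quantMorph A) := by
  have h : IsLInftyMorphism (obsDeg n ϖ) (fun k => (formsGraded E X).lBracket ϖ k) (quantDeg A)
      ((totGraded E 𝒰).hamDiff A.lie) (totGraded E 𝒰).hamBracket
      (fun m => (resHom E 𝒰).qMorph A.form m) := by
    rw [obsDeg_eq_hamDeg, quantDeg_eq_hamDeg]
    exact (resHom E 𝒰).isLInftyMorphism_qMorph A.form_deg (negContract_apply _ ϖ)
      (contract_contract_dTot_form hA) (lie_eq_of_isPrequantization hA)
  exact IsLInftyMorphism.congr (isLInfty_lBracket_obsDeg hϖ) h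
    (fun _ hk _ _ hx => obsBracket_eq_lBracket hk hx) (fun _ _ => quantDiff_eq_hamDiff)
    quantBracket_eq_hamBracket fun _ _ _ _ hx => quantMorph_eq_qMorph hn hA hx

theorem isQuasiIso_quantMorph [T2Space X] [SigmaCompactSpace X] (hn : 1 ≤ n)
    (h𝒰 : ∀ x, ∃ a, x ∈ 𝒰 a) (hA : A.IsPrequantization ϖ) :
    IsQuasiIso (V := ObsAmb E X) (V' := QuantAmb E 𝒰) (obsDeg n ϖ)
      (fun x => obsBracket n ϖ 1 ![x]) (quantDeg A) (quantDiff n)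
      (fun x => quantMorph A 1 ![x]) := by
  have h : IsQuasiIso (obsDeg n ϖ) ((formsGraded E X).hamDiff ((formsGraded E X).negContract ϖ))
      (quantDeg A) ((totGraded E 𝒰).hamDiff A.lie)
      (fun x => (x.1, -(resHom E 𝒰).toLin x.2 + (totGraded E 𝒰).I x.1 A.form)) := by
    rw [obsDeg_eq_hamDeg, quantDeg_eq_hamDeg]
    exact (resHom E 𝒰).isQuasiIso_linear_part (fun η => resTot_injective h𝒰)
      (fun p θ hθ η h => exists_eq_resTot_add_dTot h𝒰 hθ h) A.form_deg
      (negContract_apply _ ϖ) (lie_eq_of_isPrequantization hA)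
  refine h.congr (fun i x hx => ?_) (fun _ _ => quantDiff_eq_hamDiff) fun x => ?_
  · rw [obsBracket_eq_lBracket (n := n) le_rfl (e := fun _ => i) (x := ![x])
      fun a => by rwa [Subsingleton.elim a 0]]
    exact lBracket_one_eq_hamDiff _ ϖ ![x] (negContract_apply _ ϖ)
  · rw [quantMorph, if_neg hn.not_gt]
    exact (resHom E 𝒰).qMorph_one ![x]

end Results

end Plectic

end

theorem mainTheorem1 {E : Type*} [NormedAddCommGroup E] [NormedSpace ℝ E] [FiniteDimensional ℝ E]
    {X : Type*} [TopologicalSpace X] [T2Space X] [SigmaCompactSpace X] [ChartedSpace E X]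
    [IsManifold 𝓘(ℝ, E) ∞ X]
    (n : ℕ) (hn : 1 ≤ n)
    (ϖ : Plectic.Forms E (⊤ : TopologicalSpace.Opens X)) (hϖ : Plectic.IsPrePlectic n ϖ)
    {κ : Type*} (𝒰 : κ → TopologicalSpace.Opens X) (h𝒰 : Plectic.IsGoodCover 𝒰)
    (A : Plectic.DeligneCochain E 𝒰 n) (hA : A.IsPrequantization ϖ) :
    Plectic.IsLInfty (Plectic.obsDeg n ϖ) (Plectic.obsBracket n ϖ) ∧
    Plectic.IsDGLie (Plectic.quantDeg A) (Plectic.quantDiff n) Plectic.quantBracket ∧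
    ∃ f : (m : ℕ) → (Fin m → Plectic.ObsAmb E X) → Plectic.QuantAmb E 𝒰,
      (∀ x, f 1 x = ((x 0).1, - Plectic.resTot (x 0).2 +
        Plectic.Tot.map (fun U => Plectic.ι U (x 0).1) (A.twist 1))) ∧
      (∀ m, 2 ≤ m → m ≤ n → ∀ x, f m x = (0, Plectic.ς m • (Plectic.resTot (Plectic.S m x) +
        Plectic.Tot.map (fun U => Plectic.ιMulti U m fun a => (x a).1) (A.twist m)))) ∧
      (∀ m, n < m → ∀ x, f m x = 0) ∧
      Plectic.IsLInftyMorphism (Plectic.obsDeg n ϖ) (Plectic.obsBracket n ϖ)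
        (Plectic.quantDeg A) (Plectic.quantDiff n) Plectic.quantBracket f ∧
      Plectic.IsQuasiIso (V := Plectic.ObsAmb E X) (V' := Plectic.QuantAmb E 𝒰)
        (Plectic.obsDeg n ϖ) (fun x => Plectic.obsBracket n ϖ 1 ![x])
        (Plectic.quantDeg A) (Plectic.quantDiff n) (fun x => f 1 ![x]) :=
  ⟨Plectic.isLInfty_obsBracket hϖ, Plectic.isDGLie_quantBracket hϖ hA, Plectic.quantMorph A,
    Plectic.quantMorph_one hn, fun _ hm hmn x => Plectic.quantMorph_of_le hm hmn x,
    fun _ hm _ => if_pos hm, Plectic.isLInftyMorphism_quantMorph hn hϖ hA,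
    Plectic.isQuasiIso_quantMorph hn h𝒰.1 hA⟩
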